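/- Let $N$ be a smooth (Hausdorff, second countable) manifold of dimension $n$, let $1\le k\le n$, and let $\pi:M=\Lambda^kT^*N\to N$ be the multisymplectic phase space. Put $\theta_\mu(Z_1,\dots,Z_k)=\mu(\pi_*Z_1,\dots,\pi_*Z_k)$ for $\mu\in M$, $\omega=-d\theta$, and $\zeta(m)=-(-1)^{m(m+1)/2}$. For a decomposable multivector $X=X_1\wedge\dots\wedge X_l$ write $X\lrcorner\tau=X_l\lrcorner\cdots\lrcorner X_1\lrcorner\tau=\tau(X_1,\dots,X_l,\cdot)$, extended linearly; forms of negative degree are $0$. *Hamiltonian forms.* For $1\le l\le k$, a smooth $(k-l)$-form $\alpha$ on $M$ is Hamiltonian if there is a smooth $l$-vector field $X_\alpha$ on $M$ with $d\alpha=-X_\alpha\lrcorner\omega$. For Hamiltonian $\alpha,\beta$ with $X_\beta$ of degree $l'$, $\{\alpha,\beta\}=(-1)^{l'+1}X_\beta\lrcorner X_\alpha\lrcorner\omega$; this does not depend on the choice of $X_\alpha,X_\beta$. *Multivector fields on $N$.* Let $\mathfrak X=\Gamma(TN)$, a real Lie algebra, and let $\Lambda^l_{\mathbb R}\mathfrak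 X$ be its exterior power over $\mathbb R$ (finite sums of elements $Y_1\wedge\dots\wedge Y_l$, $Y_i\in\mathfrak X$, which also define $l$-vector fields on $N$). Let $$\partial_l(Y_1\wedge\dots\wedge Y_l)=\sum_{i<j}(-1)^{i+j}[Y_i,Y_j]\wedge Y_1\wedge\dots\widehat{Y_i}\dots\widehat{Y_j}\dots\wedge Y_l ,$$ and let the Lie kernel $\mathcal P_l\subset\Lambda^l_{\mathbb R}\mathfrak X$ consist of those $Y$ for which the $(l-1)$-vector field on $N$ defined by $\partial_lY$ vanishes. The Schouten bracket is the bilinear map $\Lambda^s_{\mathbb R}\mathfrak X\times\Lambda^t_{\mathbb R}\mathfrak X\to\Lambda^{s+t-1}_{\mathbb R}\mathfrak X$ with $$[X_1\wedge\dots\wedge X_s,Y_1\wedge\dots\wedge Y_t]=\sum_{i,j}(-1)^{i+j}[X_i,Y_j]\wedge X_1\wedge\dots\widehat{X_i}\dots\wedge X_s\wedge Y_1\wedge\dots\widehat{Y_j}\dots\wedge Y_t .$$ For $Y\in\Lambda^l_{\mathbb R}\mathfrak X$ the momentum form $P(Y)$ is the $(k-l)$-form on $M$ given, for $Y=Y_1\wedge\dots\wedge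 Y_l$ and linearly in general, by $$P(Y)_\mu(Z_1,\dots,Z_{k-l})=-\zeta(l+1)\,\mu(Y_1,\dots,Y_l,\pi_*Z_1,\dots,\pi_*Z_{k-l}).$$ The complete lift $Y^\sharp$ of $Y\in\mathfrak X$ with local flow $\varphi_t$ is the vector field on $M$ with flow $\mu\mapsto(\varphi_t^*)^{-1}\mu$; one sets $(Y_1\wedge\dots\wedge Y_l)^\sharp=Y_1^\sharp\wedge\dots\wedge Y_l^\sharp$ and extends linearly. **Proposition.** 1. For $1\le l\le k$ and $Y\in\mathcal P_l$, the form $P(Y)$ is a Hamiltonian $(k-l)$-form, and $\zeta(l)Y^\sharp$ is a Hamiltonian multivector field for it: $dP(Y)=-\zeta(l)\,Y^\sharp\lrcorner\omega$. 2. For $1\le s,t\le k$, $Y_1\in\mathcal P_s$ and $Y_2\in\mathcal P_t$, $$\{P(Y_1),P(Y_2)\}=-(-1)^{ts+s+t}P([Y_1,Y_2])+(-1)^{t(s+1)}\zeta(s+1)\zeta(t+1)\,d\big(Y_1^\sharp\lrcorner Y_2^\sharp\lrcorner\theta\big).$$ 3. For $1\le i\le k$ and every smooth $(k-i)$-form $\alpha$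 on $N$, the position form $\pi^*\alpha$ is a Hamiltonian $(k-i)$-form. 4. For $1\le i,j\le k$ and smooth forms $\alpha\in\Omega^{k-i}(N)$, $\beta\in\Omega^{k-j}(N)$, one has $\{\pi^*\alpha,\pi^*\beta\}=0$. 5. For $1\le i,j\le k$, a smooth form $\alpha\in\Omega^{k-i}(N)$ and $Y\in\mathcal P_j$, $$\{\pi^*\alpha,P(Y)\}=(-1)^j\zeta(j)\,\pi^*(Y\lrcorner d\alpha).$$ -/

import Mathlib

open Bundle Set
open scoped Manifold ContDiff Topology

noncomputable section

namespace MultiPhase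

section Algebra

variable {R L : Type*} [CommRing R] [LieRing L] [LieAlgebra R L]

local notation "Λ" => ExteriorAlgebra R L

/-- The wedge product `ξ₁ ∧ ⋯ ∧ ξₗ` of a list of elements. -/
def wedge (R : Type*) {L : Type*} [CommRing R] [AddCommGroup L] [Module R L] (l : List L) :
    ExteriorAlgebra R L :=
  (l.map (ExteriorAlgebra.ι R)).prod

@[simp] theorem wedge_nil : wedge R ([] : List L) = 1 := rfl

@[simp] theorem wedge_cons (a : L) (l : List L) :
    wedge R (a :: l) = ExteriorAlgebra.ι R a * wedge R l := by simp [wedge]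

theorem ι_anticomm (a b : L) :
    ExteriorAlgebra.ι R a * ExteriorAlgebra.ι R b =
      -(ExteriorAlgebra.ι R b * ExteriorAlgebra.ι R a) :=
  eq_neg_of_add_eq_zero_left (ExteriorAlgebra.ι_add_mul_swap a b)

theorem ι_anticomm_assoc (a b : L) (x : Λ) :
    ExteriorAlgebra.ι R a * (ExteriorAlgebra.ι R b * x) =
      -(ExteriorAlgebra.ι R b * (ExteriorAlgebra.ι R a * x)) := by
  rw [← mul_assoc, ι_anticomm, neg_mul, mul_assoc]

theorem ι_sq_assoc (a : L) (x : Λ) :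
    ExteriorAlgebra.ι R a * (ExteriorAlgebra.ι R a * x) = 0 := by
  rw [← mul_assoc, ExteriorAlgebra.ι_sq_zero, zero_mul]

/-- Two linear maps on the exterior algebra agree if they agree on wedge products. -/
theorem linearMap_ext_wedge {N : Type*} [AddCommGroup N] [Module R N] {f g : Λ →ₗ[R] N}
    (h : ∀ l : List L, f (wedge R l) = g (wedge R l)) : f = g := by
  refine LinearMap.ext fun x => ?_
  have hx : x ∈ Submodule.span R (Set.range (fun l : List L => wedge R l)) := by
    induction x using CliffordAlgebra.left_induction with
    | algebraMap r =>
      rw [Algebra.algebraMap_eq_smul_one]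
      exact Submodule.smul_mem _ _ (Submodule.subset_span ⟨[], rfl⟩)
    | add x y hx hy => exact Submodule.add_mem _ hx hy
    | ι_mul x m hx =>
      induction hx using Submodule.span_induction with
      | mem x hx =>
        obtain ⟨l, rfl⟩ := hx
        exact Submodule.subset_span ⟨m :: l, wedge_cons m l⟩
      | zero => simp
      | add x y _ _ hx hy => rw [mul_add]; exact Submodule.add_mem _ hx hy
      | smul c x _ hx => rw [mul_smul_comm]; exact Submodule.smul_mem _ _ hx
  induction hx using Submodule.span_induction with
  | mem x hx => obtain ⟨l, rfl⟩ := hx; exact h l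
  | zero => simp
  | add x y _ _ hx hy => simp [hx, hy]
  | smul c x _ hx => simp [hx]

/-- The recursion step `(m, (x, y)) ↦ [ξ, m] ∧ x + m ∧ y` of the adjoint action. -/
def adStep (ξ : L) : L →ₗ[R] (Λ × Λ) →ₗ[R] Λ :=
  LinearMap.mk₂ R
    (fun m p => ExteriorAlgebra.ι R ⁅ξ, m⁆ * p.1 + ExteriorAlgebra.ι R m * p.2)
    (by intro a b p; simp only [lie_add, map_add, add_mul]; abel)
    (by intro c a p; simp [lie_smul])
    (by intro a p q; simp only [Prod.fst_add, Prod.snd_add, mul_add]; abel)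
    (by intro c a p; simp)

theorem adStep_apply (ξ m : L) (x y : Λ) :
    adStep ξ m (x, y) = ExteriorAlgebra.ι R ⁅ξ, m⁆ * x + ExteriorAlgebra.ι R m * y := rfl

theorem adStep_adStep (ξ m : L) (x y : Λ) :
    adStep ξ m (ExteriorAlgebra.ι R m * x, adStep ξ m (x, y)) = (0 : QuadraticForm R L) m • y := by
  rw [adStep_apply, adStep_apply, mul_add, ι_sq_assoc, ι_anticomm_assoc]
  simp

/-- The adjoint action of `ξ` on the exterior algebra: the linear map with `ad_ξ 1 = 0` and
`ad_ξ (m ∧ x) = [ξ, m] ∧ x + m ∧ ad_ξ x`. -/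
def adExt (ξ : L) : Λ →ₗ[R] Λ :=
  CliffordAlgebra.foldr' (0 : QuadraticForm R L) (adStep ξ) (adStep_adStep ξ) 0

@[simp] theorem adExt_one (ξ : L) : adExt (R := R) ξ 1 = 0 := by
  have h := CliffordAlgebra.foldr'_algebraMap (0 : QuadraticForm R L) (adStep ξ)
    (adStep_adStep ξ) 0 1
  rw [map_one, smul_zero] at h
  exact h

@[simp] theorem adExt_ι_mul (ξ m : L) (x : Λ) :
    adExt ξ (ExteriorAlgebra.ι R m * x) =
      ExteriorAlgebra.ι R ⁅ξ, m⁆ * x + ExteriorAlgebra.ι R m * adExt ξ x :=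
  CliffordAlgebra.foldr'_ι_mul (0 : QuadraticForm R L) (adStep ξ) (adStep_adStep ξ) 0 m x

theorem adExt_add (ξ η : L) : adExt (R := R) (ξ + η) = adExt ξ + adExt η := by
  refine linearMap_ext_wedge fun l => ?_
  induction l with
  | nil => simp
  | cons a l ih =>
    rw [LinearMap.add_apply] at ih
    simp only [wedge_cons, adExt_ι_mul, ih, LinearMap.add_apply, add_lie, map_add, add_mul,
      mul_add]
    abel

theorem adExt_smul (c : R) (ξ : L) : adExt (R := R) (c • ξ) = c • adExt ξ := by
  refine linearMap_ext_wedge fun l => ?_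
  induction l with
  | nil => simp
  | cons a l ih =>
    rw [LinearMap.smul_apply] at ih
    simp [ih]

/-- The recursion step `(m, (x, y)) ↦ -(m ∧ y) - ad_m x` of the Chevalley–Eilenberg
differential. -/
def boundaryStep : L →ₗ[R] (Λ × Λ) →ₗ[R] Λ :=
  LinearMap.mk₂ R
    (fun m p => -(ExteriorAlgebra.ι R m * p.2) - adExt m p.1)
    (by intro a b p; simp only [map_add, add_mul, adExt_add, LinearMap.add_apply]; abel)
    (by intro c a p; simp [adExt_smul, smul_sub])
    (by intro a p q; simp only [Prod.fst_add, Prod.snd_add, mul_add, map_add]; abel)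
    (by intro c a p; simp [smul_sub])

theorem boundaryStep_apply (m : L) (x y : Λ) :
    boundaryStep m (x, y) = -(ExteriorAlgebra.ι R m * y) - adExt m x := rfl

theorem boundaryStep_boundaryStep (m : L) (x y : Λ) :
    boundaryStep m (ExteriorAlgebra.ι R m * x, boundaryStep m (x, y)) =
      (0 : QuadraticForm R L) m • y := by
  rw [boundaryStep_apply, boundaryStep_apply, mul_sub, mul_neg, ι_sq_assoc, adExt_ι_mul]
  simp

variable (R L) in
/-- The Chevalley–Eilenberg differential `∂` on the exterior algebra of a Lie algebra. It is
constructed by recursion on the wedge products; `ceBoundary_wedge` is the usual formula. -/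
def ceBoundary : Λ →ₗ[R] Λ :=
  CliffordAlgebra.foldr' (0 : QuadraticForm R L) boundaryStep boundaryStep_boundaryStep 0

@[simp] theorem ceBoundary_one : ceBoundary R L 1 = 0 := by
  have h := CliffordAlgebra.foldr'_algebraMap (0 : QuadraticForm R L) boundaryStep
    boundaryStep_boundaryStep 0 1
  rw [map_one, smul_zero] at h
  exact h

@[simp] theorem ceBoundary_ι_mul (m : L) (x : Λ) :
    ceBoundary R L (ExteriorAlgebra.ι R m * x) =
      -(ExteriorAlgebra.ι R m * ceBoundary R L x) - adExt m x :=
  CliffordAlgebra.foldr'_ι_mul (0 : QuadraticForm R L) boundaryStep boundaryStep_boundaryStep 0 m x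

/-- `ad_ξ (ξ₁ ∧ ⋯ ∧ ξₗ) = ∑ⱼ (-1)ʲ [ξ, ξⱼ] ∧ ξ₁ ∧ ⋯ ξ̂ⱼ ⋯ ∧ ξₗ`, with `j` counted from `0`. -/
theorem adExt_wedge (ξ : L) (l : List L) :
    adExt ξ (wedge R l) = ∑ j : Fin l.length,
      (-1 : R) ^ (j : ℕ) • (ExteriorAlgebra.ι R ⁅ξ, l[j]⁆ * wedge R (l.eraseIdx j)) := by
  induction l with
  | nil => simp
  | cons a l ih =>
    rw [wedge_cons, adExt_ι_mul, ih, Finset.mul_sum]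
    refine Eq.trans ?_ (Fin.sum_univ_succ (n := l.length) _).symm
    congr 1
    · simp
    · refine Finset.sum_congr rfl fun j _ => ?_
      simp [pow_succ, ι_anticomm_assoc a]

/-- The formula for the Chevalley–Eilenberg differential:
`∂ (ξ₁ ∧ ⋯ ∧ ξₗ) = ∑_{i < j} (-1)^(i+j) [ξᵢ, ξⱼ] ∧ ξ₁ ∧ ⋯ ξ̂ᵢ ⋯ ξ̂ⱼ ⋯ ∧ ξₗ`. -/
theorem ceBoundary_wedge (l : List L) :
    ceBoundary R L (wedge R l) = ∑ i : Fin l.length, ∑ j : Fin l.length,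
      if i < j then (-1 : R) ^ ((i : ℕ) + (j : ℕ)) •
        (ExteriorAlgebra.ι R ⁅l[i], l[j]⁆ * wedge R ((l.eraseIdx j).eraseIdx i)) else 0 := by
  induction l with
  | nil => simp
  | cons a l ih =>
    rw [wedge_cons, ceBoundary_ι_mul, ih, adExt_wedge, sub_eq_add_neg, add_comm]
    refine Eq.trans ?_ (Fin.sum_univ_succ (n := l.length) _).symm
    congr 1
    · refine Eq.trans ?_ (Fin.sum_univ_succ (n := l.length) _).symm
      rw [← Finset.sum_neg_distrib]
      simp [pow_succ]
    · rw [Finset.mul_sum, ← Finset.sum_neg_distrib]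
      refine Finset.sum_congr rfl fun i _ => ?_
      refine Eq.trans ?_ (Fin.sum_univ_succ (n := l.length) _).symm
      rw [Finset.mul_sum, ← Finset.sum_neg_distrib]
      simp only [Fin.not_lt_zero, if_false, zero_add]
      refine Finset.sum_congr rfl fun j _ => ?_
      by_cases h : i < j
      · have e : (-1 : R) ^ ((i : ℕ) + 1 + ((j : ℕ) + 1)) = (-1) ^ ((i : ℕ) + (j : ℕ)) := by
          rw [show (i : ℕ) + 1 + ((j : ℕ) + 1) = (i : ℕ) + j + 2 by ring, pow_add]; simp
        simp [h, e, ι_anticomm_assoc a]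
      · simp [h]

/-- The recursion step `(m, (x, y)) ↦ m ∧ y + (-1)^|x| x ∧ ad_m Y` of the Schouten bracket. -/
def schoutenStep (Y : Λ) : L →ₗ[R] (Λ × Λ) →ₗ[R] Λ :=
  LinearMap.mk₂ R
    (fun m p => ExteriorAlgebra.ι R m * p.2 +
      CliffordAlgebra.involute (Q := (0 : QuadraticForm R L)) p.1 * adExt m Y)
    (by intro a b p; simp only [map_add, add_mul, adExt_add, LinearMap.add_apply, mul_add]; abel)
    (by intro c a p; simp [adExt_smul])
    (by intro a p q; simp only [Prod.fst_add, Prod.snd_add, mul_add, map_add, add_mul]; abel)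
    (by intro c a p; simp)

theorem schoutenStep_apply (Y : Λ) (m : L) (x y : Λ) :
    schoutenStep Y m (x, y) = ExteriorAlgebra.ι R m * y +
      CliffordAlgebra.involute (Q := (0 : QuadraticForm R L)) x * adExt m Y := rfl

theorem schoutenStep_schoutenStep (Y : Λ) (m : L) (x y : Λ) :
    schoutenStep Y m (ExteriorAlgebra.ι R m * x, schoutenStep Y m (x, y)) =
      (0 : QuadraticForm R L) m • y := by
  rw [schoutenStep_apply, schoutenStep_apply, mul_add, ι_sq_assoc, map_mul,
    show CliffordAlgebra.involute (Q := (0 : QuadraticForm R L)) (ExteriorAlgebra.ι R m) =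
      -ExteriorAlgebra.ι R m from CliffordAlgebra.involute_ι m]
  simp [mul_assoc]

/-- The Schouten bracket on the exterior algebra of a Lie algebra. It is constructed by recursion
on the first argument; `schouten_wedge` is the usual formula. -/
def schouten (X Y : Λ) : Λ :=
  CliffordAlgebra.foldr' (0 : QuadraticForm R L) (schoutenStep Y) (schoutenStep_schoutenStep Y) 0 X

@[simp] theorem schouten_one (Y : Λ) : schouten 1 Y = 0 := by
  have h := CliffordAlgebra.foldr'_algebraMap (0 : QuadraticForm R L) (schoutenStep Y)
    (schoutenStep_schoutenStep Y) 0 1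
  rw [map_one, smul_zero] at h
  exact h

@[simp] theorem schouten_ι_mul (m : L) (x Y : Λ) :
    schouten (ExteriorAlgebra.ι R m * x) Y = ExteriorAlgebra.ι R m * schouten x Y +
      CliffordAlgebra.involute (Q := (0 : QuadraticForm R L)) x * adExt m Y :=
  CliffordAlgebra.foldr'_ι_mul (0 : QuadraticForm R L) (schoutenStep Y)
    (schoutenStep_schoutenStep Y) 0 m x

theorem involute_wedge (l : List L) :
    CliffordAlgebra.involute (Q := (0 : QuadraticForm R L)) (wedge R l) =
      (-1 : R) ^ l.length • wedge R l := by
  induction l with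
  | nil => simp
  | cons a l ih =>
    rw [wedge_cons, map_mul, ih,
      show CliffordAlgebra.involute (Q := (0 : QuadraticForm R L)) (ExteriorAlgebra.ι R a) =
      -ExteriorAlgebra.ι R a from CliffordAlgebra.involute_ι a]
    simp [pow_succ]

theorem wedge_mul_ι_mul (l : List L) (m : L) (x : Λ) :
    wedge R l * (ExteriorAlgebra.ι R m * x) =
      (-1 : R) ^ l.length • (ExteriorAlgebra.ι R m * (wedge R l * x)) := by
  induction l with
  | nil => simp
  | cons a l ih =>
    rw [wedge_cons, mul_assoc, ih, mul_smul_comm, ι_anticomm_assoc]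
    simp [pow_succ, mul_assoc]

/-- The formula for the Schouten bracket: `[X, Y] = ∑ᵢ ∑ⱼ (-1)^(i+j)
[Xᵢ, Yⱼ] ∧ X₁ ∧ ⋯ X̂ᵢ ⋯ ∧ Xₖ ∧ Y₁ ∧ ⋯ Ŷⱼ ⋯ ∧ Yₗ`
for `X = X₁ ∧ ⋯ ∧ Xₖ` and `Y = Y₁ ∧ ⋯ ∧ Yₗ`. -/
theorem schouten_wedge (X Y : List L) :
    schouten (wedge R X) (wedge R Y) = ∑ i : Fin X.length, ∑ j : Fin Y.length,
      (-1 : R) ^ ((i : ℕ) + (j : ℕ)) • (ExteriorAlgebra.ι R ⁅X[i], Y[j]⁆ *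
        wedge R (X.eraseIdx i) * wedge R (Y.eraseIdx j)) := by
  induction X with
  | nil => simp
  | cons a X ih =>
    rw [wedge_cons, schouten_ι_mul, ih, adExt_wedge, add_comm, involute_wedge]
    refine Eq.trans ?_ (Fin.sum_univ_succ (n := X.length) _).symm
    congr 1
    · rw [Finset.mul_sum]
      refine Finset.sum_congr rfl fun j _ => ?_
      simp only [Algebra.smul_mul_assoc, Algebra.mul_smul_comm, wedge_mul_ι_mul, smul_smul]
      have e : (-1 : R) ^ X.length * (-1) ^ X.length = 1 := by rw [← mul_pow]; simp
      simp [e, mul_assoc]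
    · rw [Finset.mul_sum]
      refine Finset.sum_congr rfl fun i _ => ?_
      rw [Finset.mul_sum]
      refine Finset.sum_congr rfl fun j _ => ?_
      simp [pow_succ, pow_add, mul_assoc, ι_anticomm_assoc a]

end Algebra

section
variable {E F G : Type*} [NormedAddCommGroup E] [NormedSpace ℝ E] [NormedAddCommGroup F]
  [NormedSpace ℝ F] [NormedAddCommGroup G] [NormedSpace ℝ G] {k : ℕ}

/-- Antisymmetrization of continuous multilinear maps, as a continuous linear map. -/
def alternatizationCLM (E G : Type*) [NormedAddCommGroup E] [NormedSpace ℝ E]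
    [NormedAddCommGroup G] [NormedSpace ℝ G] (k : ℕ) :
    ContinuousMultilinearMap ℝ (fun _ : Fin k => E) G →L[ℝ] (E [⋀^Fin k]→L[ℝ] G) :=
  LinearMap.mkContinuous
    { toFun := fun f => ContinuousMultilinearMap.alternatization f
      map_add' := fun f g => map_add _ f g
      map_smul' := fun c f => by
        ext v
        refine (ContinuousMultilinearMap.alternatization_apply_apply _ v).trans ?_
        refine Eq.trans ?_ (congrArg (fun x => c • x)
          (ContinuousMultilinearMap.alternatization_apply_apply f v).symm)
        rw [Finset.smul_sum]
        exact Finset.sum_congr rfl fun σ _ => smul_comm (Equiv.Perm.sign σ) c (f (v ∘ σ)) }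
    (Fintype.card (Equiv.Perm (Fin k)))
    (fun f => by
      refine ContinuousAlternatingMap.opNorm_le_bound _
        (mul_nonneg (Nat.cast_nonneg _) (norm_nonneg _)) fun v => ?_
      simp only [LinearMap.coe_mk, AddHom.coe_mk,
        ContinuousMultilinearMap.alternatization_apply_apply]
      refine (norm_sum_le _ _).trans ?_
      have h : ∀ σ ∈ (Finset.univ : Finset (Equiv.Perm (Fin k))),
          ‖Equiv.Perm.sign σ • f (v ∘ σ)‖ ≤ ‖f‖ * ∏ i, ‖v i‖ := by
        intro σ _
        have h1 : ‖Equiv.Perm.sign σ • f (v ∘ σ)‖ = ‖f (v ∘ σ)‖ := by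
          rcases Int.units_eq_one_or (Equiv.Perm.sign σ) with h | h <;> simp [h]
        rw [h1, ← Equiv.prod_comp σ fun i => ‖v i‖]
        exact f.le_opNorm _
      refine (Finset.sum_le_sum h).trans (le_of_eq ?_)
      rw [Finset.sum_const, nsmul_eq_mul, Finset.card_univ, mul_assoc])

theorem contDiff_compContinuousLinearMapCLM {n : WithTop ℕ∞} :
    ContDiff ℝ n (ContinuousAlternatingMap.compContinuousLinearMapCLM :
      (E →L[ℝ] F) → (F [⋀^Fin k]→L[ℝ] G) →L[ℝ] (E [⋀^Fin k]→L[ℝ] G)) := by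
  have key : (ContinuousAlternatingMap.compContinuousLinearMapCLM :
      (E →L[ℝ] F) → (F [⋀^Fin k]→L[ℝ] G) →L[ℝ] (E [⋀^Fin k]→L[ℝ] G)) = fun g =>
      ((k.factorial : ℝ)⁻¹ • alternatizationCLM E G k).comp
        ((ContinuousMultilinearMap.compContinuousLinearMapContinuousMultilinear ℝ
          (fun _ : Fin k => E) (fun _ => F) G (fun _ => g)).comp
          (ContinuousAlternatingMap.toContinuousMultilinearMapCLM ℝ)) := by
    funext g
    ext f v
    have h : ∀ σ : Equiv.Perm (Fin k), Equiv.Perm.sign σ • f (fun i => g (v (σ i))) =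
        f (fun i => g (v i)) := fun σ => by
      have h1 := f.toAlternatingMap.map_perm (fun i => g (v i)) σ
      have h2 : f (fun i => g (v (σ i))) = Equiv.Perm.sign σ • f (fun i => g (v i)) := h1
      rw [h2, smul_smul, Int.units_mul_self, one_smul]
    have h3 : alternatizationCLM E G k
        ((ContinuousMultilinearMap.compContinuousLinearMapContinuousMultilinear ℝ
          (fun _ : Fin k => E) (fun _ => F) G (fun _ => g)) f.toContinuousMultilinearMap) v =
        k.factorial • f (fun i => g (v i)) := by
      refine (ContinuousMultilinearMap.alternatization_apply_apply _ v).trans ?_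
      refine (Finset.sum_congr rfl fun σ _ => h σ).trans ?_
      rw [Finset.sum_const, Finset.card_univ, Fintype.card_perm, Fintype.card_fin]
    refine Eq.trans ?_ (congrArg (fun x => (k.factorial : ℝ)⁻¹ • x) h3.symm)
    rw [← Nat.cast_smul_eq_nsmul ℝ, smul_smul, inv_mul_cancel₀ (by positivity), one_smul]
    rfl
  rw [key]
  refine contDiff_const.clm_comp (ContDiff.clm_comp ?_ contDiff_const)
  exact (ContinuousMultilinearMap.contDiff _).comp (contDiff_pi.2 fun _ => contDiff_id)

theorem contDiff_compContinuousAlternatingMapCLM {n : WithTop ℕ∞} :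
    ContDiff ℝ n (fun g : F →L[ℝ] G =>
      (ContinuousLinearMap.compContinuousAlternatingMapCLM ℝ E F G (Fin k) g :
        (E [⋀^Fin k]→L[ℝ] F) →L[ℝ] (E [⋀^Fin k]→L[ℝ] G))) :=
  ContinuousLinearMap.contDiff _
end

section Bundle

variable {k : ℕ} {B F₁ F₂ : Type*} {n : WithTop ℕ∞} {E₁ : B → Type*} {E₂ : B → Type*}
  [∀ x, AddCommGroup (E₁ x)] [∀ x, Module ℝ (E₁ x)] [NormedAddCommGroup F₁] [NormedSpace ℝ F₁]
  [TopologicalSpace (TotalSpace F₁ E₁)] [∀ x, TopologicalSpace (E₁ x)] [∀ x, AddCommGroup (E₂ x)]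
  [∀ x, Module ℝ (E₂ x)] [NormedAddCommGroup F₂] [NormedSpace ℝ F₂]
  [TopologicalSpace (TotalSpace F₂ E₂)] [∀ x, TopologicalSpace (E₂ x)]
  {EB : Type*} [NormedAddCommGroup EB] [NormedSpace ℝ EB] {HB : Type*} [TopologicalSpace HB]
  {IB : ModelWithCorners ℝ EB HB} [TopologicalSpace B] [ChartedSpace HB B]
  [FiberBundle F₁ E₁] [VectorBundle ℝ F₁ E₁] [FiberBundle F₂ E₂] [VectorBundle ℝ F₂ E₂]
  [∀ x, IsTopologicalAddGroup (E₂ x)] [∀ x, ContinuousSMul ℝ (E₂ x)]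
  [ContMDiffVectorBundle n F₁ E₁ IB] [ContMDiffVectorBundle n F₂ E₂ IB]

/-- The bundle of alternating maps between two smooth vector bundles is smooth. -/
instance contMDiffVectorBundle_continuousAlternatingMap :
    ContMDiffVectorBundle n (F₁ [⋀^Fin k]→L[ℝ] F₂) (fun b : B => E₁ b [⋀^Fin k]→L[ℝ] E₂ b) IB :=
  have : (Bundle.ContinuousAlternatingMap.vectorPrebundle
      ℝ (Fin k) F₁ E₁ F₂ E₂).IsContMDiff IB n := by
    refine ⟨?_⟩
    rintro _ ⟨e₁, e₂, he₁, he₂, rfl⟩ _ ⟨e₁', e₂', he₁', he₂', rfl⟩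
    refine ⟨Pretrivialization.continuousAlternatingMapCoordChange ℝ (Fin k) e₁ e₁' e₂ e₂', ?_,
      Pretrivialization.continuousAlternatingMapCoordChange_apply⟩
    have h₁ := contMDiffOn_coordChangeL (IB := IB) e₁' e₁ (n := n)
    have h₂ := contMDiffOn_coordChangeL (IB := IB) e₂ e₂' (n := n)
    have hs : e₁.baseSet ∩ e₂.baseSet ∩ (e₁'.baseSet ∩ e₂'.baseSet) ⊆
      e₁'.baseSet ∩ e₁.baseSet := by mfld_set_tac
    have hs' : e₁.baseSet ∩ e₂.baseSet ∩ (e₁'.baseSet ∩ e₂'.baseSet) ⊆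
      e₂.baseSet ∩ e₂'.baseSet := by mfld_set_tac
    have g₁ := (contDiff_compContinuousLinearMapCLM (E := F₁) (F := F₁) (G := F₂) (k := k)
      (n := n)).contMDiff.comp_contMDiffOn (h₁.mono hs)
    have g₂ := (contDiff_compContinuousAlternatingMapCLM (E := F₁) (F := F₂) (G := F₂) (k := k)
      (n := n)).contMDiff.comp_contMDiffOn (h₂.mono hs')
    exact g₂.clm_comp g₁
  (Bundle.ContinuousAlternatingMap.vectorPrebundle
    ℝ (Fin k) F₁ E₁ F₂ E₂).contMDiffVectorBundle IB

end Bundle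

section Forms

variable {V W : Type*} [AddCommGroup V] [Module ℝ V] [TopologicalSpace V]
  [AddCommGroup W] [Module ℝ W] [TopologicalSpace W]

/-- Alternating forms of all degrees on a vector space: the component `α m` is an alternating
`m`-form. A form of degree `p` is one whose components of degree `m ≠ p` vanish. -/
abbrev GradedForms (V : Type*) [AddCommGroup V] [Module ℝ V] [TopologicalSpace V] : Type _ :=
  ∀ m : ℕ, V [⋀^Fin m]→L[ℝ] ℝ

/-- The interior product `(v ⌟ α)(w₁, …, w_m) = α (v, w₁, …, w_m)`; it kills `0`-forms, as
they are not the degree `m + 1` component of `α` for any `m`. -/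
def interior : V →ₗ[ℝ] GradedForms V →ₗ[ℝ] GradedForms V :=
  LinearMap.mk₂ ℝ
    (fun v α m =>
      { (α (m + 1)).toAlternatingMap.curryLeft v with
        cont := (α (m + 1)).cont.comp (continuous_const.finCons continuous_id) })
    (by
      intro v v' α; funext m; ext w
      exact DFunLike.congr_fun (map_add (α (m + 1)).toAlternatingMap.curryLeft v v') w)
    (by
      intro c v α; funext m; ext w
      exact DFunLike.congr_fun (map_smul (α (m + 1)).toAlternatingMap.curryLeft c v) w)
    (fun _ _ _ => rfl)
    (fun _ _ _ => rfl)

@[simp] theorem interior_apply (v : V) (α : GradedForms V) (m : ℕ) (w : Fin m → V) :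
    interior v α m w = α (m + 1) (Fin.cons v w) := rfl

theorem interior_interior (v : V) (α : GradedForms V) : interior v (interior v α) = 0 := by
  funext m
  ext w
  rw [interior_apply, interior_apply]
  exact (α (m + 1 + 1)).map_eq_zero_of_eq _ (i := 0) (j := 1) rfl (by simp)

/-- The contraction of a form by a multivector,
`(X₁ ∧ ⋯ ∧ Xₗ) ⌟ α = Xₗ ⌟ ⋯ ⌟ X₁ ⌟ α = α (X₁, …, Xₗ, …)`. -/
def contract (X : ExteriorAlgebra ℝ V) : GradedForms V →ₗ[ℝ] GradedForms V :=
  (ExteriorAlgebra.lift ℝ (A := (Module.End ℝ (GradedForms V))ᵐᵒᵖ)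
    ⟨(MulOpposite.opLinearEquiv ℝ).toLinearMap ∘ₗ interior, fun v => by
      refine MulOpposite.unop_injective (LinearMap.ext fun α => ?_)
      exact interior_interior v α⟩ X).unop

@[simp] theorem contract_one (α : GradedForms V) : contract (1 : ExteriorAlgebra ℝ V) α = α := by
  simp [contract]

@[simp] theorem contract_ι (v : V) (α : GradedForms V) :
    contract (ExteriorAlgebra.ι ℝ v) α = interior v α := by
  simp [contract]

theorem contract_mul (X Y : ExteriorAlgebra ℝ V) (α : GradedForms V) :
    contract (X * Y) α = contract Y (contract X α) := by
  simp [contract]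

theorem contract_add (X Y : ExteriorAlgebra ℝ V) (α : GradedForms V) :
    contract (X + Y) α = contract X α + contract Y α := by
  simp [contract]

theorem contract_smul (c : ℝ) (X : ExteriorAlgebra ℝ V) (α : GradedForms V) :
    contract (c • X) α = c • contract X α := by
  simp [contract]

/-- The pullback of forms by a linear map. -/
def pullback (f : V →L[ℝ] W) : GradedForms W →ₗ[ℝ] GradedForms V where
  toFun α m := (α m).compContinuousLinearMap f
  map_add' _ _ := rfl
  map_smul' _ _ := rfl

end Forms

section Fields

variable {E H : Type*} [NormedAddCommGroup E] [NormedSpace ℝ E] [TopologicalSpace H]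
  {I : ModelWithCorners ℝ E H} {M : Type*} [TopologicalSpace M] [ChartedSpace H M] [IsManifold I ∞ M]

variable (I M) in
/-- Smooth vector fields. -/
abbrev VF : Type _ := Cₛ^∞⟮I; E, (TangentSpace I : M → Type _)⟯

theorem VF.mdifferentiableAt (X : VF I M) (x : M) :
    MDifferentiableAt I I.tangent (fun y => (X y : TangentBundle I M)) x :=
  X.contMDiff.contMDiffAt.mdifferentiableAt (by simp)

variable [CompleteSpace E]

/-- The Lie bracket of smooth vector fields. -/
instance : Bracket (VF I M) (VF I M) where
  bracket X Y :=
    { toFun := VectorField.mlieBracket I X Y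
      contMDiff_toFun := fun x => by
        have : IsManifold I (((⊤ : ℕ∞) : WithTop ℕ∞) + 1) M := by
          simpa using (inferInstance : IsManifold I ∞ M)
        have : IsManifold I (minSmoothness ℝ 2) M := by
          simpa using (inferInstance : IsManifold I 2 M)
        exact ContMDiffAt.mlieBracket_vectorField (m := ⊤) (n := ⊤) X.contMDiff.contMDiffAt
          Y.contMDiff.contMDiffAt (by simp) }

theorem VF.coe_bracket (X Y : VF I M) : ⇑⁅X, Y⁆ = VectorField.mlieBracket I X Y := rfl

/-- Smooth vector fields form a Lie ring. -/
instance : LieRing (VF I M) where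
  add_lie X Y Z := by
    ext x
    exact VectorField.mlieBracket_add_left (X.mdifferentiableAt x) (Y.mdifferentiableAt x)
  lie_add X Y Z := by
    ext x
    exact VectorField.mlieBracket_add_right (Y.mdifferentiableAt x) (Z.mdifferentiableAt x)
  lie_self X := by
    ext x
    exact congrFun VectorField.mlieBracket_self x
  leibniz_lie X Y Z := by
    have : IsManifold I (minSmoothness ℝ 3) M := by
      simpa using (inferInstance : IsManifold I 3 M)
    have h (X : VF I M) (x : M) : ContMDiffAt I I.tangent (minSmoothness ℝ 2)
        (fun y => (X y : TangentBundle I M)) x := by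
      simpa using X.contMDiff.contMDiffAt.of_le (WithTop.coe_le_coe.2 (le_top : (2 : ℕ∞) ≤ ⊤))
    ext x
    exact VectorField.leibniz_identity_mlieBracket_apply (h X x) (h Y x) (h Z x)

/-- Smooth vector fields form a real Lie algebra. -/
instance : LieAlgebra ℝ (VF I M) where
  lie_smul c X Y := by
    ext x
    exact VectorField.mlieBracket_const_smul_right (Y.mdifferentiableAt x)

/-- The value at a point of an element of the exterior algebra of the real vector space of
vector fields: `(X₁ ∧ ⋯ ∧ Xₗ) x = X₁ x ∧ ⋯ ∧ Xₗ x`. -/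
def evalAt (x : M) : ExteriorAlgebra ℝ (VF I M) →ₐ[ℝ] ExteriorAlgebra ℝ (TangentSpace I x) :=
  ExteriorAlgebra.map
    { toFun := fun X => X x
      map_add' := fun _ _ => rfl
      map_smul' := fun _ _ => rfl }

/-- The Schouten bracket on the exterior algebra of the Lie algebra of vector fields. -/
def schoutenVF (X Y : ExteriorAlgebra ℝ (VF I M)) : ExteriorAlgebra ℝ (VF I M) :=
  schouten X Y

variable (I M) in
/-- The `l`-th Lie kernel: the kernel of the Chevalley–Eilenberg differential `∂`, from the `l`-th
exterior power of the Lie algebra of vector fields to the multivector fields of degree `l - 1`. -/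
def lieKernel (l : ℕ) : Set (ExteriorAlgebra ℝ (VF I M)) :=
  {Y | Y ∈ ⋀[ℝ]^l (VF I M) ∧ ∀ x, evalAt x (ceBoundary ℝ (VF I M) Y) = 0}

end Fields

section Calculus

variable {E H : Type*} [NormedAddCommGroup E] [NormedSpace ℝ E] [TopologicalSpace H]
  {I : ModelWithCorners ℝ E H} {M : Type*} [TopologicalSpace M] [ChartedSpace H M]

variable (I M) in
/-- Fields of alternating forms. -/
abbrev FormField : Type _ := ∀ x : M, GradedForms (TangentSpace I x)

variable (I M) in
/-- Fields of multivectors. -/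
abbrev MultivectorField : Type _ := ∀ x : M, ExteriorAlgebra ℝ (TangentSpace I x)

/-- The contraction `X ⌟ α` of a field of forms by a field of multivectors. -/
def contractField (X : MultivectorField I M) (α : FormField I M) : FormField I M :=
  fun x => contract (X x) (α x)

/-- `α ∈ Ω^p(M)`: the field `α` is homogeneous of degree `p` and is a smooth section of the bundle
of alternating forms. -/
def IsForm [IsManifold I ∞ M] (p : ℕ) (α : FormField I M) : Prop :=
  (∀ x m, m ≠ p → α x m = 0) ∧
    ContMDiff I (I.prod 𝓘(ℝ, E [⋀^Fin p]→L[ℝ] ℝ)) ∞ (fun x =>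
      TotalSpace.mk' (E := fun x : M => TangentSpace I x [⋀^Fin p]→L[ℝ] Bundle.Trivial M ℝ x)
        (E [⋀^Fin p]→L[ℝ] ℝ) x (α x p))

/-- `X ∈ Γ(Λ^l TM)`: near every point, `X` is a finite sum of terms `f · V₁ ∧ ⋯ ∧ Vₗ` with smooth
functions `f` and smooth vector fields `V₁, …, Vₗ`. -/
def IsMultivectorField [IsManifold I ∞ M] (l : ℕ) (X : MultivectorField I M) : Prop :=
  ∀ x₀ : M, ∃ (n : ℕ) (f : Fin n → C^∞⟮I, M; ℝ⟯) (V : Fin n → Fin l → VF I M),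
    ∀ᶠ x in 𝓝 x₀, X x = ∑ a, f a x • ExteriorAlgebra.ιMulti ℝ l (fun j => V a j x)

/-- The exterior derivative of a field of forms on a manifold without boundary, at the point `x`:
the exterior derivative of its representative in the chart at `x`. -/
def extD (α : FormField I M) : FormField I M := fun x m =>
  match m with
  | 0 => 0
  | m + 1 =>
    (extDeriv (fun z : E => ((α ((extChartAt I x).symm z) m).compContinuousLinearMap
        (mfderiv 𝓘(ℝ, E) I (extChartAt I x).symm z) : E [⋀^Fin m]→L[ℝ] ℝ))
      (extChartAt I x x)).compContinuousLinearMap (mfderiv I 𝓘(ℝ, E) (extChartAt I x) x)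

/-- The sign `ζ(k) = -(-1)^(k(k+1)/2)`. -/
def zeta (k : ℕ) : ℝ := -(-1) ^ (k * (k + 1) / 2)

/-- `X` is a Hamiltonian multivector field of degree `l` for `α`, that is `dα = -X ⌟ Ω`. -/
def IsHamiltonianField [IsManifold I ∞ M] (Ω : FormField I M) (l : ℕ) (α : FormField I M)
    (X : MultivectorField I M) : Prop :=
  IsMultivectorField l X ∧ extD α = -contractField X Ω

/-- `α ∈ Ω_Ham^(n-l)(M)`, where `Ω` has degree `n + 1`: `α` is an `(n-l)`-form with a Hamiltonian
multivector field of degree `l`. -/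
def IsHamiltonianForm [IsManifold I ∞ M] (Ω : FormField I M) (n l : ℕ) (α : FormField I M) :
    Prop :=
  IsForm (n - l) α ∧ ∃ X, IsHamiltonianField Ω l α X

open Classical in
/-- A Hamiltonian multivector field of degree `l` for `α` (and `0` if there is none). -/
def hamiltonianField [IsManifold I ∞ M] (Ω : FormField I M) (l : ℕ) (α : FormField I M) :
    MultivectorField I M :=
  if h : ∃ X, IsHamiltonianField Ω l α X then h.choose else 0

theorem hamiltonianField_spec [IsManifold I ∞ M] {Ω : FormField I M} {l : ℕ} {α : FormField I M}
    (h : ∃ X, IsHamiltonianField Ω l α X) :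
    IsHamiltonianField Ω l α (hamiltonianField Ω l α) := by
  rw [hamiltonianField, dif_pos h]
  exact h.choose_spec

/-- The bracket `{α, β} = (-1)^(l+1) X_β ⌟ X_α ⌟ Ω` of Hamiltonian forms `α, β` whose Hamiltonian
multivector fields `X_α, X_β` have degrees `k, l`. It does not depend on the choice of `X_α` and
`X_β`, see `hamBracket_eq`. -/
def hamBracket [IsManifold I ∞ M] (Ω : FormField I M) (k l : ℕ) (α β : FormField I M) :
    FormField I M :=
  (-1 : ℝ) ^ (l + 1) •
    contractField (hamiltonianField Ω l β) (contractField (hamiltonianField Ω k α) Ω)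

theorem IsMultivectorField.mem [IsManifold I ∞ M] {l : ℕ} {X : MultivectorField I M}
    (h : IsMultivectorField l X) (x : M) : X x ∈ ⋀[ℝ]^l (TangentSpace I x) := by
  obtain ⟨n, f, V, hX⟩ := h x
  rw [hX.self_of_nhds]
  refine Submodule.sum_mem _ fun a _ => Submodule.smul_mem _ _ ?_
  rw [← ExteriorAlgebra.ιMulti_span_fixedDegree]
  exact Submodule.subset_span ⟨_, rfl⟩

theorem wedge_mul_wedge {R L : Type*} [CommRing R] [AddCommGroup L] [Module R L] (l m : List L) :
    wedge R l * wedge R m = (-1 : R) ^ (l.length * m.length) • (wedge R m * wedge R l) := by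
  induction l with
  | nil => simp [wedge]
  | cons a l ih =>
    have h : ∀ m : List L, ExteriorAlgebra.ι R a * wedge R m =
        (-1 : R) ^ m.length • (wedge R m * ExteriorAlgebra.ι R a) := fun m => by
      induction m with
      | nil => simp [wedge]
      | cons b m ih' =>
        have e : wedge R (b :: m) = ExteriorAlgebra.ι R b * wedge R m := by simp [wedge]
        have e' : ExteriorAlgebra.ι R a * ExteriorAlgebra.ι R b =
          -(ExteriorAlgebra.ι R b * ExteriorAlgebra.ι R a) :=
          eq_neg_of_add_eq_zero_left (ExteriorAlgebra.ι_add_mul_swap a b)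
        rw [e, ← mul_assoc, e', neg_mul, mul_assoc, ih']
        simp [pow_succ, mul_assoc]
    have e : wedge R (a :: l) = ExteriorAlgebra.ι R a * wedge R l := by simp [wedge]
    rw [e, mul_assoc, ih, mul_smul_comm, ← mul_assoc, h, smul_mul_assoc, smul_smul, mul_assoc,
      ← pow_add, List.length_cons, add_mul, one_mul]

theorem mul_comm_of_mem {V : Type*} [AddCommGroup V] [Module ℝ V] {k l : ℕ}
    {X Y : ExteriorAlgebra ℝ V} (hX : X ∈ ⋀[ℝ]^k V) (hY : Y ∈ ⋀[ℝ]^l V) :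
    X * Y = (-1 : ℝ) ^ (k * l) • (Y * X) := by
  have e : ∀ (n : ℕ) (v : Fin n → V), ExteriorAlgebra.ιMulti ℝ n v = wedge ℝ (List.ofFn v) :=
    fun n v => by rw [ExteriorAlgebra.ιMulti_apply, wedge, List.map_ofFn]; rfl
  rw [← ExteriorAlgebra.ιMulti_span_fixedDegree] at hX hY
  induction hX using Submodule.span_induction with
  | mem X hX =>
    obtain ⟨v, rfl⟩ := hX
    induction hY using Submodule.span_induction with
    | mem Y hY =>
      obtain ⟨w, rfl⟩ := hY
      rw [e, e, wedge_mul_wedge, List.length_ofFn, List.length_ofFn]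
    | zero => simp
    | add Y Y' _ _ h h' => rw [mul_add, h, h', add_mul, smul_add]
    | smul c Y _ h => rw [mul_smul_comm, h, smul_mul_assoc, smul_comm]
  | zero => simp
  | add X X' _ _ h h' => rw [add_mul, h, h', mul_add, smul_add]
  | smul c X _ h => rw [smul_mul_assoc, h, mul_smul_comm, smul_comm]

/-- The bracket can be computed with any Hamiltonian multivector fields. -/
theorem hamBracket_eq [IsManifold I ∞ M] {Ω α β : FormField I M} {k l : ℕ}
    {X Y : MultivectorField I M} (hX : IsHamiltonianField Ω k α X)
    (hY : IsHamiltonianField Ω l β Y) :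
    hamBracket Ω k l α β = (-1 : ℝ) ^ (l + 1) • contractField Y (contractField X Ω) := by
  have hX' := hamiltonianField_spec ⟨X, hX⟩
  have hY' := hamiltonianField_spec ⟨Y, hY⟩
  have e₁ : contractField (hamiltonianField Ω k α) Ω = contractField X Ω :=
    neg_injective (hX'.2.symm.trans hX.2)
  have e₂ : contractField (hamiltonianField Ω l β) Ω = contractField Y Ω :=
    neg_injective (hY'.2.symm.trans hY.2)
  rw [hamBracket, e₁]
  congr 1
  funext x
  have e₃ : contract (hamiltonianField Ω l β x) (Ω x) = contract (Y x) (Ω x) := congrFun e₂ x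
  simp only [contractField]
  rw [← contract_mul, ← contract_mul,
    mul_comm_of_mem (hX.1.mem x) (hY'.1.mem x), mul_comm_of_mem (hX.1.mem x) (hY.1.mem x),
    contract_smul, contract_smul, contract_mul, contract_mul, e₃]

end Calculus

section PhaseSpace

variable {E N : Type*} [NormedAddCommGroup E] [NormedSpace ℝ E] [TopologicalSpace N]
  [ChartedSpace E N] [IsManifold 𝓘(ℝ, E) ∞ N] {k : ℕ}

/-- The multisymplectic phase space `M = Λ^k T*N`: the total space of the bundle of alternating
`k`-forms on the tangent spaces of `N`. A point `μ` has the base point `μ.1` and is the `k`-form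
`μ.2` on the tangent space at `μ.1`. -/
abbrev PhaseSpace (E N : Type*) [NormedAddCommGroup E] [NormedSpace ℝ E] [TopologicalSpace N]
    [ChartedSpace E N] [IsManifold 𝓘(ℝ, E) ∞ N] (k : ℕ) : Type _ :=
  TotalSpace (E [⋀^Fin k]→L[ℝ] ℝ)
    (fun x : N => TangentSpace 𝓘(ℝ, E) x [⋀^Fin k]→L[ℝ] Bundle.Trivial N ℝ x)

/-- The model with corners of the phase space. -/
abbrev phaseModel (E : Type*) [NormedAddCommGroup E] [NormedSpace ℝ E] (k : ℕ) :
    ModelWithCorners ℝ (E × (E [⋀^Fin k]→L[ℝ] ℝ)) (ModelProd E (E [⋀^Fin k]→L[ℝ] ℝ)) :=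
  𝓘(ℝ, E).prod 𝓘(ℝ, E [⋀^Fin k]→L[ℝ] ℝ)

/-- The derivative at `μ` of the projection `π : M → N`. -/
def dproj (μ : PhaseSpace E N k) :
    TangentSpace (phaseModel E k) μ →L[ℝ] TangentSpace 𝓘(ℝ, E) μ.1 :=
  mfderiv (phaseModel E k) 𝓘(ℝ, E) (fun ν : PhaseSpace E N k => ν.1) μ

/-- The point `μ` of the phase space, as a form on the tangent space at its base point. -/
def PhaseSpace.form (μ : PhaseSpace E N k) : GradedForms (TangentSpace 𝓘(ℝ, E) μ.1) :=
  Pi.single k μ.2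

/-- The canonical `k`-form `θ` on the phase space,
`θ_μ (Z₁, …, Z_k) = μ (π_* Z₁, …, π_* Z_k)`. -/
def theta (E N : Type*) [NormedAddCommGroup E] [NormedSpace ℝ E] [TopologicalSpace N]
    [ChartedSpace E N] [IsManifold 𝓘(ℝ, E) ∞ N] (k : ℕ) :
    FormField (phaseModel E k) (PhaseSpace E N k) :=
  fun μ => pullback (dproj μ) μ.form

/-- The canonical `(k+1)`-form `ω = -dθ` on the phase space. -/
def omega (E N : Type*) [NormedAddCommGroup E] [NormedSpace ℝ E] [TopologicalSpace N]
    [ChartedSpace E N] [IsManifold 𝓘(ℝ, E) ∞ N] (k : ℕ) :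
    FormField (phaseModel E k) (PhaseSpace E N k) :=
  -extD (theta E N k)

/-- The position form `π^* α`. -/
def positionForm (k : ℕ) (α : FormField 𝓘(ℝ, E) N) :
    FormField (phaseModel E k) (PhaseSpace E N k) :=
  fun μ => pullback (dproj μ) (α μ.1)

/-- An element of the exterior algebra of the real vector space of vector fields on `N`, as a field
of multivectors on `N`. -/
def toMultivectorField (Y : ExteriorAlgebra ℝ (VF 𝓘(ℝ, E) N)) : MultivectorField 𝓘(ℝ, E) N :=
  fun x => evalAt x Y

/-- The momentum form of `Y` of degree `l`: for `Y = Y₁ ∧ ⋯ ∧ Yₗ`,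
`P(Y)_μ (Z₁, …, Z_{k-l}) = -ζ(l+1) μ (Y₁, …, Yₗ, π_* Z₁, …, π_* Z_{k-l})`. -/
def momentumForm (k l : ℕ) (Y : ExteriorAlgebra ℝ (VF 𝓘(ℝ, E) N)) :
    FormField (phaseModel E k) (PhaseSpace E N k) :=
  fun μ => -(zeta (l + 1)) • pullback (dproj μ) (contract (evalAt μ.1 Y) μ.form)

/-- The derivative at `x`, in the chart at `x`, of the vector field `Y`. -/
def chartDeriv (x : N) (Y : VF 𝓘(ℝ, E) N) : E →L[ℝ] E :=
  fderiv ℝ (fun z : E => (mfderiv 𝓘(ℝ, E) 𝓘(ℝ, E) (extChartAt 𝓘(ℝ, E) x).symm z).inverse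
    (Y ((extChartAt 𝓘(ℝ, E) x).symm z))) (extChartAt 𝓘(ℝ, E) x x)

theorem differentiableAt_chartField [CompleteSpace E] (x : N) (Y : VF 𝓘(ℝ, E) N) :
    DifferentiableAt ℝ
      (fun z : E => (mfderiv 𝓘(ℝ, E) 𝓘(ℝ, E) (extChartAt 𝓘(ℝ, E) x).symm z).inverse
        (Y ((extChartAt 𝓘(ℝ, E) x).symm z))) (extChartAt 𝓘(ℝ, E) x x) := by
  have h := (Y.mdifferentiableAt x).mdifferentiableWithinAt
    (s := univ).differentiableWithinAt_mpullbackWithin_vectorField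
  have e : (extChartAt 𝓘(ℝ, E) x).symm ⁻¹' univ ∩ range 𝓘(ℝ, E) = univ := by simp
  rw [e] at h
  have e' : VectorField.mpullbackWithin 𝓘(ℝ, E) 𝓘(ℝ, E) (extChartAt 𝓘(ℝ, E) x).symm Y
      (range 𝓘(ℝ, E)) = fun z : E =>
        (mfderiv 𝓘(ℝ, E) 𝓘(ℝ, E) (extChartAt 𝓘(ℝ, E) x).symm z).inverse
          (Y ((extChartAt 𝓘(ℝ, E) x).symm z)) := by
    funext z
    rw [VectorField.mpullbackWithin_apply, ModelWithCorners.range_eq_univ, mfderivWithin_univ]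
  have h' := differentiableWithinAt_univ.1 h
  exact e' ▸ h'

variable [CompleteSpace E]

/-- The value at `μ` of the complete lift `Y♯` of a vector field `Y`, the vector field on the phase
space whose flow is `(φ_t^*)⁻¹` if `φ_t` is the flow of `Y`. In the chart at `μ` this is
`Y♯ (q, p) = (Y q, -∑ᵢ p (…, DY vᵢ, …))`; see `hasMFDerivAt_completeLift` for the flow. -/
def completeLiftAt (μ : PhaseSpace E N k) :
    VF 𝓘(ℝ, E) N →ₗ[ℝ] TangentSpace (phaseModel E k) μ where
  toFun Y := ((Y μ.1 : E),
    -ContinuousAlternatingMap.fderivCompContinuousLinearMap (μ.2 : E [⋀^Fin k]→L[ℝ] ℝ)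
      (ContinuousLinearMap.id ℝ E) (chartDeriv μ.1 Y))
  map_add' Y Z := by
    have h : chartDeriv μ.1 (Y + Z) = chartDeriv μ.1 Y + chartDeriv μ.1 Z := by
      refine Eq.trans ?_ (fderiv_add (differentiableAt_chartField μ.1 Y)
        (differentiableAt_chartField μ.1 Z))
      refine congrArg (fun f => fderiv ℝ f _) (funext fun z => ?_)
      exact map_add _ _ _
    rw [h, map_add, neg_add]
    rfl
  map_smul' c Y := by
    have h : chartDeriv μ.1 (c • Y) = c • chartDeriv μ.1 Y := by
      refine Eq.trans ?_ (fderiv_const_smul (differentiableAt_chartField μ.1 Y) c)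
      refine congrArg (fun f => fderiv ℝ f _) (funext fun z => ?_)
      exact map_smul _ _ _
    rw [h, map_smul, ← smul_neg]
    rfl

/-- The complete lift of multivector fields, `(Y₁ ∧ ⋯ ∧ Yₗ)♯ = Y₁♯ ∧ ⋯ ∧ Yₗ♯`. -/
def completeLift (k : ℕ) (Y : ExteriorAlgebra ℝ (VF 𝓘(ℝ, E) N)) :
    MultivectorField (phaseModel E k) (PhaseSpace E N k) :=
  fun μ => ExteriorAlgebra.map (completeLiftAt μ) Y

/-- The derivative at `t = 0` of the pullback of a form by the inverse of the derivative of a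
local flow `Φ_t`. -/
theorem hasDerivAt_comp_inverse_fderiv (Φ : ℝ → E → E) (z₀ : E) (v : E → E) (p : E [⋀^Fin k]→L[ℝ] ℝ)
    (hΦ : ContDiffAt ℝ ∞ (fun q : ℝ × E => Φ q.1 q.2) (0, z₀))
    (h0 : ∀ᶠ z in 𝓝 z₀, Φ 0 z = z)
    (hd : ∀ᶠ z in 𝓝 z₀, HasDerivAt (fun t => Φ t z) (v z) 0) :
    HasDerivAt (fun t => p.compContinuousLinearMap (fderiv ℝ (Φ t) z₀).inverse)
      (-p.fderivCompContinuousLinearMap (ContinuousLinearMap.id ℝ E) (fderiv ℝ v z₀)) 0 := by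
  set F : ℝ × E → E := fun q => Φ q.1 q.2 with hF
  have hdiff : ∀ᶠ q in 𝓝 ((0 : ℝ), z₀), DifferentiableAt ℝ F q :=
    ((hΦ.of_le (m := 1) (by simp)).eventually (by simp)).mono fun q h => h.differentiableAt (by simp)
  have hd1 : DifferentiableAt ℝ (fderiv ℝ F) (0, z₀) :=
    (hΦ.fderiv_right (m := 1) (by norm_cast)).differentiableAt (by simp)
  have hsymm : IsSymmSndFDerivAt ℝ F (0, z₀) := hΦ.isSymmSndFDerivAt
    (by simpa using WithTop.coe_le_coe.2 (le_top : (2 : ℕ∞) ≤ ⊤))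
  -- the partial derivatives
  have hA : ∀ᶠ t in 𝓝 (0 : ℝ), fderiv ℝ (Φ t) z₀ =
      (fderiv ℝ F (t, z₀)).comp (ContinuousLinearMap.inr ℝ ℝ E) := by
    have hc : Filter.Tendsto (fun t : ℝ => (t, z₀)) (𝓝 0) (𝓝 (0, z₀)) :=
      (by fun_prop : Continuous fun t : ℝ => (t, z₀)).tendsto 0
    filter_upwards [hc.eventually hdiff] with t ht
    exact (ht.hasFDerivAt.comp z₀ (hasFDerivAt_prodMk_right t z₀)).fderiv
  have hv : ∀ᶠ z in 𝓝 z₀, v z = fderiv ℝ F (0, z) (1, 0) := by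
    have hc : Filter.Tendsto (fun z : E => ((0 : ℝ), z)) (𝓝 z₀) (𝓝 (0, z₀)) :=
      (by fun_prop : Continuous fun z : E => ((0 : ℝ), z)).tendsto z₀
    filter_upwards [hc.eventually hdiff, hd] with z hz hz'
    have := (hz.hasFDerivAt.comp (0 : ℝ) (hasFDerivAt_prodMk_left (0 : ℝ) z)).hasDerivAt
    exact (hz'.unique this).trans (by simp)
  have hA0 : fderiv ℝ (Φ 0) z₀ = ContinuousLinearMap.id ℝ E := by
    have : Φ 0 =ᶠ[𝓝 z₀] id := h0
    rw [this.fderiv_eq, fderiv_id]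
  have hv' : fderiv ℝ v z₀ = (fderiv ℝ (fderiv ℝ F) (0, z₀) (1, 0)).comp
      (ContinuousLinearMap.inr ℝ ℝ E) := by
    have e : v =ᶠ[𝓝 z₀] fun z => fderiv ℝ F (0, z) (1, 0) := hv
    have h1 := (hd1.hasFDerivAt.comp z₀ (hasFDerivAt_prodMk_right (0 : ℝ) z₀)).clm_apply
      (hasFDerivAt_const ((1 : ℝ), (0 : E)) z₀)
    rw [e.fderiv_eq]
    refine h1.fderiv.trans ?_
    ext w
    simpa using hsymm.eq (0, w) (1, 0)
  have hAd : HasDerivAt (fun t => fderiv ℝ (Φ t) z₀) (fderiv ℝ v z₀) 0 := by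
    have h1 := (hd1.hasFDerivAt.comp (0 : ℝ) (hasFDerivAt_prodMk_left (0 : ℝ) z₀)).hasDerivAt
    have h2 := h1.clm_comp (hasDerivAt_const (0 : ℝ) (ContinuousLinearMap.inr ℝ ℝ E))
    refine HasDerivAt.congr_of_eventuallyEq ?_ hA
    rw [hv']
    simpa using h2
  have hinv : HasDerivAt (fun t => (fderiv ℝ (Φ t) z₀).inverse) (-fderiv ℝ v z₀) 0 := by
    have h1 := hasFDerivAt_ringInverse (𝕜 := ℝ) (R := E →L[ℝ] E) 1
    rw [ContinuousLinearMap.ringInverse_eq_inverse, Units.val_one,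
      show (1 : E →L[ℝ] E) = ContinuousLinearMap.id ℝ E from rfl] at h1
    rw [← hA0] at h1
    have h2 := h1.comp_hasDerivAt (0 : ℝ) hAd
    refine h2.congr_deriv ?_
    rw [neg_apply, ContinuousLinearMap.mulLeftRight_apply, inv_one, Units.val_one, one_mul, mul_one]
  have hp := (ContinuousAlternatingMap.hasStrictFDerivAt_compContinuousLinearMap
    (p, (fderiv ℝ (Φ 0) z₀).inverse)).hasFDerivAt
  have h3 := hp.comp_hasDerivAt (0 : ℝ) ((hasDerivAt_const (0 : ℝ) p).prodMk hinv)
  refine h3.congr_deriv ?_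
  rw [hA0]
  simp
  rfl

set_option maxHeartbeats 400000 in
/-- The complete lift is the velocity of the curves `t ↦ (φ_t^*)⁻¹ μ`, for each smooth local
flow `φ_t` of `Y`. -/
theorem hasMFDerivAt_completeLift (Y : VF 𝓘(ℝ, E) N) (μ : PhaseSpace E N k) (φ : ℝ → N → N)
    (hφ : ContMDiffAt (𝓘(ℝ, ℝ).prod 𝓘(ℝ, E)) 𝓘(ℝ, E) ∞ (fun q : ℝ × N => φ q.1 q.2) (0, μ.1))
    (h0 : ∀ᶠ y in 𝓝 μ.1, φ 0 y = y)
    (hd : ∀ᶠ y in 𝓝 μ.1, HasMFDerivAt 𝓘(ℝ, ℝ) 𝓘(ℝ, E) (fun t => φ t y) 0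
      ((ContinuousLinearMap.id ℝ ℝ).smulRight (Y (φ 0 y)))) :
    let γ : ℝ → PhaseSpace E N k := fun t => ⟨φ t μ.1, (μ.2 : E [⋀^Fin k]→L[ℝ] ℝ)
      |>.compContinuousLinearMap (mfderiv 𝓘(ℝ, E) 𝓘(ℝ, E) (φ t) μ.1).inverse⟩
    γ 0 = μ ∧ HasMFDerivAt 𝓘(ℝ, ℝ) (phaseModel E k) γ 0
      ((ContinuousLinearMap.id ℝ ℝ).smulRight (completeLiftAt (γ 0) Y)) := by
  intro γ
  obtain ⟨x, p⟩ := μ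
  let p' : E [⋀^Fin k]→L[ℝ] ℝ := p
  change ContMDiffAt _ _ _ _ (0, x) at hφ
  change ∀ᶠ y in 𝓝 x, _ at h0
  change ∀ᶠ y in 𝓝 x, _ at hd
  let J : ℝ → E →L[ℝ] E := fun t => mfderiv 𝓘(ℝ, E) 𝓘(ℝ, E) (φ t) x
  have hJ0 : J 0 = ContinuousLinearMap.id ℝ E := by
    have e : φ 0 =ᶠ[𝓝 x] id := h0
    exact e.mfderiv_eq.trans mfderiv_id
  let mk (y : N) (q : E [⋀^Fin k]→L[ℝ] ℝ) : PhaseSpace E N k := ⟨y, q⟩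
  have hγ : γ = fun t => mk (φ t x) (p'.compContinuousLinearMap (J t).inverse) := rfl
  have hγ0 : γ 0 = mk x p' := by
    rw [hγ]
    show mk (φ 0 x) (p'.compContinuousLinearMap (J 0).inverse) = mk x p'
    rw [hJ0, h0.self_of_nhds, ContinuousLinearMap.inverse_id]
    rfl
  refine ⟨hγ0, ?_⟩
  let c := extChartAt 𝓘(ℝ, E) x
  let Φ : ℝ → E → E := fun t z => c (φ t (c.symm z))
  let v : E → E := fun z => (mfderiv 𝓘(ℝ, E) 𝓘(ℝ, E) c.symm z).inverse (Y (c.symm z))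
  have hcx : c.symm (c x) = x := extChartAt_to_inv x
  have hx : φ 0 x = x := h0.self_of_nhds
  have hsrc : c.source ∈ 𝓝 x := extChartAt_source_mem_nhds x
  have htgt : c.target ∈ 𝓝 (c x) := extChartAt_target_mem_nhds x
  have hcs : ContinuousAt c.symm (c x) := continuousAt_extChartAt_symm x
  have hcs' : Filter.Tendsto c.symm (𝓝 (c x)) (𝓝 x) := by
    have := hcs.tendsto
    rwa [hcx] at this
  have hrange : range 𝓘(ℝ, E) = univ := ModelWithCorners.range_eq_univ _
  have hΦ : ContDiffAt ℝ ∞ (fun q : ℝ × E => Φ q.1 q.2) (0, c x) := by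
    rw [← contMDiffAt_iff_contDiffAt]
    have a1 : ContMDiffAt 𝓘(ℝ, E) 𝓘(ℝ, E) ∞ c.symm (c x) := by
      have := contMDiffWithinAt_extChartAt_symm_range (I := 𝓘(ℝ, E)) (n := ∞) x
        (mem_extChartAt_target x)
      rw [hrange] at this
      exact this.contMDiffAt Filter.univ_mem
    have a2 : ContMDiffAt 𝓘(ℝ, ℝ × E) (𝓘(ℝ, ℝ).prod 𝓘(ℝ, E)) ∞
        (fun q : ℝ × E => (q.1, c.symm q.2)) (0, c x) :=
      contDiff_fst.contMDiff.contMDiffAt.prodMk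
        (ContMDiffAt.comp (0, c x) a1 contDiff_snd.contMDiff.contMDiffAt)
    have a3 : ContMDiffAt (𝓘(ℝ, ℝ).prod 𝓘(ℝ, E)) 𝓘(ℝ, E) ∞ (fun q : ℝ × N => c (φ q.1 q.2))
        (0, x) := by
      refine ContMDiffAt.comp (0, x) ?_ hφ
      show ContMDiffAt _ _ _ _ (φ 0 x)
      rw [hx]
      exact contMDiffAt_extChartAt
    have a4 : ContMDiffAt (𝓘(ℝ, ℝ).prod 𝓘(ℝ, E)) 𝓘(ℝ, E) ∞ (fun q : ℝ × N => c (φ q.1 q.2))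
        ((0 : ℝ), c.symm (c x)) := by rw [hcx]; exact a3
    exact ContMDiffAt.comp (g := fun q : ℝ × N => c (φ q.1 q.2))
      (f := fun q : ℝ × E => (q.1, c.symm q.2)) ((0 : ℝ), c x) a4 a2
  have hΦ0 : ∀ᶠ z in 𝓝 (c x), Φ 0 z = z := by
    filter_upwards [hcs'.eventually h0, htgt] with z hz hz'
    show c (φ 0 (c.symm z)) = z
    rw [hz, c.right_inv hz']
  have hΦd : ∀ᶠ z in 𝓝 (c x), HasDerivAt (fun t => Φ t z) (v z) 0 := by
    filter_upwards [hcs'.eventually h0, hcs'.eventually hd, htgt] with z hz hz' hzt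
    have b1 : MDifferentiableAt 𝓘(ℝ, E) 𝓘(ℝ, E) c (φ 0 (c.symm z)) := by
      rw [hz]
      exact mdifferentiableAt_extChartAt (by simpa [c] using c.map_target hzt)
    have b2 := b1.hasMFDerivAt.comp (0 : ℝ) hz'
    obtain ⟨A, hA⟩ : ∃ A : E →L[ℝ] E, A = mfderiv 𝓘(ℝ, E) 𝓘(ℝ, E) c (φ 0 (c.symm z)) :=
      ⟨_, rfl⟩
    obtain ⟨w, hw⟩ : ∃ w : E, w = Y (φ 0 (c.symm z)) := ⟨_, rfl⟩
    have b3 : HasFDerivAt (fun t => Φ t z) (A.comp ((ContinuousLinearMap.id ℝ ℝ).smulRight w)) 0 := by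
      rw [hA, hw]
      exact hasMFDerivAt_iff_hasFDerivAt.1 b2
    have b4 : HasDerivAt (fun t => Φ t z) (A w) 0 := by
      have := b3.hasDerivAt
      simpa using this
    refine b4.congr_deriv ?_
    rw [hA, hw, hz]
    have b5 : (mfderiv 𝓘(ℝ, E) 𝓘(ℝ, E) c.symm z).inverse =
        mfderiv 𝓘(ℝ, E) 𝓘(ℝ, E) c (c.symm z) := by
      have d1 := mfderiv_extChartAt_comp_mfderivWithin_extChartAt_symm (I := 𝓘(ℝ, E)) hzt
      have d2 := mfderivWithin_extChartAt_symm_comp_mfderiv_extChartAt (I := 𝓘(ℝ, E)) hzt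
      rw [hrange, mfderivWithin_univ] at d1 d2
      exact ContinuousLinearMap.inverse_eq d2 d1
    show _ = (mfderiv 𝓘(ℝ, E) 𝓘(ℝ, E) c.symm z).inverse (Y (c.symm z))
    rw [b5]
    rfl
  have key := hasDerivAt_comp_inverse_fderiv Φ (c x) v p' hΦ hΦ0 hΦd
  let S : N → E →L[ℝ] E := fun y =>
    (trivializationAt E (TangentSpace 𝓘(ℝ, E) : N → Type _) x).symmL ℝ y
  have hchart : ∀ (y : N) (q : E [⋀^Fin k]→L[ℝ] ℝ),
      extChartAt (phaseModel E k) (mk x p') (mk y q) = (c y, q.compContinuousLinearMap (S y)) := by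
    intro y q
    rw [FiberBundle.extChartAt]
    refine Prod.ext rfl ?_
    show (trivializationAt (E [⋀^Fin k]→L[ℝ] ℝ) (fun x : N => TangentSpace 𝓘(ℝ, E) x [⋀^Fin k]→L[ℝ]
      Bundle.Trivial N ℝ x) x (mk y q)).2 = _
    rw [FiberBundle.trivializationAt_continuousAlternatingMap_apply]
    ext w
    simp [ContinuousAlternatingMap.inCoordinates]
    rfl
  have hφx : ContinuousAt (fun t => φ t x) 0 :=
    ContinuousAt.comp (g := fun q : ℝ × N => φ q.1 q.2) (f := fun t : ℝ => (t, x)) hφ.continuousAt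
      (by fun_prop)
  have hφs : ∀ᶠ t in 𝓝 (0 : ℝ), φ t x ∈ c.source :=
    hφx.eventually (by show c.source ∈ 𝓝 (φ 0 x); rw [hx]; exact hsrc)
  have hφd : ∀ᶠ t in 𝓝 (0 : ℝ), MDifferentiableAt 𝓘(ℝ, E) 𝓘(ℝ, E) (φ t) x := by
    have h1 := (contMDiffAt_iff_contMDiffAt_nhds (n := 1) (by simp)).1
      (hφ.of_le (m := 1) (by simp))
    have hc : Filter.Tendsto (fun t : ℝ => (t, x)) (𝓝 0) (𝓝 (0, x)) :=
      (by fun_prop : Continuous fun t : ℝ => (t, x)).tendsto 0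
    filter_upwards [hc.eventually h1] with t ht
    have h2 := ht.mdifferentiableAt one_ne_zero
    exact MDifferentiableAt.comp (g := fun q : ℝ × N => φ q.1 q.2) (f := fun y : N => (t, y)) x h2
      (mdifferentiableAt_const.prodMk mdifferentiableAt_id)
  have hsymm : mfderiv 𝓘(ℝ, E) 𝓘(ℝ, E) c.symm (c x) = ContinuousLinearMap.id ℝ E := by
    have h1 := mfderivWithin_range_extChartAt_symm (I := 𝓘(ℝ, E)) (x := x)
    rwa [hrange, mfderivWithin_univ] at h1
  have hsymmd : MDifferentiableAt 𝓘(ℝ, E) 𝓘(ℝ, E) c.symm (c x) := by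
    have h1 := mdifferentiableWithinAt_extChartAt_symm (I := 𝓘(ℝ, E)) (mem_extChartAt_target x)
    rwa [hrange, mdifferentiableWithinAt_univ] at h1
  have hJ : ∀ᶠ t in 𝓝 (0 : ℝ), (J t).inverse.comp (S (φ t x)) =
      (fderiv ℝ (Φ t) (c x)).inverse := by
    filter_upwards [hφs, hφd] with t ht ht'
    have ht'' : φ t x ∈ (chartAt E x).source := by simpa [c] using ht
    obtain ⟨A, hA⟩ : ∃ A : E →L[ℝ] E, A = mfderiv 𝓘(ℝ, E) 𝓘(ℝ, E) c (φ t x) := ⟨_, rfl⟩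
    have e1 : A.comp (S (φ t x)) = ContinuousLinearMap.id ℝ E ∧
        (S (φ t x)).comp A = ContinuousLinearMap.id ℝ E := by
      have hS : S (φ t x) = mfderivWithin 𝓘(ℝ, E) 𝓘(ℝ, E) c.symm (range 𝓘(ℝ, E)) (c (φ t x)) :=
        TangentBundle.symmL_trivializationAt ht''
      rw [hS, hA]
      exact ⟨mfderiv_extChartAt_comp_mfderivWithin_extChartAt_symm' ht,
        mfderivWithin_extChartAt_symm_comp_mfderiv_extChartAt' ht⟩
    have e2 : HasMFDerivAt 𝓘(ℝ, E) 𝓘(ℝ, E) (fun y => c (φ t y)) x (A.comp (J t)) := by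
      rw [hA]
      exact (mdifferentiableAt_extChartAt ht'').hasMFDerivAt.comp x ht'.hasMFDerivAt
    have e3 : HasMFDerivAt 𝓘(ℝ, E) 𝓘(ℝ, E) (fun y => c (φ t y)) (c.symm (c x)) (A.comp (J t)) := by
      rw [hcx]
      exact e2
    have e4 : HasMFDerivAt 𝓘(ℝ, E) 𝓘(ℝ, E) c.symm (c x) (ContinuousLinearMap.id ℝ E) := by
      rw [← hsymm]
      exact hsymmd.hasMFDerivAt
    have e5 : HasFDerivAt (Φ t) ((A.comp (J t)).comp (ContinuousLinearMap.id ℝ E)) (c x) :=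
      hasMFDerivAt_iff_hasFDerivAt.1 (e3.comp (c x) e4)
    rw [e5.fderiv, ContinuousLinearMap.comp_id,
      (ContinuousLinearMap.IsInvertible.of_inverse e1.1 e1.2).inverse_comp_of_left,
      ContinuousLinearMap.inverse_eq e1.1 e1.2]
  have hΦx : HasDerivAt (fun t => Φ t (c x)) (Y x : E) 0 := by
    refine hΦd.self_of_nhds.congr_deriv ?_
    show (mfderiv 𝓘(ℝ, E) 𝓘(ℝ, E) c.symm (c x)).inverse (Y (c.symm (c x))) = Y x
    refine Eq.trans (congrArg (fun A : E →L[ℝ] E => A.inverse (Y (c.symm (c x)) : E)) hsymm) ?_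
    refine Eq.trans (congrArg (fun A : E →L[ℝ] E => A (Y (c.symm (c x)) : E))
      ContinuousLinearMap.inverse_id) ?_
    exact congrArg (fun y => (Y y : E)) hcx
  have hcγ : (fun t => extChartAt (phaseModel E k) (mk x p') (γ t)) =ᶠ[𝓝 0]
      fun t => (Φ t (c x), p'.compContinuousLinearMap (fderiv ℝ (Φ t) (c x)).inverse) := by
    filter_upwards [hJ] with t ht
    refine (hchart (φ t x) (p'.compContinuousLinearMap (J t).inverse)).trans ?_
    rw [← ht]
    refine Prod.ext ?_ rfl
    show c (φ t x) = c (φ t (c.symm (c x)))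
    rw [hcx]
  have hder : HasDerivAt (fun t => extChartAt (phaseModel E k) (mk x p') (γ t))
      (completeLiftAt (mk x p') Y : E × (E [⋀^Fin k]→L[ℝ] ℝ)) 0 :=
    (hΦx.prodMk key).congr_of_eventuallyEq hcγ
  have hcont : ContinuousAt γ 0 := by
    have h1 : ContinuousAt (extChartAt (phaseModel E k) (mk x p')).symm
        (extChartAt (phaseModel E k) (mk x p') (γ 0)) := by
      rw [hγ0]
      exact continuousAt_extChartAt_symm _
    refine (ContinuousAt.comp (f := fun t => extChartAt (phaseModel E k) (mk x p') (γ t)) h1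
      hder.continuousAt).congr ?_
    filter_upwards [hφs] with t ht
    refine (extChartAt (phaseModel E k) (mk x p')).left_inv ?_
    have ht' : φ t x ∈ (chartAt E x).source := by simpa [c] using ht
    rw [extChartAt_source, FiberBundle.chartedSpace_chartAt]
    simp only [mfld_simps]
    exact ⟨⟨ht', mem_univ _⟩, ht'⟩
  refine ⟨hcont, ?_⟩
  have hfin : ∀ ν : PhaseSpace E N k, ν = mk x p' →
      HasFDerivAt (fun t => extChartAt (phaseModel E k) ν (γ t))
        ((ContinuousLinearMap.id ℝ ℝ).smulRight
          (completeLiftAt ν Y : E × (E [⋀^Fin k]→L[ℝ] ℝ))) 0 := by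
    rintro _ rfl
    exact hder.hasFDerivAt
  exact (hfin _ hγ0).hasFDerivWithinAt

end PhaseSpace

end MultiPhase

end

open Bundle Set
open scoped Manifold ContDiff Topology

noncomputable section

/-! Write $Y\lrcorner\theta$ for `contractTheta k Y`, the form
$\mu\mapsto(Y\lrcorner\mu)\circ\pi_*$. The statements on momentum forms rest on one identity,
`extD_contractTheta`: for every $Y$ in the real exterior algebra of $\mathfrak X$,
$$d(Y\lrcorner\theta)=(\mathrm{gr}\,Y)^\sharp\lrcorner
d\theta+(\partial\,\mathrm{gr}\,Y)\lrcorner\theta,$$ where $\mathrm{gr}$ is $(-1)^l$ in degree $l$.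
It is Cartan's formula $d\,i_v=L_v-i_v\,d$ iterated over the factors of $Y$. Complete lifts preserve
$\theta$, so $L_{\xi^\sharp}(Y\lrcorner\theta)=(\mathrm{ad}_\xi Y)\lrcorner\theta$, and these Lie
derivatives add up to the Chevalley–Eilenberg differential.

For $Y$ in the Lie kernel the last term vanishes, and $\zeta(l+1)=(-1)^{l+1}\zeta(l)$ turns the
identity into $dP(Y)=-\zeta(l)Y^\sharp\lrcorner\omega$. For the bracket, apply the identity to
$Y_1\wedge Y_2$. By `ceBoundary_mul`, $\partial$ is a graded derivation up to the Schouten bracket,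
and the terms with $\partial Y_1$ or $\partial Y_2$ vanish pointwise. So $d(Y_1\wedge
Y_2\lrcorner\theta)$ is, up to signs, the sum of $(Y_1\wedge Y_2)^\sharp\lrcorner d\theta$, which is
the bracket up to a factor, and $[Y_1,Y_2]\lrcorner\theta$. The signs are settled by
`smul_zeta_identity`.

The identity is proved in bundle charts $E\times\Lambda^kE^*$, where
$\theta_{(z,p)}=p\circ\mathrm{fst}$ and $d\theta$ has constant coefficients; the core is
`exists_hasFDerivAt_contract`. Smoothness of complete lifts is not visible from `completeLiftAt`,
which uses a different chart at every point. It follows from nondegeneracy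
(`contDiffAt_chartVF_of_interior`): a vector is determined by its projection to $N$ and its
contraction with $d\theta$, and $\xi^\sharp\lrcorner d\theta=-d(\xi\lrcorner\theta)$ is smooth.

For position forms, a $k$-form $\eta$ on $N$ has a vertical lift $V_\eta$ with $V_\eta\lrcorner
d\theta=\pi^*\eta$, hence $V_\eta\wedge\xi_1^\sharp\wedge\dots\wedge\xi_r^\sharp$ contracts
$d\theta$ to $\pi^*(\xi_1\wedge\dots\wedge\xi_r\lrcorner\eta)$. Since $k\le n$, every form of degree
$k-r$ is locally a sum of such contractions (`exists_sum_contract_eq`), and a partition of unity on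
$N$ glues the resulting multivector fields. Each term has a vertical factor and so kills forms
pulled back from $N$, which makes brackets of position forms vanish. The mixed bracket only uses
that $Y^\sharp$ projects to $Y$. -/

namespace MultiPhase

/-! ### Derivation identities in the exterior algebra of a Lie algebra -/

section ExteriorIdentities

variable {R L : Type*} [CommRing R] [LieRing L] [LieAlgebra R L]

local notation "Λ" => ExteriorAlgebra R L

/-- The grading involution of the exterior algebra. -/
def grade (R : Type*) {L : Type*} [CommRing R] [AddCommGroup L] [Module R L] :
    ExteriorAlgebra R L →ₐ[R] ExteriorAlgebra R L :=
  CliffordAlgebra.involute (Q := (0 : QuadraticForm R L))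

@[simp] theorem grade_ι {R L : Type*} [CommRing R] [AddCommGroup L] [Module R L] (m : L) :
    grade R (ExteriorAlgebra.ι R m) = -ExteriorAlgebra.ι R m :=
  CliffordAlgebra.involute_ι m

@[simp] theorem grade_grade (x : Λ) : grade R (grade R x) = x :=
  CliffordAlgebra.involute_involute x

theorem grade_eq {l : ℕ} {x : Λ} (hx : x ∈ ⋀[R]^l L) : grade R x = (-1 : R) ^ l • x := by
  rw [← ExteriorAlgebra.ιMulti_span_fixedDegree] at hx
  induction hx using Submodule.span_induction with
  | mem x hx =>
    obtain ⟨v, rfl⟩ := hx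
    have e : ExteriorAlgebra.ιMulti R l v = wedge R (List.ofFn v) := by
      rw [ExteriorAlgebra.ιMulti_apply, wedge, List.map_ofFn]; rfl
    rw [e, grade, involute_wedge, List.length_ofFn]
  | zero => simp
  | add x y _ _ hx hy => rw [map_add, hx, hy, smul_add]
  | smul c x _ hx => rw [map_smul, hx, smul_comm]

/-- Moving `n` past each factor of `x` costs one sign, and `grade` supplies exactly these signs. -/
theorem ι_mul_grade (n : L) (x : Λ) :
    ExteriorAlgebra.ι R n * grade R x = x * ExteriorAlgebra.ι R n := by
  have h : (LinearMap.mulLeft R (ExteriorAlgebra.ι R n)) ∘ₗ (grade R).toLinearMap =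
      LinearMap.mulRight R (ExteriorAlgebra.ι R n) := by
    refine linearMap_ext_wedge fun l => ?_
    induction l with
    | nil => simp
    | cons a l ih =>
      simp only [LinearMap.comp_apply, LinearMap.mulLeft_apply, LinearMap.mulRight_apply,
        AlgHom.toLinearMap_apply] at ih
      simp [mul_assoc, ← ih, ι_anticomm_assoc n a]
  exact LinearMap.congr_fun h x

/-- The recursion for `adExt` peels off factors on the left; as a derivation it can be evaluated
from the right as well. -/
theorem adExt_mul (ξ : L) (x y : Λ) : adExt ξ (x * y) = adExt ξ x * y + x * adExt ξ y := by
  have h : adExt ξ ∘ₗ LinearMap.mulRight R y =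
      LinearMap.mulRight R y ∘ₗ adExt ξ + LinearMap.mulRight R (adExt ξ y) := by
    refine linearMap_ext_wedge fun l => ?_
    induction l with
    | nil => simp
    | cons a l ih =>
      simp only [LinearMap.comp_apply, LinearMap.mulRight_apply, LinearMap.add_apply] at ih
      simp [mul_assoc, ih, add_mul, mul_add, add_assoc]
  exact LinearMap.congr_fun h x

@[simp] theorem adExt_ι (ξ m : L) :
    adExt ξ (ExteriorAlgebra.ι R m) = ExteriorAlgebra.ι R ⁅ξ, m⁆ := by
  simpa using adExt_ι_mul (R := R) ξ m 1

/-- The Schouten bracket with fixed second argument, as a linear map. -/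
def schoutenLM (Y : Λ) : Λ →ₗ[R] Λ :=
  CliffordAlgebra.foldr' (0 : QuadraticForm R L) (schoutenStep Y) (schoutenStep_schoutenStep Y) 0

theorem schoutenLM_apply (X Y : Λ) : schoutenLM Y X = schouten X Y := rfl

theorem schouten_smul_left (c : R) (X Y : Λ) : schouten (c • X) Y = c • schouten X Y :=
  map_smul (schoutenLM Y) c X

/-- The Chevalley–Eilenberg differential is a derivation up to the Schouten bracket. -/
theorem ceBoundary_mul (x y : Λ) : ceBoundary R L (x * y) =
    ceBoundary R L x * y + grade R x * ceBoundary R L y + schouten (grade R x) y := by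
  have h : ceBoundary R L ∘ₗ LinearMap.mulRight R y =
      LinearMap.mulRight R y ∘ₗ ceBoundary R L +
        LinearMap.mulRight R (ceBoundary R L y) ∘ₗ (grade R).toLinearMap +
        schoutenLM y ∘ₗ (grade R).toLinearMap := by
    refine linearMap_ext_wedge fun l => ?_
    induction l with
    | nil => simp [schoutenLM_apply]
    | cons a l ih =>
      simp only [LinearMap.comp_apply, LinearMap.mulRight_apply, LinearMap.add_apply,
        AlgHom.toLinearMap_apply, schoutenLM_apply] at ih ⊢
      -- The recursion of `schouten` applies the grading to `grade R (wedge R l)` once more, which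
      -- cancels it. What remains matches the term that `adExt a` produces on the second factor.
      have e : schouten (-(ExteriorAlgebra.ι R a * grade R (wedge R l))) y =
          -(ExteriorAlgebra.ι R a * schouten (grade R (wedge R l)) y) - wedge R l * adExt a y := by
        rw [← schoutenLM_apply, map_neg, schoutenLM_apply, schouten_ι_mul, neg_add,
          ← sub_eq_add_neg]
        congr 2
        exact grade_grade _
      simp only [wedge_cons, mul_assoc, ceBoundary_ι_mul, map_mul, grade_ι, neg_mul, ih, e,
        adExt_mul, mul_add, sub_mul]
      abel
  exact LinearMap.congr_fun h x

/-- The new factor `m` only forms new pairs with the factors of `x`, and these make up the bracket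
term. The recursion on the right is needed because contraction by a product applies the rightmost
factor last, whereas `ceBoundary` is built from the left. -/
theorem ceBoundary_mul_ι (x : Λ) (m : L) : ceBoundary R L (x * ExteriorAlgebra.ι R m) =
    ceBoundary R L x * ExteriorAlgebra.ι R m - adExt m (grade R x) := by
  have h : ceBoundary R L ∘ₗ LinearMap.mulRight R (ExteriorAlgebra.ι R m) =
      LinearMap.mulRight R (ExteriorAlgebra.ι R m) ∘ₗ ceBoundary R L -
        adExt m ∘ₗ (grade R).toLinearMap := by
    refine linearMap_ext_wedge fun l => ?_
    induction l with
    | nil => simpa using ceBoundary_ι_mul (R := R) m 1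
    | cons a l ih =>
      simp only [LinearMap.comp_apply, LinearMap.mulRight_apply, LinearMap.sub_apply,
        AlgHom.toLinearMap_apply] at ih ⊢
      have e : ExteriorAlgebra.ι R ⁅m, a⁆ = -ExteriorAlgebra.ι R ⁅a, m⁆ := by
        rw [← lie_skew, map_neg]
      simp only [wedge_cons, mul_assoc, ceBoundary_ι_mul, map_mul, grade_ι, neg_mul, ih,
        adExt_mul, sub_mul, mul_sub, map_neg, adExt_ι, e, ← ι_mul_grade ⁅a, m⁆]
      abel
  exact LinearMap.congr_fun h x

end ExteriorIdentities

/-! ### Contraction, pullback and antisymmetrization of graded forms -/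

section GradedCalculus

/-- Appending a vector on the right of a multivector is one further interior product after the
contraction, so statements about `contract` are proved by this induction. -/
theorem exterior_right_induction {R L : Type*} [CommRing R] [AddCommGroup L] [Module R L]
    {P : ExteriorAlgebra R L → Prop} (one : P 1) (smul : ∀ (r : R) x, P x → P (r • x))
    (add : ∀ x y, P x → P y → P (x + y)) (mul_ι : ∀ x n, P x → P (x * ExteriorAlgebra.ι R n))
    (x : ExteriorAlgebra R L) : P x := by
  refine CliffordAlgebra.right_induction (0 : QuadraticForm R L) (P := P) (fun r => ?_) add
    (fun n x h => mul_ι x n h) x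
  rw [Algebra.algebraMap_eq_smul_one]
  exact smul r 1 one

section Forms

variable {V W : Type*} [AddCommGroup V] [Module ℝ V] [TopologicalSpace V]
  [AddCommGroup W] [Module ℝ W] [TopologicalSpace W]

theorem contract_zero (α : GradedForms V) : contract (0 : ExteriorAlgebra ℝ V) α = 0 := by
  simp [contract]

theorem contract_neg (X : ExteriorAlgebra ℝ V) (α : GradedForms V) :
    contract (-X) α = -contract X α := by
  simp [contract]

theorem contract_sub (X Y : ExteriorAlgebra ℝ V) (α : GradedForms V) :
    contract (X - Y) α = contract X α - contract Y α := by
  simp [contract]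

@[simp] theorem pullback_apply (f : V →L[ℝ] W) (α : GradedForms W) (m : ℕ) :
    pullback f α m = (α m).compContinuousLinearMap f := rfl

theorem pullback_single (f : V →L[ℝ] W) (k : ℕ) (p : W [⋀^Fin k]→L[ℝ] ℝ) :
    pullback f (Pi.single k p) = Pi.single k (p.compContinuousLinearMap f) := by
  funext m
  by_cases h : m = k
  · subst h
    rw [pullback_apply, Pi.single_eq_same, Pi.single_eq_same]
  · rw [pullback_apply, Pi.single_eq_of_ne h, Pi.single_eq_of_ne h]
    rfl

theorem interior_pullback (f : V →L[ℝ] W) (v : V) (α : GradedForms W) :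
    interior v (pullback f α) = pullback f (interior (f v) α) := by
  funext m
  ext w
  change α (m + 1) (fun i => f ((Fin.cons v w : Fin (m + 1) → V) i)) =
    α (m + 1) (Fin.cons (f v) fun i => f (w i))
  congr 1
  funext i
  refine Fin.cases ?_ (fun i => ?_) i <;> simp

theorem contract_pullback (f : V →L[ℝ] W) (X : ExteriorAlgebra ℝ V) (α : GradedForms W) :
    contract X (pullback f α) =
      pullback f (contract (ExteriorAlgebra.map (f : V →ₗ[ℝ] W) X) α) := by
  induction X using exterior_right_induction generalizing α with
  | one => simp
  | smul r x hx => rw [contract_smul, map_smul, contract_smul, hx, map_smul]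
  | add x y hx hy => rw [contract_add, map_add, contract_add, hx, hy, map_add]
  | mul_ι x m hx =>
    rw [map_mul, contract_mul, contract_mul, hx, ExteriorAlgebra.map_apply_ι, contract_ι,
      contract_ι, interior_pullback]
    rfl

end Forms

variable {V W : Type*} [NormedAddCommGroup V] [NormedSpace ℝ V] [NormedAddCommGroup W]
  [NormedSpace ℝ W]

theorem interior_eq_curryLeft (v : V) (α : GradedForms V) (m : ℕ) :
    interior v α m = (α (m + 1)).curryLeft v := rfl

/-- The interior product in a fixed degree, as a continuous linear map. -/
def interiorCLM (v : V) (m : ℕ) : (V [⋀^Fin (m + 1)]→L[ℝ] ℝ) →L[ℝ] (V [⋀^Fin m]→L[ℝ] ℝ) :=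
  (ContinuousLinearMap.apply ℝ (V [⋀^Fin m]→L[ℝ] ℝ) v).comp
    (ContinuousAlternatingMap.curryLeftLI (𝕜 := ℝ) (E := V) (F := ℝ)
      (n := m)).toContinuousLinearMap

theorem _root_.HasFDerivAt.comp_fst_prod {U : Type*} [NormedAddCommGroup U] [NormedSpace ℝ U]
    {f : V → U} {f' : V →L[ℝ] U} {z : V} (h : HasFDerivAt f f' z) (w : W) :
    HasFDerivAt (fun q : V × W => f q.1) (f'.comp (ContinuousLinearMap.fst ℝ V W)) (z, w) :=
  HasFDerivAt.comp (g := f) (z, w) h hasFDerivAt_fst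

theorem isBoundedBilinearMap_curryLeft (m : ℕ) : IsBoundedBilinearMap ℝ
    (fun q : (V [⋀^Fin (m + 1)]→L[ℝ] ℝ) × V => q.1.curryLeft q.2) where
  add_left _ _ _ := rfl
  smul_left _ _ _ := rfl
  add_right f v w := map_add f.curryLeft v w
  smul_right c f w := map_smul f.curryLeft c w
  bound := ⟨1, one_pos, fun f v => by
    rw [one_mul, ← ContinuousAlternatingMap.norm_curryLeft]
    exact f.curryLeft.le_opNorm v⟩

theorem _root_.HasFDerivAt.curryLeft_apply {m : ℕ} {f : W → V [⋀^Fin (m + 1)]→L[ℝ] ℝ} {v : W → V}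
    {f' : W →L[ℝ] V [⋀^Fin (m + 1)]→L[ℝ] ℝ} {v' : W →L[ℝ] V} {x : W}
    (hf : HasFDerivAt f f' x) (hv : HasFDerivAt v v' x) :
    HasFDerivAt (fun y => (f y).curryLeft (v y))
      ((interiorCLM (v x) m).comp f' + (f x).curryLeft.comp v') x := by
  have h := (isBoundedBilinearMap_curryLeft m).hasFDerivAt (f x, v x)
  have h' := HasFDerivAt.comp
    (g := fun q : (V [⋀^Fin (m + 1)]→L[ℝ] ℝ) × V => q.1.curryLeft q.2) x h (hf.prodMk hv)
  refine h'.congr_fderiv (ContinuousLinearMap.ext fun w => ?_)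
  exact add_comm _ _

/-- The pullback in a fixed degree, as a continuous linear map. -/
abbrev pullbackCLM (f : V →L[ℝ] W) (m : ℕ) : (W [⋀^Fin m]→L[ℝ] ℝ) →L[ℝ] (V [⋀^Fin m]→L[ℝ] ℝ) :=
  ContinuousAlternatingMap.compContinuousLinearMapCLM f

/-- The antisymmetrization of a linear map with values in graded forms: the form
`(w₀, …, w_m) ↦ ∑ᵢ (-1)ⁱ T wᵢ (w₀, …, ŵᵢ, …, w_m)`. -/
def gradedAlt (T : ∀ m : ℕ, V →L[ℝ] V [⋀^Fin m]→L[ℝ] ℝ) : GradedForms V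
  | 0 => 0
  | m + 1 => ContinuousAlternatingMap.alternatizeUncurryFin (T m)

@[simp] theorem gradedAlt_zero_apply (T : ∀ m : ℕ, V →L[ℝ] V [⋀^Fin m]→L[ℝ] ℝ) :
    gradedAlt T 0 = 0 := rfl

@[simp] theorem gradedAlt_succ_apply (T : ∀ m : ℕ, V →L[ℝ] V [⋀^Fin m]→L[ℝ] ℝ) (m : ℕ) :
    gradedAlt T (m + 1) = ContinuousAlternatingMap.alternatizeUncurryFin (T m) := rfl

theorem gradedAlt_eq_zero {T : ∀ m : ℕ, V →L[ℝ] V [⋀^Fin m]→L[ℝ] ℝ} (h : ∀ m v, T m v = 0) :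
    gradedAlt T = 0 := by
  funext m
  cases m with
  | zero => rfl
  | succ m =>
    ext w
    simp [ContinuousAlternatingMap.alternatizeUncurryFin_apply, h]

theorem gradedAlt_add (S T : ∀ m : ℕ, V →L[ℝ] V [⋀^Fin m]→L[ℝ] ℝ) :
    gradedAlt (S + T) = gradedAlt S + gradedAlt T := by
  funext m
  cases m with
  | zero => simp
  | succ m => exact ContinuousAlternatingMap.alternatizeUncurryFin_add _ _

theorem gradedAlt_smul (c : ℝ) (T : ∀ m : ℕ, V →L[ℝ] V [⋀^Fin m]→L[ℝ] ℝ) :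
    gradedAlt (c • T) = c • gradedAlt T := by
  funext m
  cases m with
  | zero => simp
  | succ m => exact ContinuousAlternatingMap.alternatizeUncurryFin_smul _ _

/-- In the alternating sum, the term of index 0 feeds `v` to `T` as the direction; every other term
keeps `v` as first argument of the form and has its index, hence its sign, shifted by one. When `T`
is the derivative of a form, this is the algebraic content of Cartan's formula. -/
theorem interior_gradedAlt (v : V) (T : ∀ m : ℕ, V →L[ℝ] V [⋀^Fin m]→L[ℝ] ℝ) :
    interior v (gradedAlt T) =
      (fun m => T m v) - gradedAlt fun m => (interiorCLM v m).comp (T (m + 1)) := by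
  funext m
  ext w
  rw [interior_apply, gradedAlt_succ_apply, ContinuousAlternatingMap.alternatizeUncurryFin_apply,
    Fin.sum_univ_succ]
  have h0 : Fin.removeNth 0 (Fin.cons v w : Fin (m + 1) → V) = w := Fin.tail_cons _ _
  rw [h0]
  cases m with
  | zero => simp
  | succ m =>
    have h : ∀ i : Fin (m + 1), Fin.removeNth i.succ (Fin.cons v w : Fin (m + 2) → V) =
        Fin.cons v (Fin.removeNth i w) := by
      intro i
      funext j
      refine Fin.cases ?_ (fun j => ?_) j <;> simp [Fin.removeNth]
    simp only [h]
    simp [ContinuousAlternatingMap.alternatizeUncurryFin_apply, pow_succ, sub_eq_add_neg]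
    rfl

theorem pullback_gradedAlt (f : V →L[ℝ] W) (T : ∀ m : ℕ, W →L[ℝ] W [⋀^Fin m]→L[ℝ] ℝ) :
    pullback f (gradedAlt T) = gradedAlt fun m => (pullbackCLM f m).comp ((T m).comp f) := by
  funext m
  cases m with
  | zero => rfl
  | succ m =>
    ext w
    simp [ContinuousAlternatingMap.alternatizeUncurryFin_apply]
    rfl

/-- The derivation `(B · α) (w₁, …, w_m) = ∑ᵢ α (w₁, …, B wᵢ, …, w_m)` on graded forms. -/
def formDerivation (B : V →L[ℝ] V) (α : GradedForms V) : GradedForms V :=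
  gradedAlt fun m => (α (m + 1)).curryLeft.comp B

theorem formDerivation_add (B : V →L[ℝ] V) (α β : GradedForms V) :
    formDerivation B (α + β) = formDerivation B α + formDerivation B β := by
  rw [formDerivation, formDerivation, formDerivation, ← gradedAlt_add]
  rfl

theorem formDerivation_smul (c : ℝ) (B : V →L[ℝ] V) (α : GradedForms V) :
    formDerivation B (c • α) = c • formDerivation B α := by
  rw [formDerivation, formDerivation, ← gradedAlt_smul]
  rfl

/-- The minus sign of `interior_gradedAlt` becomes a plus because the interior products with `v` and
`B w` anticommute. -/
theorem interior_formDerivation (B : V →L[ℝ] V) (v : V) (α : GradedForms V) :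
    interior v (formDerivation B α) = interior (B v) α + formDerivation B (interior v α) := by
  rw [formDerivation, interior_gradedAlt, sub_eq_add_neg]
  congr 1
  rw [← neg_one_smul ℝ, ← gradedAlt_smul, formDerivation]
  congr 1
  funext m
  ext w u
  change (-1 : ℝ) * α (m + 2) (Fin.cons (B w) (Fin.cons v u)) =
    α (m + 2) (Fin.cons v (Fin.cons (B w) u))
  have h := (α (m + 2)).toAlternatingMap.map_swap (Fin.cons (B w) (Fin.cons v u))
    (i := 0) (j := 1) (by simp)
  have h' : (Fin.cons (B w) (Fin.cons v u) : Fin (m + 2) → V) ∘ Equiv.swap (0 : Fin (m + 2)) 1 =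
      Fin.cons v (Fin.cons (B w) u) := by
    funext j
    refine Fin.cases ?_ (fun j => Fin.cases ?_ (fun j => ?_) j) j
    · simp
    · simp
    · have : Equiv.swap (0 : Fin (m + 2)) 1 j.succ.succ = j.succ.succ :=
        Equiv.swap_apply_of_ne_of_ne (by simp [Fin.ext_iff]) (by simp [Fin.ext_iff])
      simp [this]
  rw [h'] at h
  rw [neg_one_mul]
  exact h.symm

/-- Identifies the derivation with the expression whose negative is the fibre component of
`completeLiftAt`; the resulting cancellation is the invariance of θ under complete lifts. -/
theorem formDerivation_single (B : V →L[ℝ] V) (k : ℕ) (p : V [⋀^Fin k]→L[ℝ] ℝ) :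
    formDerivation B (Pi.single k p) =
      Pi.single k (p.fderivCompContinuousLinearMap (ContinuousLinearMap.id ℝ V) B) := by
  funext m
  by_cases h : m = k
  · subst h
    rw [Pi.single_eq_same, formDerivation]
    cases m with
    | zero => ext; simp
    | succ m =>
      rw [gradedAlt_succ_apply, Pi.single_eq_same,
        ContinuousAlternatingMap.fderivCompContinuousLinearMap_eq_alternatizeUncurryFin]
      rfl
  · rw [Pi.single_eq_of_ne h, formDerivation]
    cases m with
    | zero => rfl
    | succ m =>
      rw [gradedAlt_succ_apply, Pi.single_eq_of_ne h]
      ext w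
      simp [ContinuousAlternatingMap.alternatizeUncurryFin_apply]

/-- Each of the `m` arguments contributes one copy of the form. This produces the degree in
`sum_curryLeft_wedgeForm`. -/
theorem formDerivation_id (α : GradedForms V) (m : ℕ) :
    formDerivation (ContinuousLinearMap.id ℝ V) α m = m • α m := by
  rw [formDerivation]
  cases m with
  | zero => simp
  | succ m =>
    rw [gradedAlt_succ_apply, ContinuousLinearMap.comp_id]
    exact ContinuousAlternatingMap.alternatizeUncurryFin_curryLeft _

end GradedCalculus

/-! ### Cartan calculus on the flat phase space `E × Λ^k E*` -/

section FlatPhaseSpace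

variable {E : Type*} [NormedAddCommGroup E] [NormedSpace ℝ E]

/-- The inclusion of `k`-forms into graded forms, followed by the projection to degree `m`. -/
def singleCLM (E : Type*) [NormedAddCommGroup E] [NormedSpace ℝ E] (k m : ℕ) :
    (E [⋀^Fin k]→L[ℝ] ℝ) →L[ℝ] (E [⋀^Fin m]→L[ℝ] ℝ) :=
  (ContinuousLinearMap.proj (R := ℝ) (φ := fun m : ℕ => E [⋀^Fin m]→L[ℝ] ℝ) m).comp
    (ContinuousLinearMap.single ℝ (fun m : ℕ => E [⋀^Fin m]→L[ℝ] ℝ) k)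

/-- The projection `E × Λ^k E* → E`. -/
abbrev baseProj (E : Type*) [NormedAddCommGroup E] [NormedSpace ℝ E] (k : ℕ) :
    E × (E [⋀^Fin k]→L[ℝ] ℝ) →L[ℝ] E :=
  ContinuousLinearMap.fst ℝ E (E [⋀^Fin k]→L[ℝ] ℝ)

/-- The exterior derivative of the canonical form `θ_(z,p) = p ∘ fst` on `E × Λ^k E*`. -/
def flatDTheta (E : Type*) [NormedAddCommGroup E] [NormedSpace ℝ E] (k : ℕ) :
    GradedForms (E × (E [⋀^Fin k]→L[ℝ] ℝ)) :=
  gradedAlt fun m => (pullbackCLM (baseProj E k) m).comp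
    ((singleCLM E k m).comp (ContinuousLinearMap.snd ℝ E (E [⋀^Fin k]→L[ℝ] ℝ)))

variable {L : Type*} [LieRing L] [LieAlgebra ℝ L] {k : ℕ}

/-- Cartan's formula `d i_v = L_v - i_v d` at a point, for a horizontal form with value `s` and
derivative `S`. On the left stands the derivative of its interior product, by the product rule; `B`
is the derivative of the projected vector field, and `S v + B · s` is the Lie derivative. -/
theorem gradedAlt_pullback_interior {v : E × (E [⋀^Fin k]→L[ℝ] ℝ)} {u : E} (hv : v.1 = u)
    (S : ∀ m : ℕ, (E × (E [⋀^Fin k]→L[ℝ] ℝ)) →L[ℝ] E [⋀^Fin m]→L[ℝ] ℝ) (B : E →L[ℝ] E)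
    (s : GradedForms E) :
    gradedAlt (fun m => (pullbackCLM (baseProj E k) m).comp ((interiorCLM u m).comp (S (m + 1)) +
      ((s (m + 1)).curryLeft.comp B).comp (baseProj E k))) =
    pullback (baseProj E k) ((fun m => S m v) + formDerivation B s) -
      interior v (gradedAlt fun m => (pullbackCLM (baseProj E k) m).comp (S m)) := by
  have e1 : (fun m => (pullbackCLM (baseProj E k) m).comp
      ((interiorCLM u m).comp (S (m + 1)) +
        ((s (m + 1)).curryLeft.comp B).comp (baseProj E k))) =
      (fun m => (interiorCLM v m).comp ((pullbackCLM (baseProj E k) (m + 1)).comp (S (m + 1)))) +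
      fun m => (pullbackCLM (baseProj E k) m).comp
        (((s (m + 1)).curryLeft.comp B).comp (baseProj E k)) := by
    subst hv
    funext m
    refine ContinuousLinearMap.ext fun w => ?_
    change (pullbackCLM (baseProj E k) m) (_ + _) = _ + _
    rw [map_add]
    congr 1
    exact (ContinuousAlternatingMap.curryLeft_compContinuousLinearMap (S (m + 1) w)
      (baseProj E k) v).symm
  have e3 : gradedAlt (fun m => (pullbackCLM (baseProj E k) m).comp
      (((s (m + 1)).curryLeft.comp B).comp (baseProj E k))) =
      pullback (baseProj E k) (formDerivation B s) :=
    (pullback_gradedAlt _ _).symm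
  rw [e1, gradedAlt_add, e3, interior_gradedAlt, map_add]
  have e6 : (fun m => (pullbackCLM (baseProj E k) m).comp (S m) v) =
    pullback (baseProj E k) (fun m => S m v) := rfl
  rw [e6]
  abel

set_option maxHeartbeats 400000 in
/-- The derivative of the contraction of the canonical form of `E × Λ^k E*` with an element of the
exterior algebra of a Lie algebra acting on `E` by vector fields `a`, and the exterior derivative
of this contraction in terms of the complete lifts `ℓ`. -/
theorem exists_hasFDerivAt_contract (a : E → L →ₗ[ℝ] E) (z₀ : E) (p₀ : E [⋀^Fin k]→L[ℝ] ℝ)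
    (A : L → E →L[ℝ] E) (hA : ∀ ξ, HasFDerivAt (fun z => a z ξ) (A ξ) z₀)
    (hbr : ∀ ξ η, a z₀ ⁅ξ, η⁆ = A η (a z₀ ξ) - A ξ (a z₀ η))
    (ℓ : L →ₗ[ℝ] E × (E [⋀^Fin k]→L[ℝ] ℝ))
    (hℓ : ∀ ξ, ℓ ξ = (a z₀ ξ,
      -p₀.fderivCompContinuousLinearMap (ContinuousLinearMap.id ℝ E) (A ξ)))
    (Y : ExteriorAlgebra ℝ L) :
    ∃ S : ∀ m : ℕ, (E × (E [⋀^Fin k]→L[ℝ] ℝ)) →L[ℝ] E [⋀^Fin m]→L[ℝ] ℝ,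
      (∀ m, HasFDerivAt (fun q : E × (E [⋀^Fin k]→L[ℝ] ℝ) =>
        contract (ExteriorAlgebra.map (a q.1) Y) (Pi.single k q.2) m) (S m) (z₀, p₀)) ∧
      (∀ ξ, (fun m => S m (ℓ ξ)) +
        formDerivation (A ξ) (contract (ExteriorAlgebra.map (a z₀) Y) (Pi.single k p₀)) =
          contract (ExteriorAlgebra.map (a z₀) (adExt ξ Y)) (Pi.single k p₀)) ∧
      gradedAlt (fun m => (pullbackCLM (baseProj E k) m).comp (S m)) =
        contract (ExteriorAlgebra.map ℓ (grade ℝ Y)) (flatDTheta E k) +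
        pullback (baseProj E k) (contract (ExteriorAlgebra.map (a z₀)
          (ceBoundary ℝ L (grade ℝ Y))) (Pi.single k p₀)) := by
  -- The claims are proved together: the exterior derivative for `x ∧ n` needs the Lie derivative of
  -- the contraction by `x` along `ℓ n`, which is the second claim for `x`.
  induction Y using exterior_right_induction with
  | one =>
    refine ⟨fun m => (singleCLM E k m).comp (ContinuousLinearMap.snd ℝ E _), fun m => ?_,
      fun ξ => ?_, ?_⟩
    · simp only [map_one, contract_one]
      exact ((singleCLM E k m).comp (ContinuousLinearMap.snd ℝ E _)).hasFDerivAt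
    -- Invariance of θ: the fibre component of `ℓ ξ` is the negative of the derivation by `A ξ`.
    · rw [adExt_one, map_zero, map_one, contract_one, formDerivation_single, hℓ, contract_zero]
      funext m
      refine (congrArg (· + _) (map_neg (singleCLM E k m) _)).trans ?_
      exact neg_add_cancel _
    · rw [map_one, map_one, contract_one, ceBoundary_one, map_zero, contract_zero, map_zero,
        add_zero]
      rfl
  | smul r x hx =>
    obtain ⟨S, h1, h2, h3⟩ := hx
    refine ⟨r • S, fun m => ?_, fun ξ => ?_, ?_⟩
    · simp only [map_smul, contract_smul]
      exact (h1 m).const_smul r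
    · rw [map_smul, contract_smul, formDerivation_smul, map_smul, map_smul, contract_smul, ← h2,
        smul_add]
      rfl
    · rw [map_smul, map_smul, contract_smul, map_smul, map_smul, contract_smul, map_smul,
        ← smul_add, ← h3, ← gradedAlt_smul]
      congr 1
  | add x y hx hy =>
    obtain ⟨S, h1, h2, h3⟩ := hx
    obtain ⟨T, g1, g2, g3⟩ := hy
    refine ⟨S + T, fun m => ?_, fun ξ => ?_, ?_⟩
    · simp only [map_add, contract_add]
      exact (h1 m).add (g1 m)
    · rw [map_add, contract_add, formDerivation_add, map_add, map_add, contract_add, ← h2, ← g2,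
        add_add_add_comm]
      rfl
    · rw [map_add, map_add, contract_add, map_add, map_add, contract_add, map_add,
        add_add_add_comm, ← h3, ← g3, ← gradedAlt_add]
      congr 1
  | mul_ι x n hx =>
    obtain ⟨S, h1, h2, h3⟩ := hx
    obtain ⟨s, hs⟩ : ∃ s, s = contract (ExteriorAlgebra.map (a z₀) x)
      (Pi.single k p₀ : GradedForms E) := ⟨_, rfl⟩
    have hmul : ∀ z x n (α : GradedForms E), contract (ExteriorAlgebra.map (a z)
        (x * ExteriorAlgebra.ι ℝ n)) α =
          interior (a z n) (contract (ExteriorAlgebra.map (a z) x) α) := fun z x n α => by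
      rw [map_mul, contract_mul, ExteriorAlgebra.map_apply_ι, contract_ι]
    refine ⟨fun m => (interiorCLM (a z₀ n) m).comp (S (m + 1)) +
      ((s (m + 1)).curryLeft.comp (A n)).comp (baseProj E k), fun m => ?_,
      fun ξ => ?_, ?_⟩
    · simp only [hmul, interior_eq_curryLeft]
      have d2 : HasFDerivAt (fun q : E × (E [⋀^Fin k]→L[ℝ] ℝ) => a q.1 n)
          ((A n).comp (baseProj E k)) (z₀, p₀) :=
        (hA n).comp_fst_prod p₀
      have d3 := HasFDerivAt.curryLeft_apply (f := fun q : E × (E [⋀^Fin k]→L[ℝ] ℝ) =>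
        contract (ExteriorAlgebra.map (a q.1) x) (Pi.single k q.2) (m + 1))
        (v := fun q : E × (E [⋀^Fin k]→L[ℝ] ℝ) => a q.1 n) (h1 (m + 1)) d2
      rw [hs]
      exact d3
    -- Of the two halves of the bracket of `ξ` and `n`, the one with `A n` comes from
    -- differentiating the field `n` along `ξ`, the one with `A ξ` from moving the derivation past
    -- the interior product with `n`.
    · rw [hmul, ← hs, adExt_mul, adExt_ι, map_add, contract_add, hmul, hmul, hbr, map_sub,
        ← hs]
      have e := congrArg (interior (a z₀ n)) (h2 ξ)
      rw [map_add, ← hs, interior_formDerivation] at e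
      rw [← e, LinearMap.sub_apply]
      have e' : (fun m => ((interiorCLM (a z₀ n) m).comp (S (m + 1)) +
          ((s (m + 1)).curryLeft.comp (A n)).comp (baseProj E k)) (ℓ ξ)) =
          interior (a z₀ n) (fun m => S m (ℓ ξ)) + interior (A n (a z₀ ξ)) s := by
        funext m
        rw [hℓ]
        rfl
      rw [e']
      abel
    · have hv : (ℓ n).1 = a z₀ n := by rw [hℓ]
      -- Cartan's formula for the last factor `n`: its Lie derivative is `h2` at `ξ = n`, its other
      -- term is `h3` contracted by `ℓ n`. The right recursion `ceBoundary_mul_ι` combines the two.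
      have key := gradedAlt_pullback_interior hv S (A n) s
      refine key.trans ?_
      rw [h3, hs, h2, map_mul, grade_ι, mul_neg, map_neg, contract_neg, map_mul, contract_mul,
        ExteriorAlgebra.map_apply_ι, contract_ι, map_neg, ceBoundary_mul_ι, grade_grade, neg_sub,
        map_sub, contract_sub, hmul, map_add, interior_pullback, map_sub,
        show baseProj E k (ℓ n) = a z₀ n from hv]
      abel

end FlatPhaseSpace

/-! ### Forms, vector fields and the exterior derivative in charts -/

section Charts

variable {E H : Type*} [NormedAddCommGroup E] [NormedSpace ℝ E] [TopologicalSpace H]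
  {I : ModelWithCorners ℝ E H} {M : Type*} [TopologicalSpace M] [ChartedSpace H M]

variable (I) in
/-- The derivative at `y` of the chart at `x`. -/
def toChart (x y : M) : E →L[ℝ] E := mfderiv I 𝓘(ℝ, E) (extChartAt I x) y

variable (I) in
/-- The derivative at `z` of the inverse of the chart at `x`. -/
def ofChart (x : M) (z : E) : E →L[ℝ] E := mfderiv 𝓘(ℝ, E) I (extChartAt I x).symm z

/-- The degree `m` component at `y` of a field of forms, as a form on the model space. -/
def component (α : FormField I M) (m : ℕ) (y : M) : E [⋀^Fin m]→L[ℝ] ℝ := α y m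

/-- The representative of the degree `m` component of a field of forms in the chart at `x`. -/
def chartForm (x : M) (m : ℕ) (α : FormField I M) (z : E) : E [⋀^Fin m]→L[ℝ] ℝ :=
  (component α m ((extChartAt I x).symm z)).compContinuousLinearMap (ofChart I x z)

theorem component_extD_succ (α : FormField I M) (x : M) (m : ℕ) :
    component (extD α) (m + 1) x = (extDeriv (chartForm x m α)
      (extChartAt I x x)).compContinuousLinearMap (toChart I x x) := rfl

theorem extD_eq_zero {p : ℕ} {α : FormField I M} (h0 : ∀ x m, m ≠ p → α x m = 0) (x : M) (m : ℕ)
    (hm : m ≠ p + 1) : extD α x m = 0 := by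
  cases m with
  | zero => rfl
  | succ m =>
    change component (extD α) (m + 1) x = 0
    have : chartForm x m α = fun _ => 0 := by
      funext z
      have h0 : component α m ((extChartAt I x).symm z) = 0 := h0 _ _ (by omega)
      rw [chartForm, h0]
      rfl
    rw [component_extD_succ, this, extDeriv, fderiv_fun_const]
    ext w
    simp [ContinuousAlternatingMap.alternatizeUncurryFin_apply]

theorem target_mem_nhds [I.Boundaryless] {x : M} {z : E} (hz : z ∈ (extChartAt I x).target) :
    (extChartAt I x).target ∈ 𝓝 z := (isOpen_extChartAt_target x).mem_nhds hz

variable [IsManifold I ∞ M]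

theorem contMDiffAt_chart {x y : M} (hy : y ∈ (extChartAt I x).source) :
    ContMDiffAt I 𝓘(ℝ, E) ∞ (extChartAt I x) y :=
  contMDiffAt_extChartAt' (by rwa [extChartAt_source] at hy)

theorem isManifold_one : IsManifold I 1 M := .of_le (n := ∞) (by simp)

variable [I.Boundaryless]

theorem toChart_comp_ofChart {x : M} {z : E} (hz : z ∈ (extChartAt I x).target) :
    (toChart I x ((extChartAt I x).symm z)).comp (ofChart I x z) = ContinuousLinearMap.id ℝ E := by
  have := isManifold_one (I := I) (M := M)
  have h := mfderiv_extChartAt_comp_mfderivWithin_extChartAt_symm (I := I) hz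
  rw [I.range_eq_univ, mfderivWithin_univ] at h
  exact h

theorem ofChart_comp_toChart {x : M} {z : E} (hz : z ∈ (extChartAt I x).target) :
    (ofChart I x z).comp (toChart I x ((extChartAt I x).symm z)) = ContinuousLinearMap.id ℝ E := by
  have := isManifold_one (I := I) (M := M)
  have h := mfderivWithin_extChartAt_symm_comp_mfderiv_extChartAt (I := I) hz
  rw [I.range_eq_univ, mfderivWithin_univ] at h
  exact h

theorem toChart_comp_ofChart' {x y : M} (hy : y ∈ (extChartAt I x).source) :
    (toChart I x y).comp (ofChart I x (extChartAt I x y)) = ContinuousLinearMap.id ℝ E := by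
  have h := toChart_comp_ofChart ((extChartAt I x).map_source hy)
  rwa [(extChartAt I x).left_inv hy] at h

theorem ofChart_comp_toChart' {x y : M} (hy : y ∈ (extChartAt I x).source) :
    (ofChart I x (extChartAt I x y)).comp (toChart I x y) = ContinuousLinearMap.id ℝ E := by
  have h := ofChart_comp_toChart ((extChartAt I x).map_source hy)
  rwa [(extChartAt I x).left_inv hy] at h

/-- The tangent space at `x` is identified with the model space through the chart at `x` itself.
Hence computations at the centre of a chart carry no transition terms. -/
theorem ofChart_self (x : M) : ofChart I x (extChartAt I x x) = ContinuousLinearMap.id ℝ E := by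
  have := isManifold_one (I := I) (M := M)
  have h1 := mfderivWithin_range_extChartAt_symm (I := I) (x := x)
  rw [I.range_eq_univ, mfderivWithin_univ] at h1
  exact h1

theorem toChart_self (x : M) : toChart I x x = ContinuousLinearMap.id ℝ E := by
  have h := ofChart_comp_toChart' (I := I) (mem_extChartAt_source x)
  rwa [ofChart_self, ContinuousLinearMap.id_comp] at h

theorem ofChart_inverse {x : M} {z : E} (hz : z ∈ (extChartAt I x).target) :
    (ofChart I x z).inverse = toChart I x ((extChartAt I x).symm z) :=
  ContinuousLinearMap.inverse_eq (ofChart_comp_toChart hz) (toChart_comp_ofChart hz)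

theorem contMDiffAt_symm {x : M} {z : E} (hz : z ∈ (extChartAt I x).target) :
    ContMDiffAt 𝓘(ℝ, E) I ∞ (extChartAt I x).symm z :=
  (contMDiffOn_extChartAt_symm (n := ∞) x).contMDiffAt (target_mem_nhds hz)

theorem contDiffAt_transition {x x₀ : M} {z : E} (hz : z ∈ (extChartAt I x).target)
    (hz' : (extChartAt I x).symm z ∈ (extChartAt I x₀).source) :
    ContDiffAt ℝ ∞ (fun z => extChartAt I x₀ ((extChartAt I x).symm z)) z := by
  rw [← contMDiffAt_iff_contDiffAt]
  exact (contMDiffAt_chart hz').comp z (contMDiffAt_symm hz)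

theorem fderiv_transition {x x₀ : M} {z : E} (hz : z ∈ (extChartAt I x).target)
    (hz' : (extChartAt I x).symm z ∈ (extChartAt I x₀).source) :
    fderiv ℝ (fun z => extChartAt I x₀ ((extChartAt I x).symm z)) z =
      (toChart I x₀ ((extChartAt I x).symm z)).comp (ofChart I x z) := by
  have h1 := ((contMDiffAt_chart hz').mdifferentiableAt (by simp)).hasMFDerivAt
  have h2 := ((contMDiffAt_symm hz).mdifferentiableAt (by simp)).hasMFDerivAt
  obtain ⟨C, hC⟩ : ∃ C : E →L[ℝ] E,
    C = (toChart I x₀ ((extChartAt I x).symm z)).comp (ofChart I x z) := ⟨_, rfl⟩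
  have h3 : HasMFDerivAt 𝓘(ℝ, E) 𝓘(ℝ, E) (fun z => extChartAt I x₀ ((extChartAt I x).symm z)) z
      C := by
    rw [hC]
    exact h1.comp z h2
  rw [← hC]
  have h4 : HasFDerivAt (fun z => extChartAt I x₀ ((extChartAt I x).symm z)) C z :=
    hasMFDerivAt_iff_hasFDerivAt.1 h3
  exact h4.fderiv

theorem chartForm_transition {x x₀ : M} {z : E} (hz : z ∈ (extChartAt I x).target)
    (hz' : (extChartAt I x).symm z ∈ (extChartAt I x₀).source) (m : ℕ) (α : FormField I M) :
    chartForm x m α z = (chartForm x₀ m α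
      (extChartAt I x₀ ((extChartAt I x).symm z))).compContinuousLinearMap
        (fderiv ℝ (fun z => extChartAt I x₀ ((extChartAt I x).symm z)) z) := by
  rw [fderiv_transition hz hz', chartForm, chartForm, (extChartAt I x₀).left_inv hz']
  have h : (ofChart I x₀ (extChartAt I x₀ ((extChartAt I x).symm z))).comp
      ((toChart I x₀ ((extChartAt I x).symm z)).comp (ofChart I x z)) = ofChart I x z := by
    rw [← ContinuousLinearMap.comp_assoc, ofChart_comp_toChart' hz', ContinuousLinearMap.id_comp]
  conv_lhs => rw [← h]
  rfl

/-- The exterior derivative can be computed in any chart. -/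
theorem component_extD_eq {x x₀ : M} (hx : x ∈ (extChartAt I x₀).source) (m : ℕ)
    (α : FormField I M) (hα : DifferentiableAt ℝ (chartForm x₀ m α) (extChartAt I x₀ x)) :
    component (extD α) (m + 1) x = (extDeriv (chartForm x₀ m α)
      (extChartAt I x₀ x)).compContinuousLinearMap (toChart I x₀ x) := by
  have hz := mem_extChartAt_target (I := I) x
  have hxx : (extChartAt I x).symm (extChartAt I x x) = x := extChartAt_to_inv x
  have hz' : (extChartAt I x).symm (extChartAt I x x) ∈ (extChartAt I x₀).source := by rwa [hxx]
  have hev : chartForm x m α =ᶠ[𝓝 (extChartAt I x x)] fun z => (chartForm x₀ m α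
      (extChartAt I x₀ ((extChartAt I x).symm z))).compContinuousLinearMap
        (fderiv ℝ (fun z => extChartAt I x₀ ((extChartAt I x).symm z)) z) := by
    have h1 : ∀ᶠ z in 𝓝 (extChartAt I x x),
        (extChartAt I x).symm z ∈ (extChartAt I x₀).source :=
      (continuousAt_extChartAt_symm x).eventually
        ((isOpen_extChartAt_source x₀).mem_nhds hz')
    filter_upwards [h1, target_mem_nhds hz] with z h1 h2
    exact chartForm_transition h2 h1 m α
  rw [component_extD_succ, hev.extDeriv_eq, toChart_self]
  have hα' : DifferentiableAt ℝ (chartForm x₀ m α)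
      (extChartAt I x₀ ((extChartAt I x).symm (extChartAt I x x))) := by rwa [hxx]
  -- Naturality of `d` under the transition map between the two charts.
  rw [extDeriv_pullback (f := fun z => extChartAt I x₀ ((extChartAt I x).symm z)) hα'
    (contDiffAt_transition hz hz') (by simpa using WithTop.coe_le_coe.2 (le_top : (2 : ℕ∞) ≤ ⊤)),
    fderiv_transition hz hz', hxx, ofChart_self,
    ContinuousLinearMap.comp_id]
  rfl

theorem contMDiffAt_comp_chart_iff {F : Type*} [NormedAddCommGroup F] [NormedSpace ℝ F] {x₀ x : M}
    (hx : x ∈ (extChartAt I x₀).source) {f : M → F} {g : E → F}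
    (h : ∀ y ∈ (extChartAt I x₀).source, f y = g (extChartAt I x₀ y)) :
    ContMDiffAt I 𝓘(ℝ, F) ∞ f x ↔ ContDiffAt ℝ ∞ g (extChartAt I x₀ x) := by
  constructor
  · intro hf
    rw [← contMDiffAt_iff_contDiffAt]
    have hz := (extChartAt I x₀).map_source hx
    have hf' : ContMDiffAt I 𝓘(ℝ, F) ∞ f ((extChartAt I x₀).symm (extChartAt I x₀ x)) := by
      rwa [(extChartAt I x₀).left_inv hx]
    refine (hf'.comp (extChartAt I x₀ x) (contMDiffAt_symm hz)).congr_of_eventuallyEq ?_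
    filter_upwards [target_mem_nhds hz] with z hz
    rw [Function.comp_apply, h _ ((extChartAt I x₀).map_target hz), (extChartAt I x₀).right_inv hz]
  · intro hg
    refine (hg.contMDiffAt.comp x (contMDiffAt_chart hx)).congr_of_eventuallyEq ?_
    filter_upwards [(isOpen_extChartAt_source x₀).mem_nhds hx] with y hy
    exact h y hy

/-- The trivialization of the bundle of forms at `x₀` is precomposition with the derivative of the
inverse chart, so in it a section becomes its chart representative. -/
theorem contMDiffAt_form_iff {p : ℕ} {α : FormField I M} (x₀ : M) {x : M}
    (hx : x ∈ (extChartAt I x₀).source) :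
    ContMDiffAt I (I.prod 𝓘(ℝ, E [⋀^Fin p]→L[ℝ] ℝ)) ∞ (fun x =>
      TotalSpace.mk' (E := fun x : M => TangentSpace I x [⋀^Fin p]→L[ℝ] Bundle.Trivial M ℝ x)
        (E [⋀^Fin p]→L[ℝ] ℝ) x (α x p)) x ↔
    ContDiffAt ℝ ∞ (chartForm x₀ p α) (extChartAt I x₀ x) := by
  have hx' : x ∈ (chartAt H x₀).source := by rwa [extChartAt_source] at hx
  rw [Bundle.Trivialization.contMDiffAt_section_iff
    (trivializationAt (E [⋀^Fin p]→L[ℝ] ℝ) (fun x : M => TangentSpace I x [⋀^Fin p]→L[ℝ]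
      Bundle.Trivial M ℝ x) x₀) ⟨hx', mem_univ _⟩]
  refine contMDiffAt_comp_chart_iff hx fun y hy => ?_
  have := isManifold_one (I := I) (M := M)
  have hy' : y ∈ (chartAt H x₀).source := by rwa [extChartAt_source] at hy
  have h := TangentBundle.symmL_trivializationAt (I := I) hy'
  rw [I.range_eq_univ, mfderivWithin_univ] at h
  have h2 : (trivializationAt E (TangentSpace I) x₀).symmL ℝ y =
    ofChart I x₀ (extChartAt I x₀ y) := h
  rw [FiberBundle.trivializationAt_continuousAlternatingMap_apply,
    ContinuousAlternatingMap.inCoordinates, chartForm, (extChartAt I x₀).left_inv hy, ← h2]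
  ext w
  simp
  rfl

theorem isForm_of_contDiffAt {p : ℕ} {α : FormField I M} (h0 : ∀ x m, m ≠ p → α x m = 0)
    (h : ∀ x, ContDiffAt ℝ ∞ (chartForm x p α) (extChartAt I x x)) : IsForm p α :=
  ⟨h0, fun x => (contMDiffAt_form_iff x (mem_extChartAt_source x)).2 (h x)⟩

theorem IsForm.contDiffAt_chartForm {p : ℕ} {α : FormField I M} (h : IsForm p α) {x : M} {z : E}
    (hz : z ∈ (extChartAt I x).target) (m : ℕ) : ContDiffAt ℝ ∞ (chartForm x m α) z := by
  by_cases hm : m = p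
  · subst hm
    have h1 := (contMDiffAt_form_iff x ((extChartAt I x).map_target hz)).1 (h.2 _)
    rwa [(extChartAt I x).right_inv hz] at h1
  · have : chartForm x m α = fun _ => 0 := by
      funext z
      have h0 : component α m ((extChartAt I x).symm z) = 0 := h.1 _ _ hm
      rw [chartForm, h0]
      rfl
    rw [this]
    exact contDiffAt_const

theorem chartForm_extD {α : FormField I M} {x : M} {z : E} (hz : z ∈ (extChartAt I x).target)
    (m : ℕ) (hα : DifferentiableAt ℝ (chartForm x m α) z) :
    chartForm x (m + 1) (extD α) z = extDeriv (chartForm x m α) z := by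
  have h := component_extD_eq ((extChartAt I x).map_target hz) m α
    (by rwa [(extChartAt I x).right_inv hz])
  rw [chartForm, h, (extChartAt I x).right_inv hz]
  have h2 := toChart_comp_ofChart hz
  ext w
  change extDeriv (chartForm x m α) z (fun i => ((toChart I x ((extChartAt I x).symm z)).comp
    (ofChart I x z)) (w i)) = _
  rw [h2]
  rfl

/-- The exterior derivative of a smooth form is smooth. -/
theorem IsForm.extD {p : ℕ} {α : FormField I M} (h : IsForm p α) : IsForm (p + 1) (extD α) := by
  refine isForm_of_contDiffAt (extD_eq_zero h.1) fun x => ?_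
  have hz := mem_extChartAt_target (I := I) x
  have hev : chartForm x (p + 1) (MultiPhase.extD α) =ᶠ[𝓝 (extChartAt I x x)]
      extDeriv (chartForm x p α) := by
    filter_upwards [target_mem_nhds hz] with z hz
    exact chartForm_extD hz p ((h.contDiffAt_chartForm hz p).differentiableAt (by simp))
  refine ContDiffAt.congr_of_eventuallyEq ?_ hev
  have h1 : ContDiffAt ℝ ∞ (fderiv ℝ (chartForm x p α)) (extChartAt I x x) :=
    (h.contDiffAt_chartForm hz p).fderiv_right (m := ∞) (by simp)
  exact (ContinuousAlternatingMap.alternatizeUncurryFinCLM ℝ E ℝ).contDiff.contDiffAt.comp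
    (extChartAt I x x) h1

/-- The representative of a vector field in the chart at `x`. -/
def chartVF (x : M) (X : ∀ y : M, TangentSpace I y) (z : E) : E :=
  toChart I x ((extChartAt I x).symm z) (X ((extChartAt I x).symm z))

theorem contMDiffAt_vectorField_iff {X : ∀ y : M, TangentSpace I y} (x₀ : M) {x : M}
    (hx : x ∈ (extChartAt I x₀).source) :
    ContMDiffAt I (I.prod 𝓘(ℝ, E)) ∞ (fun x => TotalSpace.mk' E x (X x)) x ↔
      ContDiffAt ℝ ∞ (chartVF x₀ X) (extChartAt I x₀ x) := by
  have hx' : x ∈ (chartAt H x₀).source := by rwa [extChartAt_source] at hx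
  rw [Bundle.Trivialization.contMDiffAt_section_iff (trivializationAt E (TangentSpace I) x₀) hx']
  refine contMDiffAt_comp_chart_iff hx fun y hy => ?_
  have := isManifold_one (I := I) (M := M)
  have hy' : y ∈ (chartAt H x₀).source := by rwa [extChartAt_source] at hy
  have h := TangentBundle.continuousLinearMapAt_trivializationAt (I := I) hy'
  have h2 : (trivializationAt E (TangentSpace I) x₀).continuousLinearMapAt ℝ y =
    toChart I x₀ y := h
  rw [chartVF, (extChartAt I x₀).left_inv hy]
  refine Eq.trans ?_ (congrArg (fun A : E →L[ℝ] E => A (X y : E)) h2)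
  exact (congrFun (Bundle.Trivialization.coe_linearMapAt_of_mem (R := ℝ)
    (trivializationAt E (TangentSpace I) x₀) hy') (X y)).symm

/-- A vector field whose representatives in charts are smooth. -/
def mkVF (X : ∀ y : M, TangentSpace I y)
    (h : ∀ x, ContDiffAt ℝ ∞ (chartVF x X) (extChartAt I x x)) : VF I M where
  toFun := X
  contMDiff_toFun x := (contMDiffAt_vectorField_iff x (mem_extChartAt_source x)).2 (h x)

theorem VF.contDiffAt_chartVF (X : VF I M) {x : M} {z : E} (hz : z ∈ (extChartAt I x).target) :
    ContDiffAt ℝ ∞ (chartVF x X) z := by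
  have h1 := (contMDiffAt_vectorField_iff x ((extChartAt I x).map_target hz)).1
    (X.contMDiff_toFun _)
  rwa [(extChartAt I x).right_inv hz] at h1

end Charts

/-! ### Bundle charts of the phase space -/

section PhaseCharts

variable {E N : Type*} [NormedAddCommGroup E] [NormedSpace ℝ E] [TopologicalSpace N]
  [ChartedSpace E N] [IsManifold 𝓘(ℝ, E) ∞ N] {k : ℕ}

/-- The point of the phase space over `y` given by a form on the model space. -/
def phasePoint (y : N) (q : E [⋀^Fin k]→L[ℝ] ℝ) : PhaseSpace E N k := ⟨y, q⟩

/-- The form on the model space given by a point of the phase space. -/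
def PhaseSpace.fiber (μ : PhaseSpace E N k) : E [⋀^Fin k]→L[ℝ] ℝ := μ.2

theorem mem_source_phase {μ ν : PhaseSpace E N k} :
    ν ∈ (extChartAt (phaseModel E k) μ).source ↔ ν.1 ∈ (extChartAt 𝓘(ℝ, E) μ.1).source := by
  rw [extChartAt_source, FiberBundle.chartedSpace_chartAt, extChartAt_source]
  simp only [mfld_simps]
  constructor
  · intro h
    exact h.2
  · intro h
    exact ⟨⟨h, mem_univ _⟩, h⟩

/-- The chart at `μ` depends on `μ` only through its base point and is linear on the fibres: it
pulls a form back along the inverse of the base chart. -/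
theorem extChartAt_phase {μ ν : PhaseSpace E N k}
    (hν : ν.1 ∈ (extChartAt 𝓘(ℝ, E) μ.1).source) :
    extChartAt (phaseModel E k) μ ν = (extChartAt 𝓘(ℝ, E) μ.1 ν.1,
      ν.fiber.compContinuousLinearMap (ofChart 𝓘(ℝ, E) μ.1 (extChartAt 𝓘(ℝ, E) μ.1 ν.1))) := by
  rw [FiberBundle.extChartAt]
  refine Prod.ext rfl ?_
  have := isManifold_one (I := 𝓘(ℝ, E)) (M := N)
  have hy' : ν.1 ∈ (chartAt E μ.1).source := by rwa [extChartAt_source] at hν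
  have h := TangentBundle.symmL_trivializationAt (I := 𝓘(ℝ, E)) hy'
  rw [ModelWithCorners.range_eq_univ, mfderivWithin_univ] at h
  have h2 : (trivializationAt E (TangentSpace 𝓘(ℝ, E)) μ.1).symmL ℝ ν.1 =
    ofChart 𝓘(ℝ, E) μ.1 (extChartAt 𝓘(ℝ, E) μ.1 ν.1) := h
  rw [← h2]
  show (trivializationAt (E [⋀^Fin k]→L[ℝ] ℝ) (fun x : N => TangentSpace 𝓘(ℝ, E) x [⋀^Fin k]→L[ℝ]
    Bundle.Trivial N ℝ x) μ.1 ν).2 = _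
  rw [FiberBundle.trivializationAt_continuousAlternatingMap_apply]
  ext w
  simp [ContinuousAlternatingMap.inCoordinates]
  rfl

theorem extChartAt_phase_self (μ : PhaseSpace E N k) :
    extChartAt (phaseModel E k) μ μ = (extChartAt 𝓘(ℝ, E) μ.1 μ.1, μ.fiber) := by
  rw [extChartAt_phase (mem_extChartAt_source μ.1), ofChart_self]
  rfl

theorem extChartAt_phase_symm {μ : PhaseSpace E N k} {z : E} (p : E [⋀^Fin k]→L[ℝ] ℝ)
    (hz : z ∈ (extChartAt 𝓘(ℝ, E) μ.1).target) :
    (extChartAt (phaseModel E k) μ).symm (z, p) =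
      phasePoint ((extChartAt 𝓘(ℝ, E) μ.1).symm z)
        (p.compContinuousLinearMap
          (toChart 𝓘(ℝ, E) μ.1 ((extChartAt 𝓘(ℝ, E) μ.1).symm z))) := by
  have hs : (phasePoint ((extChartAt 𝓘(ℝ, E) μ.1).symm z) (p.compContinuousLinearMap
      (toChart 𝓘(ℝ, E) μ.1 ((extChartAt 𝓘(ℝ, E) μ.1).symm z)))).1 ∈
        (extChartAt 𝓘(ℝ, E) μ.1).source := (extChartAt 𝓘(ℝ, E) μ.1).map_target hz
  have h := extChartAt_phase (μ := μ) hs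
  have h' : extChartAt (phaseModel E k) μ (phasePoint ((extChartAt 𝓘(ℝ, E) μ.1).symm z)
      (p.compContinuousLinearMap
        (toChart 𝓘(ℝ, E) μ.1 ((extChartAt 𝓘(ℝ, E) μ.1).symm z)))) = (z, p) := by
    rw [h]
    refine Prod.ext ((extChartAt 𝓘(ℝ, E) μ.1).right_inv hz) ?_
    change (p.compContinuousLinearMap _).compContinuousLinearMap
      (ofChart 𝓘(ℝ, E) μ.1 (extChartAt 𝓘(ℝ, E) μ.1 ((extChartAt 𝓘(ℝ, E) μ.1).symm z))) = p
    rw [(extChartAt 𝓘(ℝ, E) μ.1).right_inv hz]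
    have h2 := toChart_comp_ofChart hz
    ext w
    change p (fun i => ((toChart 𝓘(ℝ, E) μ.1 ((extChartAt 𝓘(ℝ, E) μ.1).symm z)).comp
      (ofChart 𝓘(ℝ, E) μ.1 z)) (w i)) = _
    rw [h2]
    rfl
  rw [← h', (extChartAt (phaseModel E k) μ).left_inv (mem_source_phase.2 hs)]

theorem mem_target_phase {μ : PhaseSpace E N k} {q : E × (E [⋀^Fin k]→L[ℝ] ℝ)} :
    q ∈ (extChartAt (phaseModel E k) μ).target ↔ q.1 ∈ (extChartAt 𝓘(ℝ, E) μ.1).target := by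
  rw [FiberBundle.extChartAt_target]
  constructor
  · rintro ⟨h, -⟩
    exact h.1
  · intro h
    have h' := (extChartAt 𝓘(ℝ, E) μ.1).map_target h
    rw [extChartAt_source] at h'
    exact ⟨⟨h, h', mem_univ _⟩, mem_univ _⟩

/-- The derivative of the projection, as a map between model spaces. -/
def dprojModel (μ : PhaseSpace E N k) : E × (E [⋀^Fin k]→L[ℝ] ℝ) →L[ℝ] E := dproj μ

/-- Near `q`, the projection after the inverse bundle chart equals the inverse base chart after
`fst`; both sides are derivatives of this one map. -/
theorem dprojModel_comp_ofChart {μ : PhaseSpace E N k} {q : E × (E [⋀^Fin k]→L[ℝ] ℝ)}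
    (hq : q.1 ∈ (extChartAt 𝓘(ℝ, E) μ.1).target) :
    (dprojModel ((extChartAt (phaseModel E k) μ).symm q)).comp (ofChart (phaseModel E k) μ q) =
      (ofChart 𝓘(ℝ, E) μ.1 q.1).comp (baseProj E k) := by
  have hM : IsManifold (phaseModel E k) ∞ (PhaseSpace E N k) := inferInstance
  have hq' := mem_target_phase.2 hq
  have h1 := ((contMDiffAt_symm hq').mdifferentiableAt (by simp)).hasMFDerivAt
  have h2 : MDifferentiableAt (phaseModel E k) 𝓘(ℝ, E) (fun ν : PhaseSpace E N k => ν.1)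
      ((extChartAt (phaseModel E k) μ).symm q) :=
    ((contMDiff_proj (n := ∞) (IB := 𝓘(ℝ, E)) (fun x : N => TangentSpace 𝓘(ℝ, E) x [⋀^Fin k]→L[ℝ]
      Bundle.Trivial N ℝ x)).contMDiffAt).mdifferentiableAt (by simp)
  obtain ⟨C, hC⟩ : ∃ C : E × (E [⋀^Fin k]→L[ℝ] ℝ) →L[ℝ] E,
    C = (dprojModel ((extChartAt (phaseModel E k) μ).symm q)).comp
      (ofChart (phaseModel E k) μ q) := ⟨_, rfl⟩
  obtain ⟨D, hD⟩ : ∃ D : E × (E [⋀^Fin k]→L[ℝ] ℝ) →L[ℝ] E,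
    D = (ofChart 𝓘(ℝ, E) μ.1 q.1).comp (baseProj E k) := ⟨_, rfl⟩
  have h3 : HasMFDerivAt 𝓘(ℝ, E × (E [⋀^Fin k]→L[ℝ] ℝ)) 𝓘(ℝ, E)
      (fun q => ((extChartAt (phaseModel E k) μ).symm q).1) q C := by
    have h5 : HasMFDerivAt (phaseModel E k) 𝓘(ℝ, E) (fun ν : PhaseSpace E N k => ν.1)
        ((extChartAt (phaseModel E k) μ).symm q)
        (dproj ((extChartAt (phaseModel E k) μ).symm q)) := h2.hasMFDerivAt
    have h6 := HasMFDerivAt.comp (I := 𝓘(ℝ, E × (E [⋀^Fin k]→L[ℝ] ℝ))) (I' := phaseModel E k)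
      (g := fun ν : PhaseSpace E N k => ν.1)
      (f := (extChartAt (phaseModel E k) μ).symm) q h5 h1
    exact hC ▸ h6
  have h4 : HasMFDerivAt 𝓘(ℝ, E × (E [⋀^Fin k]→L[ℝ] ℝ)) 𝓘(ℝ, E)
      (fun q => (extChartAt 𝓘(ℝ, E) μ.1).symm q.1) q D := by
    rw [hD]
    exact HasMFDerivAt.comp (g := (extChartAt 𝓘(ℝ, E) μ.1).symm) q
      ((contMDiffAt_symm hq).mdifferentiableAt (by simp)).hasMFDerivAt
      (baseProj E k).hasMFDerivAt
  rw [← hC, ← hD]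
  refine hasMFDerivAt_unique h3 (h4.congr_of_eventuallyEq ?_)
  filter_upwards [target_mem_nhds hq'] with r hr
  exact congrArg (fun ν : PhaseSpace E N k => ν.1)
    (extChartAt_phase_symm r.2 (mem_target_phase.1 hr))

theorem dprojModel_eq (μ : PhaseSpace E N k) : dprojModel μ = baseProj E k := by
  have hM : IsManifold (phaseModel E k) ∞ (PhaseSpace E N k) := inferInstance
  have h := dprojModel_comp_ofChart (μ := μ) (q := extChartAt (phaseModel E k) μ μ)
    (mem_target_phase.1 (mem_extChartAt_target μ))
  rw [extChartAt_to_inv, ofChart_self, ContinuousLinearMap.comp_id, extChartAt_phase_self] at h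
  rw [h, ofChart_self]
  rfl

/-- A component of a graded form on a tangent space, as a form on the model space. -/
def modelComponent {y : N} (α : GradedForms (TangentSpace 𝓘(ℝ, E) y)) (m : ℕ) :
    E [⋀^Fin m]→L[ℝ] ℝ := α m

/-- The chart representative of a form pulled back from the base along `dproj`. -/
theorem chartForm_pullback_dproj {μ : PhaseSpace E N k} {q : E × (E [⋀^Fin k]→L[ℝ] ℝ)}
    (hq : q.1 ∈ (extChartAt 𝓘(ℝ, E) μ.1).target) (m : ℕ)
    (s : ∀ ν : PhaseSpace E N k, GradedForms (TangentSpace 𝓘(ℝ, E) ν.1)) :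
    chartForm (I := phaseModel E k) μ m (fun ν => pullback (dproj ν) (s ν)) q =
      ((modelComponent (s ((extChartAt (phaseModel E k) μ).symm q)) m).compContinuousLinearMap
        (ofChart 𝓘(ℝ, E) μ.1 q.1)).compContinuousLinearMap (baseProj E k) := by
  ext w
  have h := dprojModel_comp_ofChart hq
  change modelComponent (s ((extChartAt (phaseModel E k) μ).symm q)) m
    (fun i => ((dprojModel ((extChartAt (phaseModel E k) μ).symm q)).comp
      (ofChart (phaseModel E k) μ q)) (w i)) = _
  rw [h]
  rfl

/-- The value at a point, as a linear map. -/
def evalVF (y : N) : VF 𝓘(ℝ, E) N →ₗ[ℝ] E where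
  toFun ξ := ξ y
  map_add' _ _ := rfl
  map_smul' _ _ := rfl

/-- The representatives of vector fields in the chart at `x`. -/
def chartVFs (x : N) (z : E) : VF 𝓘(ℝ, E) N →ₗ[ℝ] E :=
  (toChart 𝓘(ℝ, E) x ((extChartAt 𝓘(ℝ, E) x).symm z)).toLinearMap ∘ₗ
    evalVF ((extChartAt 𝓘(ℝ, E) x).symm z)

theorem chartVFs_apply (x : N) (z : E) (ξ : VF 𝓘(ℝ, E) N) : chartVFs x z ξ = chartVF x ξ z := rfl

theorem chartVFs_self (x : N) : chartVFs x (extChartAt 𝓘(ℝ, E) x x) = evalVF x := by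
  rw [chartVFs, extChartAt_to_inv, toChart_self]
  rfl

/-- The form `μ ↦ (Y ⌟ μ) ∘ π_*`. -/
def contractTheta (k : ℕ) (Y : ExteriorAlgebra ℝ (VF 𝓘(ℝ, E) N)) :
    FormField (phaseModel E k) (PhaseSpace E N k) :=
  fun μ => pullback (dproj μ) (contract (evalAt μ.1 Y) μ.form)

theorem contractTheta_one : contractTheta (E := E) (N := N) k 1 = theta E N k := by
  funext μ
  rw [contractTheta, map_one, contract_one]
  rfl

/-- Contraction is natural for the derivative of the base chart, which carries the vector fields to
their representatives and `μ` to its fibre coordinate. The result is the expression differentiated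
in `exists_hasFDerivAt_contract`. -/
theorem chartForm_contractTheta {μ : PhaseSpace E N k} {q : E × (E [⋀^Fin k]→L[ℝ] ℝ)}
    (hq : q.1 ∈ (extChartAt 𝓘(ℝ, E) μ.1).target) (m : ℕ)
    (Y : ExteriorAlgebra ℝ (VF 𝓘(ℝ, E) N)) :
    chartForm μ m (contractTheta k Y) q =
      (contract (ExteriorAlgebra.map (chartVFs μ.1 q.1) Y)
        (Pi.single k q.2 : GradedForms E) m).compContinuousLinearMap (baseProj E k) := by
  refine (chartForm_pullback_dproj hq m fun ν => contract (evalAt ν.1 Y) ν.form).trans ?_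
  congr 1
  rw [extChartAt_phase_symm q.2 hq]
  set y := (extChartAt 𝓘(ℝ, E) μ.1).symm q.1
  have h1 := contract_pullback (ofChart 𝓘(ℝ, E) μ.1 q.1)
    (ExteriorAlgebra.map (chartVFs μ.1 q.1) Y) (Pi.single k
      (q.2.compContinuousLinearMap (toChart 𝓘(ℝ, E) μ.1 y)) : GradedForms E)
  have h2 : ExteriorAlgebra.map (ofChart 𝓘(ℝ, E) μ.1 q.1 : E →ₗ[ℝ] E)
      (ExteriorAlgebra.map (chartVFs μ.1 q.1) Y) = ExteriorAlgebra.map (evalVF y) Y := by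
    have h3 : (ofChart 𝓘(ℝ, E) μ.1 q.1 : E →ₗ[ℝ] E) ∘ₗ chartVFs μ.1 q.1 = evalVF y := by
      have h4 := ofChart_comp_toChart hq
      ext ξ
      change ((ofChart 𝓘(ℝ, E) μ.1 q.1).comp (toChart 𝓘(ℝ, E) μ.1 y)) (evalVF y ξ) = _
      rw [h4]
      rfl
    rw [← h3, ← ExteriorAlgebra.map_comp_map]
    rfl
  have h5 : pullback (ofChart 𝓘(ℝ, E) μ.1 q.1) (Pi.single k
      (q.2.compContinuousLinearMap (toChart 𝓘(ℝ, E) μ.1 y)) : GradedForms E) =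
      Pi.single k q.2 := by
    rw [pullback_single]
    congr 1
    have h4 := toChart_comp_ofChart hq
    ext w
    change q.2 (fun i => ((toChart 𝓘(ℝ, E) μ.1 y).comp (ofChart 𝓘(ℝ, E) μ.1 q.1)) (w i)) = _
    rw [h4]
    rfl
  rw [h2, h5] at h1
  exact (congrFun h1 m).symm

theorem chartForm_positionForm {μ : PhaseSpace E N k} {q : E × (E [⋀^Fin k]→L[ℝ] ℝ)}
    (hq : q.1 ∈ (extChartAt 𝓘(ℝ, E) μ.1).target) (m : ℕ) (α : FormField 𝓘(ℝ, E) N) :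
    chartForm μ m (positionForm k α) q =
      (chartForm μ.1 m α q.1).compContinuousLinearMap (baseProj E k) := by
  refine (chartForm_pullback_dproj hq m fun ν => α ν.1).trans ?_
  rw [extChartAt_phase_symm q.2 hq]
  rfl

end PhaseCharts

/-! ### The formula for `d (Y ⌟ θ)` at the centre of a chart -/

section OwnChart

variable {E H : Type*} [NormedAddCommGroup E] [NormedSpace ℝ E] [TopologicalSpace H]
  {I : ModelWithCorners ℝ E H} {M : Type*} [TopologicalSpace M] [ChartedSpace H M]
  [IsManifold I ∞ M] [I.Boundaryless]

/-- The value at `x` of a field of forms, as a graded form on the model space. -/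
def toModel (α : FormField I M) (x : M) : GradedForms E := α x

/-- At the centre the derivative of the chart is the identity, so only the antisymmetrized
derivative of the representative remains. -/
theorem extD_eq_gradedAlt {α : FormField I M} {x : M} {T : ∀ m, E →L[ℝ] E [⋀^Fin m]→L[ℝ] ℝ}
    (hT : ∀ m, HasFDerivAt (chartForm x m α) (T m) (extChartAt I x x)) :
    toModel (extD α) x = gradedAlt T := by
  funext m
  cases m with
  | zero => exact (gradedAlt_zero_apply T).symm
  | succ m =>
    change component (extD α) (m + 1) x = _
    rw [component_extD_succ, toChart_self, extDeriv, (hT m).fderiv, gradedAlt_succ_apply]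
    rfl

end OwnChart

section PhaseForms

variable {E N : Type*} [NormedAddCommGroup E] [NormedSpace ℝ E] [TopologicalSpace N]
  [ChartedSpace E N] [IsManifold 𝓘(ℝ, E) ∞ N] {k : ℕ}

/-- The pullback of a vector field to the chart at `x`. -/
def chartPullback (x : N) (ξ : VF 𝓘(ℝ, E) N) (z : E) : E :=
  (ofChart 𝓘(ℝ, E) x z).inverse (ξ ((extChartAt 𝓘(ℝ, E) x).symm z))

theorem chartPullback_eventuallyEq (x : N) (ξ : VF 𝓘(ℝ, E) N) :
    chartPullback x ξ =ᶠ[𝓝 (extChartAt 𝓘(ℝ, E) x x)] chartVF x ξ := by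
  filter_upwards [target_mem_nhds (mem_extChartAt_target x)] with z hz
  exact congrArg (fun A : E →L[ℝ] E => A (ξ ((extChartAt 𝓘(ℝ, E) x).symm z) : E))
    (ofChart_inverse hz)

theorem hasFDerivAt_chartPullback (x : N) (ξ : VF 𝓘(ℝ, E) N) :
    HasFDerivAt (chartPullback x ξ) (chartDeriv x ξ) (extChartAt 𝓘(ℝ, E) x x) := by
  have h : DifferentiableAt ℝ (chartPullback x ξ) (extChartAt 𝓘(ℝ, E) x x) :=
    ((ξ.contDiffAt_chartVF (mem_extChartAt_target x)).differentiableAt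
      (by simp)).congr_of_eventuallyEq (chartPullback_eventuallyEq x ξ)
  exact h.hasFDerivAt

theorem hasFDerivAt_chartVF (x : N) (ξ : VF 𝓘(ℝ, E) N) :
    HasFDerivAt (chartVF x ξ) (chartDeriv x ξ) (extChartAt 𝓘(ℝ, E) x x) :=
  (hasFDerivAt_chartPullback x ξ).congr_of_eventuallyEq (chartPullback_eventuallyEq x ξ).symm

/-- The bracket on a manifold is defined by pulling both fields back to the chart at `x`, and there
`chartDeriv` is the derivative of the representative. -/
theorem evalVF_bracket [CompleteSpace E] (x : N) (ξ η : VF 𝓘(ℝ, E) N) :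
    evalVF x ⁅ξ, η⁆ = chartDeriv x η (evalVF x ξ) - chartDeriv x ξ (evalVF x η) := by
  have h0 (ξ : VF 𝓘(ℝ, E) N) : VectorField.mpullbackWithin 𝓘(ℝ, E) 𝓘(ℝ, E)
      (extChartAt 𝓘(ℝ, E) x).symm ξ (range 𝓘(ℝ, E)) = chartPullback x ξ := by
    funext z
    rw [VectorField.mpullbackWithin_apply, ModelWithCorners.range_eq_univ, mfderivWithin_univ]
    rfl
  have hself (ξ : VF 𝓘(ℝ, E) N) : chartPullback x ξ (extChartAt 𝓘(ℝ, E) x x) = evalVF x ξ := by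
    rw [(chartPullback_eventuallyEq x ξ).self_of_nhds, ← chartVFs_apply, chartVFs_self]
  have h1 : evalVF x ⁅ξ, η⁆ = (toChart 𝓘(ℝ, E) x x).inverse
      (VectorField.lieBracketWithin ℝ
        (VectorField.mpullbackWithin 𝓘(ℝ, E) 𝓘(ℝ, E) (extChartAt 𝓘(ℝ, E) x).symm ξ
          (range 𝓘(ℝ, E)))
        (VectorField.mpullbackWithin 𝓘(ℝ, E) 𝓘(ℝ, E) (extChartAt 𝓘(ℝ, E) x).symm η
          (range 𝓘(ℝ, E)))
        ((extChartAt 𝓘(ℝ, E) x).symm ⁻¹' univ ∩ range 𝓘(ℝ, E)) (extChartAt 𝓘(ℝ, E) x x)) := rfl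
  rw [h1, h0, h0, ModelWithCorners.range_eq_univ, preimage_univ, inter_univ,
    VectorField.lieBracketWithin_univ, VectorField.lieBracket, hself, hself,
    (hasFDerivAt_chartPullback x ξ).fderiv, (hasFDerivAt_chartPullback x η).fderiv,
    toChart_self, ContinuousLinearMap.inverse_id]
  rfl

/-- The value of the complete lift, as a vector of the model space. -/
def completeLiftModel [CompleteSpace E] (μ : PhaseSpace E N k) :
    VF 𝓘(ℝ, E) N →ₗ[ℝ] E × (E [⋀^Fin k]→L[ℝ] ℝ) := completeLiftAt μ

theorem completeLiftModel_apply [CompleteSpace E] (μ : PhaseSpace E N k) (ξ : VF 𝓘(ℝ, E) N) :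
    completeLiftModel μ ξ = (evalVF μ.1 ξ, -μ.fiber.fderivCompContinuousLinearMap
      (ContinuousLinearMap.id ℝ E) (chartDeriv μ.1 ξ)) := rfl

theorem toModel_extD_contractTheta [CompleteSpace E] (μ : PhaseSpace E N k)
    (Y : ExteriorAlgebra ℝ (VF 𝓘(ℝ, E) N)) :
    toModel (I := phaseModel E k) (extD (contractTheta k Y)) μ =
      contract (ExteriorAlgebra.map (completeLiftModel μ) (grade ℝ Y)) (flatDTheta E k) +
      pullback (baseProj E k) (contract (ExteriorAlgebra.map (evalVF μ.1)
        (ceBoundary ℝ (VF 𝓘(ℝ, E) N) (grade ℝ Y))) (Pi.single k μ.fiber)) := by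
  have hA (ξ : VF 𝓘(ℝ, E) N) : HasFDerivAt (fun z => chartVFs μ.1 z ξ) (chartDeriv μ.1 ξ)
      (extChartAt 𝓘(ℝ, E) μ.1 μ.1) := hasFDerivAt_chartVF μ.1 ξ
  have hbr (ξ η : VF 𝓘(ℝ, E) N) : chartVFs μ.1 (extChartAt 𝓘(ℝ, E) μ.1 μ.1) ⁅ξ, η⁆ =
      chartDeriv μ.1 η (chartVFs μ.1 (extChartAt 𝓘(ℝ, E) μ.1 μ.1) ξ) -
        chartDeriv μ.1 ξ (chartVFs μ.1 (extChartAt 𝓘(ℝ, E) μ.1 μ.1) η) := by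
    rw [chartVFs_self]
    exact evalVF_bracket μ.1 ξ η
  have hℓ (ξ : VF 𝓘(ℝ, E) N) : completeLiftModel μ ξ =
      (chartVFs μ.1 (extChartAt 𝓘(ℝ, E) μ.1 μ.1) ξ, -μ.fiber.fderivCompContinuousLinearMap
        (ContinuousLinearMap.id ℝ E) (chartDeriv μ.1 ξ)) := by
    rw [chartVFs_self, completeLiftModel_apply]
  obtain ⟨S, hS, -, hS'⟩ := exists_hasFDerivAt_contract (L := VF 𝓘(ℝ, E) N) (chartVFs μ.1)
    (extChartAt 𝓘(ℝ, E) μ.1 μ.1) μ.fiber (chartDeriv μ.1) hA hbr (completeLiftModel μ) hℓ Y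
  rw [chartVFs_self] at hS'
  refine Eq.trans (extD_eq_gradedAlt (I := phaseModel E k) (M := PhaseSpace E N k)
    (α := contractTheta k Y) (x := μ)
    (T := fun m => (pullbackCLM (baseProj E k) m).comp (S m)) fun m => ?_) hS'
  rw [extChartAt_phase_self]
  have h : HasFDerivAt (fun q : E × (E [⋀^Fin k]→L[ℝ] ℝ) => pullbackCLM (baseProj E k) m
      (contract (ExteriorAlgebra.map (chartVFs μ.1 q.1) Y) (Pi.single k q.2) m))
      ((pullbackCLM (baseProj E k) m).comp (S m)) (extChartAt 𝓘(ℝ, E) μ.1 μ.1, μ.fiber) :=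
    HasFDerivAt.comp (g := pullbackCLM (baseProj E k) m)
      (f := fun q : E × (E [⋀^Fin k]→L[ℝ] ℝ) =>
        contract (ExteriorAlgebra.map (chartVFs μ.1 q.1) Y) (Pi.single k q.2) m)
      (extChartAt 𝓘(ℝ, E) μ.1 μ.1, μ.fiber) (pullbackCLM (baseProj E k) m).hasFDerivAt (hS m)
  refine h.congr_of_eventuallyEq ?_
  have ht := target_mem_nhds (mem_extChartAt_target (I := phaseModel E k) μ)
  rw [extChartAt_phase_self] at ht
  filter_upwards [ht] with q hq
  exact chartForm_contractTheta (mem_target_phase.1 hq) m Y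

end PhaseForms

/-! ### Degrees of contractions -/

section Degree

variable {V : Type*} [AddCommGroup V] [Module ℝ V] [TopologicalSpace V]

theorem ιMulti_eq_wedge {R L : Type*} [CommRing R] [AddCommGroup L] [Module R L] (n : ℕ)
    (v : Fin n → L) : ExteriorAlgebra.ιMulti R n v = wedge R (List.ofFn v) := by
  rw [ExteriorAlgebra.ιMulti_apply, wedge, List.map_ofFn]
  rfl

theorem exteriorPower_induction {R L : Type*} [CommRing R] [AddCommGroup L] [Module R L] {l : ℕ}
    {P : ExteriorAlgebra R L → Prop} (ιMulti : ∀ v : Fin l → L, P (ExteriorAlgebra.ιMulti R l v))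
    (zero : P 0) (add : ∀ x y, P x → P y → P (x + y)) (smul : ∀ (r : R) x, P x → P (r • x))
    {x : ExteriorAlgebra R L} (hx : x ∈ ⋀[R]^l L) : P x := by
  rw [← ExteriorAlgebra.ιMulti_span_fixedDegree] at hx
  induction hx using Submodule.span_induction with
  | mem x hx =>
    obtain ⟨v, rfl⟩ := hx
    exact ιMulti v
  | zero => exact zero
  | add x y _ _ hx hy => exact add x y hx hy
  | smul r x _ hx => exact smul r x hx

/-- The offset `j` records that `α` has degree `p - j` without truncated subtraction. It grows by
one with every factor, and the argument covers lists longer than the degree. -/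
theorem contract_wedge_eq_zero (l : List V) {α : GradedForms V} {j p : ℕ}
    (h : ∀ m, m + j ≠ p → α m = 0) (m : ℕ) (hm : m + (j + l.length) ≠ p) :
    contract (wedge ℝ l) α m = 0 := by
  induction l generalizing α j with
  | nil =>
    rw [show wedge ℝ ([] : List V) = 1 from rfl, contract_one]
    exact h m hm
  | cons a l ih =>
    rw [show wedge ℝ (a :: l) = ExteriorAlgebra.ι ℝ a * wedge ℝ l by simp [wedge],
      contract_mul, contract_ι]
    refine ih (j := j + 1) (fun m hm => ?_) ?_
    · ext w
      rw [interior_apply, h (m + 1) (by omega)]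
      rfl
    · rw [List.length_cons] at hm
      omega

/-- The contraction of a `p`-form by an `l`-vector has degree `p - l`. -/
theorem contract_apply_eq_zero {l p : ℕ} {X : ExteriorAlgebra ℝ V} (hX : X ∈ ⋀[ℝ]^l V)
    {α : GradedForms V} (h : ∀ m, m ≠ p → α m = 0) (m : ℕ) (hm : m + l ≠ p) :
    contract X α m = 0 := by
  refine exteriorPower_induction (P := fun X => contract X α m = 0) (fun v => ?_) ?_
    (fun x y hx hy => ?_) (fun r x hx => ?_) hX
  · rw [ιMulti_eq_wedge]
    exact contract_wedge_eq_zero _ (j := 0) h m (by simpa using hm)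
  · rw [contract_zero]
    rfl
  · rw [contract_add, Pi.add_apply, hx, hy, add_zero]
  · rw [contract_smul, Pi.smul_apply, hx, smul_zero]

end Degree

/-! ### Smoothness of momentum and position forms -/

section PhaseForms

variable {E N : Type*} [NormedAddCommGroup E] [NormedSpace ℝ E] [TopologicalSpace N]
  [ChartedSpace E N] [IsManifold 𝓘(ℝ, E) ∞ N] {k : ℕ}

theorem contDiffAt_pullbackCLM {V W U : Type*} [NormedAddCommGroup V] [NormedSpace ℝ V]
    [NormedAddCommGroup W] [NormedSpace ℝ W] [NormedAddCommGroup U] [NormedSpace ℝ U] {m : ℕ}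
    {n : WithTop ℕ∞} {g : U → W [⋀^Fin m]→L[ℝ] ℝ} {u : U} (h : ContDiffAt ℝ n g u)
    (f : V →L[ℝ] W) :
    ContDiffAt ℝ n (fun u => (g u).compContinuousLinearMap f) u :=
  ContDiffAt.comp (g := pullbackCLM f m) u (pullbackCLM f m).contDiff.contDiffAt h

/-- Only the pointwise values of `Y` enter. This is why the Lie kernel may ask that `∂Y` vanish as a
multivector field rather than in the real exterior algebra. -/
theorem contractTheta_eq_zero {Y : ExteriorAlgebra ℝ (VF 𝓘(ℝ, E) N)} (h : ∀ x, evalAt x Y = 0) :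
    contractTheta k Y = 0 := by
  funext μ
  rw [contractTheta, h, contract_zero, map_zero]
  rfl

theorem contractTheta_add (X Y : ExteriorAlgebra ℝ (VF 𝓘(ℝ, E) N)) :
    contractTheta k (X + Y) = contractTheta k X + contractTheta k Y := by
  funext μ
  rw [contractTheta, map_add, contract_add, map_add]
  rfl

theorem contractTheta_smul (c : ℝ) (Y : ExteriorAlgebra ℝ (VF 𝓘(ℝ, E) N)) :
    contractTheta k (c • Y) = c • contractTheta k Y := by
  funext μ
  rw [contractTheta, map_smul, contract_smul, map_smul]
  rfl

theorem momentumForm_eq (l : ℕ) (Y : ExteriorAlgebra ℝ (VF 𝓘(ℝ, E) N)) :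
    momentumForm k l Y = contractTheta k (-zeta (l + 1) • Y) := by
  rw [contractTheta_smul]
  rfl

theorem contDiffAt_contract_chartVFs {x : N} {q : E × (E [⋀^Fin k]→L[ℝ] ℝ)}
    (hq : q.1 ∈ (extChartAt 𝓘(ℝ, E) x).target) (m : ℕ)
    (Y : ExteriorAlgebra ℝ (VF 𝓘(ℝ, E) N)) :
    ContDiffAt ℝ ∞ (fun q : E × (E [⋀^Fin k]→L[ℝ] ℝ) =>
      contract (ExteriorAlgebra.map (chartVFs x q.1) Y) (Pi.single k q.2 : GradedForms E) m) q := by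
  induction Y using exterior_right_induction generalizing m with
  | one =>
    simp only [map_one, contract_one]
    exact ((singleCLM E k m).comp (ContinuousLinearMap.snd ℝ E _)).contDiff.contDiffAt
  | smul r Y ih =>
    simp only [map_smul, contract_smul, Pi.smul_apply]
    exact (ih m).const_smul r
  | add X Y hX hY =>
    simp only [map_add, contract_add, Pi.add_apply]
    exact (hX m).add (hY m)
  | mul_ι Y ξ ih =>
    simp only [map_mul, contract_mul, ExteriorAlgebra.map_apply_ι, contract_ι,
      interior_eq_curryLeft]
    have hv : ContDiffAt ℝ ∞ (fun q : E × (E [⋀^Fin k]→L[ℝ] ℝ) => chartVFs x q.1 ξ) q :=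
      ContDiffAt.comp (g := chartVF x ξ) (f := Prod.fst) q (ξ.contDiffAt_chartVF hq)
        contDiffAt_fst
    refine ContDiffAt.comp (g := fun q : (E [⋀^Fin (m + 1)]→L[ℝ] ℝ) × E => q.1.curryLeft q.2)
      (f := fun q : E × (E [⋀^Fin k]→L[ℝ] ℝ) => (contract (ExteriorAlgebra.map (chartVFs x q.1) Y)
        (Pi.single k q.2 : GradedForms E) (m + 1), chartVFs x q.1 ξ)) q
      (isBoundedBilinearMap_curryLeft m).contDiff.contDiffAt ((ih (m + 1)).prodMk hv)

theorem evalAt_mem {l : ℕ} {Y : ExteriorAlgebra ℝ (VF 𝓘(ℝ, E) N)}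
    (hY : Y ∈ ⋀[ℝ]^l (VF 𝓘(ℝ, E) N)) (x : N) :
    evalAt x Y ∈ ⋀[ℝ]^l (TangentSpace 𝓘(ℝ, E) x) := by
  refine exteriorPower_induction (P := fun Y => evalAt x Y ∈ ⋀[ℝ]^l (TangentSpace 𝓘(ℝ, E) x))
    (fun v => ?_) ?_ (fun X Y hX hY => ?_) (fun r Y hY => ?_) hY
  · rw [evalAt, ExteriorAlgebra.map_apply_ιMulti, ← ExteriorAlgebra.ιMulti_span_fixedDegree]
    exact Submodule.subset_span ⟨_, rfl⟩
  · rw [map_zero]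
    exact Submodule.zero_mem _
  · rw [map_add]
    exact Submodule.add_mem _ hX hY
  · rw [map_smul]
    exact Submodule.smul_mem _ _ hY

theorem isForm_contractTheta {l : ℕ} (hl : l ≤ k) {Y : ExteriorAlgebra ℝ (VF 𝓘(ℝ, E) N)}
    (hY : Y ∈ ⋀[ℝ]^l (VF 𝓘(ℝ, E) N)) : IsForm (k - l) (contractTheta k Y) := by
  refine isForm_of_contDiffAt (fun μ m hm => ?_) fun μ => ?_
  · have hY' : evalAt μ.1 Y ∈ ⋀[ℝ]^l (TangentSpace 𝓘(ℝ, E) μ.1) := evalAt_mem hY μ.1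
    have h0 (m : ℕ) (hm : m ≠ k) : μ.form m = 0 := Pi.single_eq_of_ne hm _
    have h : contract (evalAt μ.1 Y) μ.form m = 0 :=
      contract_apply_eq_zero hY' h0 m (by omega)
    rw [contractTheta, pullback_apply, h]
    rfl
  · rw [extChartAt_phase_self]
    have h1 := contDiffAt_pullbackCLM (contDiffAt_contract_chartVFs (q := (_, μ.fiber))
      (mem_extChartAt_target μ.1) (k - l) Y) (baseProj E k)
    refine h1.congr_of_eventuallyEq ?_
    have ht := target_mem_nhds (mem_extChartAt_target (I := phaseModel E k) μ)
    rw [extChartAt_phase_self] at ht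
    filter_upwards [ht] with q hq
    exact chartForm_contractTheta (mem_target_phase.1 hq) (k - l) Y

theorem isForm_positionForm {p : ℕ} {α : FormField 𝓘(ℝ, E) N} (h : IsForm p α) :
    IsForm p (positionForm k α) := by
  refine isForm_of_contDiffAt (fun μ m hm => ?_) fun μ => ?_
  · rw [positionForm, pullback_apply, h.1 _ _ hm]
    rfl
  · rw [extChartAt_phase_self]
    have h1 := contDiffAt_pullbackCLM (ContDiffAt.comp (g := chartForm μ.1 p α)
      (f := Prod.fst) (_, μ.fiber) (h.contDiffAt_chartForm (mem_extChartAt_target μ.1) p)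
        contDiffAt_fst) (baseProj E k)
    refine h1.congr_of_eventuallyEq ?_
    have ht := target_mem_nhds (mem_extChartAt_target (I := phaseModel E k) μ)
    rw [extChartAt_phase_self] at ht
    filter_upwards [ht] with q hq
    exact chartForm_positionForm (mem_target_phase.1 hq) p α

theorem pullback_dproj (μ : PhaseSpace E N k) (γ : GradedForms (TangentSpace 𝓘(ℝ, E) μ.1)) :
    pullback (dproj μ) γ = pullback (V := E × (E [⋀^Fin k]→L[ℝ] ℝ)) (W := E) (baseProj E k) γ :=
  congrArg (fun A : E × (E [⋀^Fin k]→L[ℝ] ℝ) →L[ℝ] E => pullback (W := E) A γ) (dprojModel_eq μ)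

theorem extD_positionForm {p : ℕ} {α : FormField 𝓘(ℝ, E) N} (h : IsForm p α) :
    extD (positionForm k α) = positionForm k (extD α) := by
  funext μ
  have hd (m : ℕ) : HasFDerivAt (chartForm μ.1 m α) (fderiv ℝ (chartForm μ.1 m α)
      (extChartAt 𝓘(ℝ, E) μ.1 μ.1)) (extChartAt 𝓘(ℝ, E) μ.1 μ.1) :=
    ((h.contDiffAt_chartForm (mem_extChartAt_target μ.1) m).differentiableAt
      (by simp)).hasFDerivAt
  have h1 := extD_eq_gradedAlt (I := 𝓘(ℝ, E)) (M := N) (α := α) (x := μ.1) hd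
  have h2 := extD_eq_gradedAlt (I := phaseModel E k) (M := PhaseSpace E N k)
    (α := positionForm k α) (x := μ)
    (T := fun m => (pullbackCLM (baseProj E k) m).comp ((fderiv ℝ (chartForm μ.1 m α)
      (extChartAt 𝓘(ℝ, E) μ.1 μ.1)).comp (baseProj E k))) fun m => by
    rw [extChartAt_phase_self]
    have h1 : HasFDerivAt (fun q : E × (E [⋀^Fin k]→L[ℝ] ℝ) =>
        pullbackCLM (baseProj E k) m (chartForm μ.1 m α q.1))
        ((pullbackCLM (baseProj E k) m).comp ((fderiv ℝ (chartForm μ.1 m α)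
          (extChartAt 𝓘(ℝ, E) μ.1 μ.1)).comp (baseProj E k)))
          (extChartAt 𝓘(ℝ, E) μ.1 μ.1, μ.fiber) :=
      HasFDerivAt.comp (g := pullbackCLM (baseProj E k) m)
        (f := fun q : E × (E [⋀^Fin k]→L[ℝ] ℝ) => chartForm μ.1 m α q.1) _
        (pullbackCLM (baseProj E k) m).hasFDerivAt ((hd m).comp_fst_prod _)
    refine h1.congr_of_eventuallyEq ?_
    have ht := target_mem_nhds (mem_extChartAt_target (I := phaseModel E k) μ)
    rw [extChartAt_phase_self] at ht
    filter_upwards [ht] with q hq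
    exact chartForm_positionForm (mem_target_phase.1 hq) m α
  rw [← pullback_gradedAlt, ← h1] at h2
  rw [positionForm, pullback_dproj]
  exact h2

end PhaseForms

/-! ### Nondegeneracy of the constant form `dθ` -/

section Lifts

variable {E N : Type*} [NormedAddCommGroup E] [NormedSpace ℝ E] [TopologicalSpace N]
  [ChartedSpace E N] [IsManifold 𝓘(ℝ, E) ∞ N] {k : ℕ}

/-- The second term of `interior_gradedAlt` contracts a form pulled back from `E` with a vertical
vector, so it vanishes. -/
theorem interior_flatDTheta_vertical (p : E [⋀^Fin k]→L[ℝ] ℝ) :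
    interior ((0, p) : E × (E [⋀^Fin k]→L[ℝ] ℝ)) (flatDTheta E k) =
      pullback (baseProj E k) (Pi.single k p) := by
  rw [flatDTheta, interior_gradedAlt]
  rw [gradedAlt_eq_zero, sub_zero]
  · rfl
  · intro m w
    have h1 := congrFun (interior_pullback (baseProj E k) ((0, p) : E × (E [⋀^Fin k]→L[ℝ] ℝ))
      (Pi.single k w.2 : GradedForms E)) m
    refine h1.trans ?_
    rw [show baseProj E k (0, p) = 0 from rfl, map_zero]
    rfl

/-- On arguments from `E × 0` the second term of `interior_gradedAlt` vanishes, since it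
differentiates in directions without fibre component. Thus the fibre component of a vector can be
read off from its contraction with `dθ`. -/
theorem curryLeft_flatDTheta (v : E × (E [⋀^Fin k]→L[ℝ] ℝ)) :
    ((flatDTheta E k (k + 1)).curryLeft v).compContinuousLinearMap
      (ContinuousLinearMap.inl ℝ E (E [⋀^Fin k]→L[ℝ] ℝ)) = v.2 := by
  have h := interior_gradedAlt v (fun m => (pullbackCLM (baseProj E k) m).comp
    ((singleCLM E k m).comp (ContinuousLinearMap.snd ℝ E (E [⋀^Fin k]→L[ℝ] ℝ))))
  have h2 := congrFun (congrArg (pullback (ContinuousLinearMap.inl ℝ E (E [⋀^Fin k]→L[ℝ] ℝ))) h) k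
  refine h2.trans ?_
  rw [map_sub, pullback_gradedAlt]
  rw [gradedAlt_eq_zero, sub_zero]
  · ext w
    change (Pi.single k v.2 : GradedForms E) k w = v.2 w
    rw [Pi.single_eq_same]
  · intro m w
    change pullbackCLM _ m (interiorCLM v m (pullbackCLM (baseProj E k) (m + 1)
      (singleCLM E k (m + 1) 0))) = 0
    rw [map_zero, map_zero, map_zero, map_zero]

end Lifts

/-! ### The form `dθ` in bundle charts -/

section CanonicalForm

variable {E N : Type*} [NormedAddCommGroup E] [NormedSpace ℝ E] [TopologicalSpace N]
  [ChartedSpace E N] [IsManifold 𝓘(ℝ, E) ∞ N] {k : ℕ}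

theorem dproj_apply (μ : PhaseSpace E N k) (v : TangentSpace (phaseModel E k) μ) :
    dproj μ v = (show E × (E [⋀^Fin k]→L[ℝ] ℝ) from v).1 :=
  congrArg (fun A : E × (E [⋀^Fin k]→L[ℝ] ℝ) →L[ℝ] E => A v) (dprojModel_eq μ)

theorem chartForm_interior {x : PhaseSpace E N k} {z : E × (E [⋀^Fin k]→L[ℝ] ℝ)}
    (hz : z ∈ (extChartAt (phaseModel E k) x).target) (m : ℕ)
    (X : ∀ y : PhaseSpace E N k, TangentSpace (phaseModel E k) y)
    (α : FormField (phaseModel E k) (PhaseSpace E N k)) :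
    chartForm x m (fun y => interior (X y) (α y)) z =
      (chartForm x (m + 1) α z).curryLeft (chartVF x X z) := by
  have hM : IsManifold (phaseModel E k) ∞ (PhaseSpace E N k) := inferInstance
  set y := (extChartAt (phaseModel E k) x).symm z with hy
  obtain ⟨v, hv⟩ : ∃ v : E × (E [⋀^Fin k]→L[ℝ] ℝ), v = X y := ⟨_, rfl⟩
  have h1 : ofChart (phaseModel E k) x z (chartVF x X z) = v := by
    have h2 := ofChart_comp_toChart hz
    rw [hv]
    exact congrArg (fun A : E × (E [⋀^Fin k]→L[ℝ] ℝ) →L[ℝ] E × (E [⋀^Fin k]→L[ℝ] ℝ) => A (X y)) h2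
  have h2 := ContinuousAlternatingMap.curryLeft_compContinuousLinearMap
    (component α (m + 1) y) (ofChart (phaseModel E k) x z) (chartVF x X z)
  rw [h1, hv] at h2
  exact h2.symm

/-- Bundle charts are Darboux charts: θ is linear in the fibre coordinate and independent of the
base coordinate, so its derivative is constant. -/
theorem chartForm_extD_theta {μ : PhaseSpace E N k} {q : E × (E [⋀^Fin k]→L[ℝ] ℝ)}
    (hq : q ∈ (extChartAt (phaseModel E k) μ).target) (m : ℕ) :
    chartForm μ (m + 1) (extD (theta E N k)) q = flatDTheta E k (m + 1) := by
  have hM : IsManifold (phaseModel E k) ∞ (PhaseSpace E N k) := inferInstance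
  have hd : HasFDerivAt (fun q : E × (E [⋀^Fin k]→L[ℝ] ℝ) => pullbackCLM (baseProj E k) m
      (singleCLM E k m q.2)) ((pullbackCLM (baseProj E k) m).comp ((singleCLM E k m).comp
        (ContinuousLinearMap.snd ℝ E (E [⋀^Fin k]→L[ℝ] ℝ)))) q :=
    ((pullbackCLM (baseProj E k) m).comp ((singleCLM E k m).comp
        (ContinuousLinearMap.snd ℝ E (E [⋀^Fin k]→L[ℝ] ℝ)))).hasFDerivAt
  have h : HasFDerivAt (chartForm μ m (theta E N k)) ((pullbackCLM (baseProj E k) m).comp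
      ((singleCLM E k m).comp (ContinuousLinearMap.snd ℝ E (E [⋀^Fin k]→L[ℝ] ℝ)))) q := by
    refine hd.congr_of_eventuallyEq ?_
    filter_upwards [target_mem_nhds hq] with r hr
    rw [← contractTheta_one]
    refine (chartForm_contractTheta (mem_target_phase.1 hr) m 1).trans ?_
    rw [map_one, contract_one]
    rfl
  rw [chartForm_extD hq m h.differentiableAt, extDeriv, h.fderiv]
  rfl

theorem toModel_extD_theta (μ : PhaseSpace E N k) :
    toModel (I := phaseModel E k) (extD (theta E N k)) μ = flatDTheta E k := by
  have hM : IsManifold (phaseModel E k) ∞ (PhaseSpace E N k) := inferInstance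
  funext m
  cases m with
  | zero => rfl
  | succ m =>
    have h := chartForm_extD_theta (μ := μ) (mem_extChartAt_target μ) m
    rw [← h, chartForm, ofChart_self, extChartAt_to_inv]
    rfl

/-- A vector field on the phase space which is projectable and whose contraction with `dθ` is
smooth is itself smooth. -/
theorem contDiffAt_chartVF_of_interior {X : ∀ μ : PhaseSpace E N k, TangentSpace (phaseModel E k) μ}
    (ξ : VF 𝓘(ℝ, E) N) (hX : ∀ μ, dproj μ (X μ) = ξ μ.1)
    {β : FormField (phaseModel E k) (PhaseSpace E N k)} (hβ : IsForm k β)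
    (h : ∀ μ, interior (X μ) (extD (theta E N k) μ) = β μ) (μ : PhaseSpace E N k) :
    ContDiffAt ℝ ∞ (chartVF (I := phaseModel E k) μ X) (extChartAt (phaseModel E k) μ μ) := by
  have hM : IsManifold (phaseModel E k) ∞ (PhaseSpace E N k) := inferInstance
  have ht := mem_extChartAt_target (I := phaseModel E k) μ
  have h1 : ContDiffAt ℝ ∞ (fun q : E × (E [⋀^Fin k]→L[ℝ] ℝ) => chartVF μ.1 ξ q.1)
      (extChartAt (phaseModel E k) μ μ) :=
    ContDiffAt.comp (g := chartVF μ.1 ξ) (f := Prod.fst) _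
      (ξ.contDiffAt_chartVF (mem_target_phase.1 ht)) contDiffAt_fst
  have h2 := contDiffAt_pullbackCLM (hβ.contDiffAt_chartForm ht k)
    (ContinuousLinearMap.inl ℝ E (E [⋀^Fin k]→L[ℝ] ℝ))
  refine (h1.prodMk h2).congr_of_eventuallyEq ?_
  filter_upwards [target_mem_nhds ht] with q hq
  have hβX : (fun μ => interior (X μ) (extD (theta E N k) μ)) = β := funext h
  have e2 := chartForm_interior hq k X (extD (theta E N k))
  rw [hβX, chartForm_extD_theta hq] at e2
  refine Prod.ext ?_ ?_
  -- The base component is the representative of `ξ`, because the field projects to `ξ`.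
  · have e1 := toChart_comp_ofChart (mem_target_phase.1 hq)
    have e3 := dprojModel_comp_ofChart (mem_target_phase.1 hq)
    have e4 := ofChart_comp_toChart hq
    rw [dprojModel_eq] at e3
    obtain ⟨v, hv⟩ : ∃ v : E × (E [⋀^Fin k]→L[ℝ] ℝ),
      v = X ((extChartAt (phaseModel E k) μ).symm q) := ⟨_, rfl⟩
    have e5 : ofChart (phaseModel E k) μ q (chartVF μ X q) = v := by
      rw [hv]
      exact congrArg (fun A : E × (E [⋀^Fin k]→L[ℝ] ℝ) →L[ℝ] E × (E [⋀^Fin k]→L[ℝ] ℝ) =>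
        A (X ((extChartAt (phaseModel E k) μ).symm q))) e4
    have e6 : v.1 = evalVF ((extChartAt (phaseModel E k) μ).symm q).1 ξ := by
      rw [hv]
      exact (dproj_apply _ _).symm.trans (hX _)
    have e7 : ((extChartAt (phaseModel E k) μ).symm q).1 = (extChartAt 𝓘(ℝ, E) μ.1).symm q.1 :=
      congrArg (fun ν : PhaseSpace E N k => ν.1)
        (extChartAt_phase_symm q.2 (mem_target_phase.1 hq))
    rw [e7] at e6
    have e8 : ofChart 𝓘(ℝ, E) μ.1 q.1 (chartVF (I := phaseModel E k) μ X q).1 =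
        evalVF ((extChartAt 𝓘(ℝ, E) μ.1).symm q.1) ξ := by
      rw [← e6, ← e5]
      exact (congrArg (fun A : E × (E [⋀^Fin k]→L[ℝ] ℝ) →L[ℝ] E => A (chartVF μ X q)) e3).symm
    have e9 := congrArg (toChart 𝓘(ℝ, E) μ.1 ((extChartAt 𝓘(ℝ, E) μ.1).symm q.1)) e8
    refine Eq.trans ?_ e9
    exact (congrArg (fun A : E →L[ℝ] E => A (chartVF (I := phaseModel E k) μ X q).1) e1).symm
  -- The fibre component is the restriction of the representative of `β` to `E × 0`.
  · change _ = (chartForm μ k β q).compContinuousLinearMap _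
    rw [e2, curryLeft_flatDTheta]

end CanonicalForm

/-! ### Vertical and complete lifts, and the formula for `d (Y ⌟ θ)` -/

section Lifts

variable {E N : Type*} [NormedAddCommGroup E] [NormedSpace ℝ E] [TopologicalSpace N]
  [ChartedSpace E N] [IsManifold 𝓘(ℝ, E) ∞ N] {k : ℕ}

/-- The vertical vector at `μ` given by a `k`-form. -/
def verticalAt (μ : PhaseSpace E N k) (p : E [⋀^Fin k]→L[ℝ] ℝ) : TangentSpace (phaseModel E k) μ :=
  ((0, p) : E × (E [⋀^Fin k]→L[ℝ] ℝ))

theorem dproj_verticalAt (μ : PhaseSpace E N k) (p : E [⋀^Fin k]→L[ℝ] ℝ) :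
    dproj μ (verticalAt μ p) = 0 := dproj_apply μ _

theorem interior_verticalAt (μ : PhaseSpace E N k) (p : E [⋀^Fin k]→L[ℝ] ℝ) :
    interior (verticalAt μ p) (extD (theta E N k) μ) =
      pullback (dproj μ) (Pi.single k p : GradedForms E) := by
  refine Eq.trans ?_ ((interior_flatDTheta_vertical p).trans (pullback_dproj μ _).symm)
  exact congrArg (fun α : GradedForms (E × (E [⋀^Fin k]→L[ℝ] ℝ)) => interior (0, p) α)
    (toModel_extD_theta μ)

/-- The vertical lift of a `k`-form on the base. -/
theorem exists_verticalLift {η : FormField 𝓘(ℝ, E) N} (h : IsForm k η) :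
    ∃ V : VF (phaseModel E k) (PhaseSpace E N k), ∀ μ : PhaseSpace E N k,
      V μ = verticalAt μ (component η k μ.1) := by
  refine ⟨mkVF _ (contDiffAt_chartVF_of_interior
    (X := fun μ => verticalAt μ (component η k μ.1)) 0 (fun μ => dproj_verticalAt μ _)
    (isForm_positionForm (k := k) h) fun μ => (interior_verticalAt μ _).trans ?_), fun μ => rfl⟩
  have h1 : (Pi.single k (component η k μ.1) : GradedForms E) = toModel η μ.1 := by
    funext m
    by_cases hm : m = k
    · subst hm
      exact Pi.single_eq_same _ _
    · exact (Pi.single_eq_of_ne hm _).trans (h.1 _ _ hm).symm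
  exact congrArg (pullback (dproj μ)) h1

variable [CompleteSpace E]

theorem dproj_completeLiftAt (μ : PhaseSpace E N k) (ξ : VF 𝓘(ℝ, E) N) :
    dproj μ (completeLiftAt μ ξ) = ξ μ.1 := dproj_apply μ _

/-- The complete lift projects to the original multivector, and contraction of a pulled-back form
sees only the projection. -/
theorem contract_completeLift_pullback (μ : PhaseSpace E N k)
    (Y : ExteriorAlgebra ℝ (VF 𝓘(ℝ, E) N)) (γ : GradedForms (TangentSpace 𝓘(ℝ, E) μ.1)) :
    contract (completeLift k Y μ) (pullback (dproj μ) γ) =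
      pullback (dproj μ) (contract (evalAt μ.1 Y) γ) := by
  rw [contract_pullback]
  congr 2
  rw [completeLift, ← AlgHom.comp_apply, ExteriorAlgebra.map_comp_map]
  have h : (dproj μ).toLinearMap ∘ₗ completeLiftAt μ =
      { toFun := fun X => X μ.1, map_add' := fun _ _ => rfl, map_smul' := fun _ _ => rfl } :=
    LinearMap.ext fun ξ => dproj_completeLiftAt μ ξ
  rw [h]
  rfl

theorem contractField_completeLift_contractTheta (X Y : ExteriorAlgebra ℝ (VF 𝓘(ℝ, E) N)) :
    contractField (completeLift k Y) (contractTheta k X) = contractTheta k (X * Y) := by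
  funext μ
  rw [contractField, contractTheta, contract_completeLift_pullback, contractTheta, map_mul,
    contract_mul]

/-- `d (Y ⌟ θ)` for a multivector field `Y` on the base. -/
theorem extD_contractTheta (Y : ExteriorAlgebra ℝ (VF 𝓘(ℝ, E) N)) :
    extD (contractTheta k Y) = contractField (completeLift k (grade ℝ Y)) (extD (theta E N k)) +
      contractTheta k (ceBoundary ℝ (VF 𝓘(ℝ, E) N) (grade ℝ Y)) := by
  funext μ
  refine (toModel_extD_contractTheta μ Y).trans ?_
  rw [← toModel_extD_theta μ]
  refine congrArg₂ (fun a b : GradedForms (E × (E [⋀^Fin k]→L[ℝ] ℝ)) => a + b) rfl ?_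
  exact (pullback_dproj μ _).symm

/-- By `extD_contractTheta` the contraction of the lift with `dθ` is the exterior derivative of the
contraction of θ by `-ξ`, hence smooth, and the lift projects to `ξ`. The sign undoes `grade` in
degree one. -/
theorem exists_completeLift (hk : 1 ≤ k) (ξ : VF 𝓘(ℝ, E) N) :
    ∃ V : VF (phaseModel E k) (PhaseSpace E N k), ∀ μ : PhaseSpace E N k,
      V μ = completeLiftAt μ ξ := by
  have h1 : IsForm k (extD (contractTheta k (ExteriorAlgebra.ι ℝ (-ξ)))) := by
    have hξ : ExteriorAlgebra.ι ℝ (-ξ) ∈ ⋀[ℝ]^1 (VF 𝓘(ℝ, E) N) := by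
      have h := LinearMap.mem_range_self (ExteriorAlgebra.ι ℝ (M := VF 𝓘(ℝ, E) N)) (-ξ)
      rw [← pow_one (LinearMap.range _)] at h
      exact h
    have h2 := (isForm_contractTheta hk hξ).extD
    rwa [Nat.sub_add_cancel hk] at h2
  refine ⟨mkVF _ (contDiffAt_chartVF_of_interior (X := fun μ => completeLiftAt μ ξ) ξ
    (fun μ => dproj_completeLiftAt μ ξ) h1 fun μ => ?_), fun μ => rfl⟩
  have h3 : ceBoundary ℝ (VF 𝓘(ℝ, E) N) (ExteriorAlgebra.ι ℝ ξ) = 0 := by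
    have := ceBoundary_ι_mul (R := ℝ) ξ (1 : ExteriorAlgebra ℝ (VF 𝓘(ℝ, E) N))
    simpa using this
  rw [extD_contractTheta, grade_ι, map_neg, neg_neg, h3, contractTheta_eq_zero (by simp), add_zero,
    contractField, completeLift, ExteriorAlgebra.map_apply_ι, contract_ι]

end Lifts

/-! ### Linearity of contraction and smooth multivector fields -/

section ContractField

variable {E H : Type*} [NormedAddCommGroup E] [NormedSpace ℝ E] [TopologicalSpace H]
  {I : ModelWithCorners ℝ E H} {M : Type*} [TopologicalSpace M] [ChartedSpace H M]

theorem contractField_smul_left (c : ℝ) (X : MultivectorField I M) (α : FormField I M) :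
    contractField (c • X) α = c • contractField X α := by
  funext x
  exact contract_smul c (X x) (α x)

theorem contractField_smul_right (c : ℝ) (X : MultivectorField I M) (α : FormField I M) :
    contractField X (c • α) = c • contractField X α := by
  funext x
  exact map_smul (contract (X x)) c (α x)

theorem contractField_neg_right (X : MultivectorField I M) (α : FormField I M) :
    contractField X (-α) = -contractField X α := by
  funext x
  exact map_neg (contract (X x)) (α x)

end ContractField

section MultivectorFields

variable {E H : Type*} [NormedAddCommGroup E] [NormedSpace ℝ E] [TopologicalSpace H]
  {I : ModelWithCorners ℝ E H} {M : Type*} [TopologicalSpace M] [ChartedSpace H M]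
  [IsManifold I ∞ M] {l : ℕ} {X Y : MultivectorField I M} {x₀ : M}

/-- Smoothness of a field of multivectors of degree `l` near a point. -/
def IsMultivectorFieldAt (l : ℕ) (X : MultivectorField I M) (x₀ : M) : Prop :=
  ∃ (n : ℕ) (f : Fin n → C^∞⟮I, M; ℝ⟯) (V : Fin n → Fin l → VF I M),
    ∀ᶠ x in 𝓝 x₀, X x = ∑ a, f a x • ExteriorAlgebra.ιMulti ℝ l (fun j => V a j x)

theorem IsMultivectorFieldAt.congr (h : IsMultivectorFieldAt l X x₀)
    (hY : ∀ᶠ x in 𝓝 x₀, Y x = X x) :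
    IsMultivectorFieldAt l Y x₀ := by
  obtain ⟨n, f, V, hV⟩ := h
  exact ⟨n, f, V, by filter_upwards [hV, hY] with x h1 h2; rw [h2, h1]⟩

theorem isMultivectorFieldAt_zero : IsMultivectorFieldAt l (0 : MultivectorField I M) x₀ :=
  ⟨0, Fin.elim0, Fin.elim0, Filter.Eventually.of_forall fun x => by simp⟩

theorem IsMultivectorFieldAt.add (hX : IsMultivectorFieldAt l X x₀)
    (hY : IsMultivectorFieldAt l Y x₀) : IsMultivectorFieldAt l (X + Y) x₀ := by
  obtain ⟨n, f, V, hV⟩ := hX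
  obtain ⟨n', f', V', hV'⟩ := hY
  refine ⟨n + n', Fin.append f f', Fin.append V V', ?_⟩
  filter_upwards [hV, hV'] with x h1 h2
  rw [Pi.add_apply, h1, h2, Fin.sum_univ_add]
  simp

theorem IsMultivectorFieldAt.smul (g : C^∞⟮I, M; ℝ⟯) (hX : IsMultivectorFieldAt l X x₀) :
    IsMultivectorFieldAt l (fun x => g x • X x) x₀ := by
  obtain ⟨n, f, V, hV⟩ := hX
  refine ⟨n, fun a => g * f a, V, ?_⟩
  filter_upwards [hV] with x h1
  rw [h1, Finset.smul_sum]
  exact Finset.sum_congr rfl fun a _ => by rw [smul_smul]; rfl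

theorem IsMultivectorFieldAt.const_smul (c : ℝ) (hX : IsMultivectorFieldAt l X x₀) :
    IsMultivectorFieldAt l (c • X) x₀ :=
  hX.smul (ContMDiffMap.const c)

theorem isMultivectorFieldAt_ιMulti (V : Fin l → VF I M) :
    IsMultivectorFieldAt l (fun x => ExteriorAlgebra.ιMulti ℝ l fun j => V j x) x₀ :=
  ⟨1, fun _ => 1, fun _ => V, Filter.Eventually.of_forall fun x => by simp⟩

theorem IsMultivectorFieldAt.sum {ι : Type*} (s : Finset ι) {X : ι → MultivectorField I M}
    (h : ∀ i ∈ s, IsMultivectorFieldAt l (X i) x₀) : IsMultivectorFieldAt l (∑ i ∈ s, X i) x₀ := by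
  classical
  induction s using Finset.induction_on with
  | empty => exact isMultivectorFieldAt_zero
  | insert i s hi ih =>
    rw [Finset.sum_insert hi]
    exact (h i (Finset.mem_insert_self i s)).add
      (ih fun j hj => h j (Finset.mem_insert_of_mem hj))

end MultivectorFields

/-! ### The signs `ζ` -/

section Signs

theorem zeta_succ (l : ℕ) : zeta (l + 1) = (-1) ^ (l + 1) * zeta l := by
  have h : (l + 1) * (l + 1 + 1) / 2 = l * (l + 1) / 2 + (l + 1) := by
    rw [← Nat.add_mul_div_right _ _ two_pos]
    congr 1
    ring
  rw [zeta, h, pow_add, zeta]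
  ring

/-- The triangular number of `s + t` is the sum of those of `s` and `t` plus `s * t`; the extra
minus sign comes from the one in the definition of `ζ`. -/
theorem zeta_add (s t : ℕ) : zeta (s + t) = -((-1) ^ (s * t) * zeta s * zeta t) := by
  have h : (s + t) * (s + t + 1) / 2 = s * (s + 1) / 2 + t * (t + 1) / 2 + s * t := by
    obtain ⟨a, ha⟩ := (Nat.even_mul_succ_self s).two_dvd
    obtain ⟨b, hb⟩ := (Nat.even_mul_succ_self t).two_dvd
    rw [show (s + t) * (s + t + 1) = s * (s + 1) + t * (t + 1) + 2 * (s * t) by ring]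
    omega
  rw [zeta, h, pow_add, pow_add, zeta, zeta]
  ring

/-- Here `A` stands for $(Y_1\wedge Y_2)^\sharp\lrcorner d\theta$ and `C` for
$[Y_1,Y_2]\lrcorner\theta$; the left side is the bracket of the momentum forms. The parities of `s`,
`t` and `t * s` can be treated as independent. -/
theorem smul_zeta_identity {V : Type*} [AddCommGroup V] [Module ℝ V] (s t : ℕ) (A C : V) :
    (-1 : ℝ) ^ (t + 1) • -(zeta t * zeta s) • A =
      -(-1 : ℝ) ^ (t * s + s + t) • -zeta (s + t) • C +
        ((-1 : ℝ) ^ (t * (s + 1)) * zeta (s + 1) * zeta (t + 1)) • (-1 : ℝ) ^ (t * s) •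
          ((-1 : ℝ) ^ s * (-1) ^ t) • (A + (-1 : ℝ) ^ s • C) := by
  rw [zeta_succ, zeta_succ, zeta_add, mul_comm s t]
  simp only [pow_add, mul_add, mul_one, pow_one]
  rcases neg_one_pow_eq_or ℝ s with h | h <;> rcases neg_one_pow_eq_or ℝ t with h' | h' <;>
    rcases neg_one_pow_eq_or ℝ (t * s) with h'' | h'' <;> rw [h, h', h''] <;> module

end Signs

/-! ### Momentum forms and their brackets -/

section MomentumForms

variable {E N : Type*} [NormedAddCommGroup E] [NormedSpace ℝ E] [TopologicalSpace N]
  [ChartedSpace E N] [IsManifold 𝓘(ℝ, E) ∞ N] {k : ℕ}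

theorem isForm_momentumForm {l : ℕ} (hl : l ≤ k) {Y : ExteriorAlgebra ℝ (VF 𝓘(ℝ, E) N)}
    (hY : Y ∈ ⋀[ℝ]^l (VF 𝓘(ℝ, E) N)) : IsForm (k - l) (momentumForm k l Y) := by
  rw [momentumForm_eq]
  exact isForm_contractTheta hl (Submodule.smul_mem _ _ hY)

variable [CompleteSpace E]

theorem completeLift_smul (c : ℝ) (Y : ExteriorAlgebra ℝ (VF 𝓘(ℝ, E) N)) :
    completeLift k (c • Y) = c • completeLift k Y := by
  funext μ
  exact map_smul _ c Y

theorem isMultivectorField_completeLift (hk : 1 ≤ k) {l : ℕ}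
    {Y : ExteriorAlgebra ℝ (VF 𝓘(ℝ, E) N)} (hY : Y ∈ ⋀[ℝ]^l (VF 𝓘(ℝ, E) N)) :
    IsMultivectorField l (completeLift k Y) := by
  intro μ
  change IsMultivectorFieldAt l (completeLift k Y) μ
  refine exteriorPower_induction (P := fun Y => IsMultivectorFieldAt l (completeLift k Y) μ)
    (fun v => ?_) ?_ (fun X Y hX hY => ?_) (fun r Y hY => ?_) hY
  · choose V hV using fun j => exists_completeLift (k := k) hk (v j)
    refine (isMultivectorFieldAt_ιMulti V).congr (Filter.Eventually.of_forall fun ν => ?_)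
    rw [completeLift, ExteriorAlgebra.map_apply_ιMulti]
    exact congrArg _ (funext fun j => (hV j ν).symm)
  · exact isMultivectorFieldAt_zero.congr (Filter.Eventually.of_forall fun ν => map_zero _)
  · exact (hX.add hY).congr (Filter.Eventually.of_forall fun ν => map_add _ _ _)
  · rw [completeLift_smul]
    exact hY.const_smul r

/-- Homogeneity is read off from `extD_contractTheta`, whose two terms are linear in `Y`. -/
theorem extD_contractTheta_smul (c : ℝ) (Y : ExteriorAlgebra ℝ (VF 𝓘(ℝ, E) N)) :
    extD (contractTheta k (c • Y)) = c • extD (contractTheta k Y) := by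
  rw [extD_contractTheta, extD_contractTheta, map_smul, map_smul, completeLift_smul,
    contractField_smul_left, contractTheta_smul, smul_add]

/-- The Lie kernel condition removes the `∂` term. The signs that remain are $(-1)^l$ from the
grading, $(-1)^{l+1}$ from `zeta_succ` and the minus sign in $\omega=-d\theta$. -/
theorem extD_momentumForm {l : ℕ} {Y : ExteriorAlgebra ℝ (VF 𝓘(ℝ, E) N)}
    (hY : Y ∈ lieKernel 𝓘(ℝ, E) N l) :
    extD (momentumForm k l Y) = -contractField (zeta l • completeLift k Y) (omega E N k) := by
  have h : contractTheta k (ceBoundary ℝ (VF 𝓘(ℝ, E) N) Y) = 0 := contractTheta_eq_zero hY.2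
  rw [momentumForm_eq, extD_contractTheta_smul, extD_contractTheta, grade_eq hY.1, map_smul,
    contractTheta_smul, h, smul_zero, add_zero, completeLift_smul, contractField_smul_left,
    contractField_smul_left, omega, contractField_neg_right, smul_neg, neg_neg, smul_smul,
    zeta_succ]
  congr 1
  rcases neg_one_pow_eq_or ℝ l with h | h <;> simp [pow_succ, h]

theorem isHamiltonianField_momentumForm (hk : 1 ≤ k) {l : ℕ}
    {Y : ExteriorAlgebra ℝ (VF 𝓘(ℝ, E) N)} (hY : Y ∈ lieKernel 𝓘(ℝ, E) N l) :
    IsHamiltonianField (omega E N k) l (momentumForm k l Y) (zeta l • completeLift k Y) :=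
  ⟨fun μ => IsMultivectorFieldAt.const_smul _ (isMultivectorField_completeLift hk hY.1 μ),
    extD_momentumForm hY⟩

theorem contractField_completeLift_completeLift (a b : ℝ)
    (Y₁ Y₂ : ExteriorAlgebra ℝ (VF 𝓘(ℝ, E) N)) :
    contractField (b • completeLift k Y₂) (contractField (a • completeLift k Y₁) (omega E N k)) =
      -(b * a) • contractField (completeLift k (Y₁ * Y₂)) (extD (theta E N k)) := by
  have h : contractField (completeLift k Y₂) (contractField (completeLift k Y₁)
      (extD (theta E N k))) = contractField (completeLift k (Y₁ * Y₂)) (extD (theta E N k)) := by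
    funext μ
    rw [contractField, contractField, contractField, ← contract_mul, completeLift, completeLift,
      completeLift, map_mul]
  rw [contractField_smul_left, contractField_smul_left, contractField_smul_right, omega,
    contractField_neg_right, contractField_neg_right, h, smul_neg, smul_neg, smul_smul]
  exact (neg_smul _ _).symm

theorem hamBracket_momentumForm (hk : 1 ≤ k) {s t : ℕ} (hs : 1 ≤ s)
    {Y₁ Y₂ : ExteriorAlgebra ℝ (VF 𝓘(ℝ, E) N)} (h₁ : Y₁ ∈ lieKernel 𝓘(ℝ, E) N s)
    (h₂ : Y₂ ∈ lieKernel 𝓘(ℝ, E) N t) :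
    hamBracket (omega E N k) s t (momentumForm k s Y₁) (momentumForm k t Y₂) =
      -(-1 : ℝ) ^ (t * s + s + t) • momentumForm k (s + t - 1) (schoutenVF Y₁ Y₂) +
        ((-1 : ℝ) ^ (t * (s + 1)) * zeta (s + 1) * zeta (t + 1)) •
          extD (contractField (completeLift k Y₁)
            (contractField (completeLift k Y₂) (theta E N k))) := by
  rw [hamBracket_eq (isHamiltonianField_momentumForm hk h₁)
    (isHamiltonianField_momentumForm hk h₂)]
  rw [contractField_completeLift_completeLift]
  -- Contracting by `Y₂` before `Y₁` is contraction by `Y₂ * Y₁`; reordering to `Y₁ * Y₂` gives the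
  -- sign.
  have e2 : contractField (completeLift k Y₁) (contractField (completeLift k Y₂) (theta E N k)) =
      contractTheta k (((-1 : ℝ) ^ (t * s)) • (Y₁ * Y₂)) := by
    rw [← contractTheta_one, contractField_completeLift_contractTheta,
      contractField_completeLift_contractTheta, one_mul, mul_comm_of_mem h₂.1 h₁.1]
  have e3 : contractTheta k (ceBoundary ℝ (VF 𝓘(ℝ, E) N) (Y₁ * Y₂)) =
      (-1 : ℝ) ^ s • contractTheta k (schoutenVF Y₁ Y₂) := by
    -- The two differentials vanish only pointwise, but evaluation at a point is multiplicative, so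
    -- these products vanish pointwise too.
    have h : contractTheta k (ceBoundary ℝ (VF 𝓘(ℝ, E) N) Y₁ * Y₂ +
        grade ℝ Y₁ * ceBoundary ℝ (VF 𝓘(ℝ, E) N) Y₂) = 0 :=
      contractTheta_eq_zero fun x => by rw [map_add, map_mul, map_mul, h₁.2, h₂.2]; simp
    rw [ceBoundary_mul, contractTheta_add, h, zero_add, grade_eq h₁.1, schouten_smul_left,
      contractTheta_smul]
    rfl
  have e4 : grade ℝ (Y₁ * Y₂) = ((-1 : ℝ) ^ s * (-1) ^ t) • (Y₁ * Y₂) := by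
    rw [map_mul, grade_eq h₁.1, grade_eq h₂.1, smul_mul_smul_comm]
  have e5 : extD (contractTheta k (Y₁ * Y₂)) = ((-1 : ℝ) ^ s * (-1) ^ t) •
      (contractField (completeLift k (Y₁ * Y₂)) (extD (theta E N k)) +
        (-1 : ℝ) ^ s • contractTheta k (schoutenVF Y₁ Y₂)) := by
    rw [extD_contractTheta, e4, map_smul, contractTheta_smul, e3, completeLift_smul,
      contractField_smul_left, smul_add]
  rw [e2, extD_contractTheta_smul, e5, momentumForm_eq, contractTheta_smul,
    show s + t - 1 + 1 = s + t by omega]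
  exact smul_zeta_identity (V := FormField (phaseModel E k) (PhaseSpace E N k)) s t _ _

end MomentumForms

/-! ### Forms as contractions of forms of higher degree -/

section FormDecomposition

variable {E : Type*} [NormedAddCommGroup E] [NormedSpace ℝ E]

/-- The exterior product of a linear form with an alternating form. -/
def wedgeForm (ε : E →L[ℝ] ℝ) (p : ℕ) : (E [⋀^Fin p]→L[ℝ] ℝ) →L[ℝ] (E [⋀^Fin (p + 1)]→L[ℝ] ℝ) :=
  (ContinuousAlternatingMap.alternatizeUncurryFinCLM ℝ E ℝ).comp
    (ContinuousLinearMap.smulRightL ℝ E (E [⋀^Fin p]→L[ℝ] ℝ) ε)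

theorem curryLeft_wedgeForm (ε : E →L[ℝ] ℝ) (p : ℕ) (γ : E [⋀^Fin p]→L[ℝ] ℝ) (v : E) :
    (wedgeForm ε p γ).curryLeft v = ε v • γ - gradedAlt (fun m => ε.smulRight
      (interior v (Pi.single p γ : GradedForms E) m)) p := by
  have h := congrFun (interior_gradedAlt v fun m =>
    ε.smulRight ((Pi.single p γ : GradedForms E) m)) p
  have h1 : interior v (gradedAlt fun m => ε.smulRight ((Pi.single p γ : GradedForms E) m)) p =
      (wedgeForm ε p γ).curryLeft v := by
    rw [interior_eq_curryLeft, gradedAlt_succ_apply, Pi.single_eq_same]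
    rfl
  rw [← h1, h, Pi.sub_apply]
  congr 1
  rw [ContinuousLinearMap.smulRight_apply, Pi.single_eq_same]

variable [FiniteDimensional ℝ E]

/-- The Leibniz rule gives
$\sum_a\varepsilon^a(b_a)\gamma-\sum_a\varepsilon^a\wedge(b_a\lrcorner\gamma)$. The first sum counts
the dimension; the second is the derivation by the identity, because $w=\sum_a\varepsilon^a(w)b_a$,
and counts the degree. -/
theorem sum_curryLeft_wedgeForm (p : ℕ) (γ : E [⋀^Fin p]→L[ℝ] ℝ) :
    ∑ a, (wedgeForm (LinearMap.toContinuousLinearMap ((Module.finBasis ℝ E).coord a)) p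
      γ).curryLeft (Module.finBasis ℝ E a) = ((Module.finrank ℝ E : ℝ) - p) • γ := by
  set b := Module.finBasis ℝ E
  simp_rw [curryLeft_wedgeForm, Finset.sum_sub_distrib]
  have h := formDerivation_id (Pi.single p γ : GradedForms E) p
  rw [Pi.single_eq_same] at h
  have h2 : ∑ a, gradedAlt (fun m => (LinearMap.toContinuousLinearMap (b.coord a)).smulRight
      (interior (b a) (Pi.single p γ : GradedForms E) m)) p =
      formDerivation (ContinuousLinearMap.id ℝ E) (Pi.single p γ : GradedForms E) p := by
    rw [formDerivation]
    cases p with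
    | zero => simp
    | succ p =>
      change ∑ a, ContinuousAlternatingMap.alternatizeUncurryFinCLM ℝ E ℝ
        ((LinearMap.toContinuousLinearMap (b.coord a)).smulRight
          (interior (b a) (Pi.single (p + 1) γ : GradedForms E) p)) =
        ContinuousAlternatingMap.alternatizeUncurryFinCLM ℝ E ℝ
          (((Pi.single (p + 1) γ : GradedForms E) (p + 1)).curryLeft.comp
            (ContinuousLinearMap.id ℝ E))
      rw [← map_sum]
      congr 1
      ext w : 1
      have hw := b.sum_repr w
      conv_rhs => rw [ContinuousLinearMap.comp_apply, ContinuousLinearMap.id_apply, ← hw, map_sum]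
      rw [sum_apply]
      refine Finset.sum_congr rfl fun a _ => ?_
      rw [map_smul]
      rfl
  rw [h2, h]
  simp only [LinearMap.coe_toContinuousLinearMap', Module.Basis.coord_apply,
    Module.Basis.repr_self, Finsupp.single_eq_same, one_smul, Finset.sum_const, Finset.card_univ,
    Fintype.card_fin]
  ext w
  simp [sub_mul]

/-- Alternating forms of degree at most `dim E` are sums of contractions of forms of higher degree
by constant multivectors. -/
theorem exists_sum_contract_eq (p r : ℕ) (h : p + r ≤ Module.finrank ℝ E) :
    ∃ (J : Type) (_ : Fintype J) (v : J → Fin r → E)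
      (L : J → (E [⋀^Fin p]→L[ℝ] ℝ) →L[ℝ] (E [⋀^Fin (p + r)]→L[ℝ] ℝ)),
      ∀ γ, ∑ j, contract (ExteriorAlgebra.ιMulti ℝ r (v j))
        (Pi.single (p + r) (L j γ) : GradedForms E) = Pi.single p γ := by
  induction r with
  | zero => exact ⟨Unit, inferInstance, fun _ => Fin.elim0, fun _ => ContinuousLinearMap.id ℝ _,
      fun γ => by simp⟩
  | succ r ih =>
    obtain ⟨J, hJ, v, L, hL⟩ := ih (by omega)
    set n := Module.finrank ℝ E with hn
    set b := Module.finBasis ℝ E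
    -- This is where the bound by the dimension enters: a form of top degree is not a contraction of
    -- a nonzero form of higher degree.
    have hne : ((n : ℝ) - ((p + r : ℕ) : ℝ)) ≠ 0 := by
      have : ((p + r : ℕ) : ℝ) < n := by exact_mod_cast (by omega : p + r < n)
      exact (sub_pos.2 this).ne'
    refine ⟨J × Fin n, inferInstance, fun ja => Fin.cons (b ja.2) (v ja.1),
      fun ja => ((n : ℝ) - ((p + r : ℕ) : ℝ))⁻¹ •
        (wedgeForm (LinearMap.toContinuousLinearMap (b.coord ja.2)) (p + r)).comp (L ja.1),
      fun γ => ?_⟩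
    rw [Fintype.sum_prod_type, ← hL γ]
    refine Finset.sum_congr rfl fun j _ => ?_
    have h1 (a : Fin n) : contract (ExteriorAlgebra.ιMulti ℝ (r + 1) (Fin.cons (b a) (v j)))
        (Pi.single (p + r + 1) ((((n : ℝ) - ((p + r : ℕ) : ℝ))⁻¹ •
          (wedgeForm (LinearMap.toContinuousLinearMap (b.coord a)) (p + r)).comp (L j)) γ) :
            GradedForms E) =
        contract (ExteriorAlgebra.ιMulti ℝ r (v j)) (Pi.single (p + r)
          (((n : ℝ) - ((p + r : ℕ) : ℝ))⁻¹ • (wedgeForm (LinearMap.toContinuousLinearMap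
            (b.coord a)) (p + r) (L j γ)).curryLeft (b a))) := by
      rw [ExteriorAlgebra.ιMulti_succ_apply, contract_mul, contract_ι]
      congr 1
      funext m
      rw [interior_eq_curryLeft, Fin.cons_zero]
      by_cases hm : m = p + r
      · subst hm
        rw [Pi.single_eq_same, Pi.single_eq_same]
        rfl
      · rw [Pi.single_eq_of_ne hm, Pi.single_eq_of_ne (by omega)]
        rfl
    refine (Finset.sum_congr rfl fun a _ => h1 a).trans ?_
    rw [← map_sum]
    congr 1
    have h2 := sum_curryLeft_wedgeForm (p + r) (L j γ)
    have h3 : ∑ a, ((n : ℝ) - ((p + r : ℕ) : ℝ))⁻¹ • (wedgeForm (LinearMap.toContinuousLinearMap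
        (b.coord a)) (p + r) (L j γ)).curryLeft (b a) = L j γ := by
      rw [← Finset.smul_sum, h2, smul_smul, inv_mul_cancel₀ hne, one_smul]
    conv_rhs => rw [← h3]
    exact (map_sum (LinearMap.single ℝ (fun m : ℕ => E [⋀^Fin m]→L[ℝ] ℝ) (p + r)) _ _).symm

end FormDecomposition

/-! ### Extending local data by bump functions -/

section BumpExtension

variable {E N : Type*} [NormedAddCommGroup E] [NormedSpace ℝ E] [FiniteDimensional ℝ E]
  [TopologicalSpace N] [ChartedSpace E N] [T2Space N] {k : ℕ}

/-- The closed support of the bump function lies in the chart domain. So a field cut off by it is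
zero near every point outside the domain, and smoothness there is immediate. -/
theorem bump_eventually_eq_zero {x₀ x : N} (f : SmoothBumpFunction 𝓘(ℝ, E) x₀)
    (hx : x ∉ (extChartAt 𝓘(ℝ, E) x₀).source) :
    ∀ᶠ z in 𝓝 (extChartAt 𝓘(ℝ, E) x x), f ((extChartAt 𝓘(ℝ, E) x).symm z) = 0 := by
  have h1 : ∀ᶠ y in 𝓝 x, f y = 0 :=
    notMem_tsupport_iff_eventuallyEq.1 fun h => hx (f.tsupport_subset_extChartAt_source h)
  have h2 := (continuousAt_extChartAt_symm (I := 𝓘(ℝ, E)) x).tendsto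
  rw [extChartAt_to_inv] at h2
  exact h2.eventually h1

variable [IsManifold 𝓘(ℝ, E) ∞ N]

theorem contDiffAt_bump_symm {x₀ : N} (f : SmoothBumpFunction 𝓘(ℝ, E) x₀) {z : E}
    (hz : z ∈ (extChartAt 𝓘(ℝ, E) x₀).target) :
    ContDiffAt ℝ ∞ (fun z => f ((extChartAt 𝓘(ℝ, E) x₀).symm z)) z := by
  rw [← contMDiffAt_iff_contDiffAt]
  exact f.contMDiffAt.comp z (contMDiffAt_symm hz)

/-- Constant vector fields in a chart extend to global vector fields. -/
theorem exists_vectorField_eventuallyEq (x₀ : N) (e : E) :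
    ∃ ξ : VF 𝓘(ℝ, E) N, ∀ᶠ y in 𝓝 x₀,
      evalVF y ξ = ofChart 𝓘(ℝ, E) x₀ (extChartAt 𝓘(ℝ, E) x₀ y) e := by
  obtain ⟨f⟩ : Nonempty (SmoothBumpFunction 𝓘(ℝ, E) x₀) := inferInstance
  let X : ∀ y : N, TangentSpace 𝓘(ℝ, E) y := fun y =>
    (f y • ofChart 𝓘(ℝ, E) x₀ (extChartAt 𝓘(ℝ, E) x₀ y) e : E)
  have hX (x : N) : ContMDiffAt 𝓘(ℝ, E) (𝓘(ℝ, E).prod 𝓘(ℝ, E)) ∞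
      (fun x => TotalSpace.mk' E x (X x)) x := by
    by_cases hx : x ∈ (extChartAt 𝓘(ℝ, E) x₀).source
    · rw [contMDiffAt_vectorField_iff x₀ hx]
      have hz := (extChartAt 𝓘(ℝ, E) x₀).map_source hx
      refine ((contDiffAt_bump_symm f hz).smul (contDiffAt_const (c := e))).congr_of_eventuallyEq ?_
      filter_upwards [target_mem_nhds hz] with z hz
      have h1 := toChart_comp_ofChart hz
      have h2 : toChart 𝓘(ℝ, E) x₀ ((extChartAt 𝓘(ℝ, E) x₀).symm z)
          (ofChart 𝓘(ℝ, E) x₀ z e) = e := congrArg (fun A : E →L[ℝ] E => A e) h1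
      change toChart 𝓘(ℝ, E) x₀ ((extChartAt 𝓘(ℝ, E) x₀).symm z)
        (f ((extChartAt 𝓘(ℝ, E) x₀).symm z) • ofChart 𝓘(ℝ, E) x₀
          (extChartAt 𝓘(ℝ, E) x₀ ((extChartAt 𝓘(ℝ, E) x₀).symm z)) e) = _
      rw [(extChartAt 𝓘(ℝ, E) x₀).right_inv hz, map_smul, h2]
      rfl
    · rw [contMDiffAt_vectorField_iff x (mem_extChartAt_source x)]
      refine (contDiffAt_const (c := (0 : E))).congr_of_eventuallyEq ?_
      filter_upwards [bump_eventually_eq_zero f hx] with z hz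
      change toChart 𝓘(ℝ, E) x ((extChartAt 𝓘(ℝ, E) x).symm z)
        (f ((extChartAt 𝓘(ℝ, E) x).symm z) • ofChart 𝓘(ℝ, E) x₀
          (extChartAt 𝓘(ℝ, E) x₀ ((extChartAt 𝓘(ℝ, E) x).symm z)) e) = 0
      rw [hz, zero_smul, map_zero]
  refine ⟨⟨X, hX⟩, ?_⟩
  filter_upwards [f.eventuallyEq_one] with y hy
  change f y • ofChart 𝓘(ℝ, E) x₀ (extChartAt 𝓘(ℝ, E) x₀ y) e = _
  rw [hy, Pi.one_apply, one_smul]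

/-- Smooth forms in a chart extend, after shrinking the chart, to global smooth forms. -/
theorem exists_form_eventuallyEq (x₀ : N) {g : E → E [⋀^Fin k]→L[ℝ] ℝ}
    (hg : ∀ z ∈ (extChartAt 𝓘(ℝ, E) x₀).target, ContDiffAt ℝ ∞ g z) :
    ∃ η : FormField 𝓘(ℝ, E) N, IsForm k η ∧ ∀ᶠ y in 𝓝 x₀, component η k y =
      (g (extChartAt 𝓘(ℝ, E) x₀ y)).compContinuousLinearMap (toChart 𝓘(ℝ, E) x₀ y) := by
  obtain ⟨f⟩ : Nonempty (SmoothBumpFunction 𝓘(ℝ, E) x₀) := inferInstance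
  let q : N → E [⋀^Fin k]→L[ℝ] ℝ := fun y => f y •
    (g (extChartAt 𝓘(ℝ, E) x₀ y)).compContinuousLinearMap (toChart 𝓘(ℝ, E) x₀ y)
  let η : FormField 𝓘(ℝ, E) N := fun y => (Pi.single k (q y) : GradedForms E)
  have hη (y : N) : component η k y = q y := Pi.single_eq_same _ _
  refine ⟨η, ⟨fun y m hm => Pi.single_eq_of_ne hm _, fun x => ?_⟩, ?_⟩
  · by_cases hx : x ∈ (extChartAt 𝓘(ℝ, E) x₀).source
    · rw [contMDiffAt_form_iff x₀ hx]
      have hz := (extChartAt 𝓘(ℝ, E) x₀).map_source hx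
      refine ((contDiffAt_bump_symm f hz).smul (hg _ hz)).congr_of_eventuallyEq ?_
      filter_upwards [target_mem_nhds hz] with z hz
      have h1 := toChart_comp_ofChart hz
      rw [chartForm, hη]
      change f ((extChartAt 𝓘(ℝ, E) x₀).symm z) •
        ((g (extChartAt 𝓘(ℝ, E) x₀ ((extChartAt 𝓘(ℝ, E) x₀).symm z))).compContinuousLinearMap
          ((toChart 𝓘(ℝ, E) x₀ ((extChartAt 𝓘(ℝ, E) x₀).symm z)).comp
            (ofChart 𝓘(ℝ, E) x₀ z))) = _
      rw [h1, (extChartAt 𝓘(ℝ, E) x₀).right_inv hz]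
      rfl
    · rw [contMDiffAt_form_iff x (mem_extChartAt_source x)]
      refine (contDiffAt_const (c := (0 : E [⋀^Fin k]→L[ℝ] ℝ))).congr_of_eventuallyEq ?_
      filter_upwards [bump_eventually_eq_zero f hx] with z hz
      rw [chartForm, hη]
      change (f ((extChartAt 𝓘(ℝ, E) x).symm z) • _ : E [⋀^Fin k]→L[ℝ] ℝ).compContinuousLinearMap
        _ = _
      rw [hz, zero_smul]
      rfl
  · filter_upwards [f.eventuallyEq_one] with y hy
    rw [hη]
    change f y • _ = _
    rw [hy, Pi.one_apply, one_smul]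

end BumpExtension

/-! ### Position forms and their brackets -/

section ContractSum

theorem contract_sum {V ι : Type*} [AddCommGroup V] [Module ℝ V] [TopologicalSpace V]
    (s : Finset ι) (X : ι → ExteriorAlgebra ℝ V) (α : GradedForms V) :
    contract (∑ i ∈ s, X i) α = ∑ i ∈ s, contract (X i) α := by
  classical
  induction s using Finset.induction_on with
  | empty => exact contract_zero α
  | insert i s hi ih => rw [Finset.sum_insert hi, Finset.sum_insert hi, contract_add, ih]

end ContractSum

section PositionForms

variable {E N : Type*} [NormedAddCommGroup E] [NormedSpace ℝ E] [TopologicalSpace N]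
  [ChartedSpace E N] [IsManifold 𝓘(ℝ, E) ∞ N] {k : ℕ}

/-- A field of multivectors on the phase space whose contraction with the pullback of forms along
the projection vanishes. -/
def AnnihilatesBase (X : MultivectorField (phaseModel E k) (PhaseSpace E N k)) : Prop :=
  ∀ (μ : PhaseSpace E N k) (γ : GradedForms (TangentSpace 𝓘(ℝ, E) μ.1)),
    contract (X μ) (pullback (dproj μ) γ) = 0

theorem AnnihilatesBase.sum {ι : Type*} (s : Finset ι)
    {X : ι → MultivectorField (phaseModel E k) (PhaseSpace E N k)}
    (h : ∀ i ∈ s, AnnihilatesBase (X i)) : AnnihilatesBase (∑ i ∈ s, X i) := by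
  intro μ γ
  rw [Finset.sum_apply, contract_sum]
  exact Finset.sum_eq_zero fun i hi => h i hi μ γ

/-- The product of a vertical lift and a complete lift. -/
theorem exists_verticalLift_mul_completeLift [CompleteSpace E] (hk : 1 ≤ k) (r : ℕ)
    {η : FormField 𝓘(ℝ, E) N}
    (hη : IsForm k η) (ξ : Fin r → VF 𝓘(ℝ, E) N) :
    ∃ X : MultivectorField (phaseModel E k) (PhaseSpace E N k), IsMultivectorField (r + 1) X ∧
      AnnihilatesBase X ∧ ∀ μ : PhaseSpace E N k, contract (X μ) (extD (theta E N k) μ) =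
        pullback (dproj μ) (contract (evalAt μ.1 (ExteriorAlgebra.ιMulti ℝ r ξ))
          (Pi.single k (component η k μ.1) : GradedForms E)) := by
  obtain ⟨V, hV⟩ := exists_verticalLift hη
  choose Y hY using fun j => exists_completeLift (k := k) hk (ξ j)
  let X : MultivectorField (phaseModel E k) (PhaseSpace E N k) := fun μ =>
    ExteriorAlgebra.ιMulti ℝ (r + 1) fun j => (Fin.cons V Y : Fin (r + 1) → _) j μ
  have hX (μ : PhaseSpace E N k) : X μ =
      ExteriorAlgebra.ι ℝ (verticalAt μ (component η k μ.1)) *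
        completeLift k (ExteriorAlgebra.ιMulti ℝ r ξ) μ := by
    rw [completeLift, ExteriorAlgebra.map_apply_ιMulti, ← hV]
    refine (ExteriorAlgebra.ιMulti_succ_apply _).trans ?_
    congr 2
    funext j
    exact hY j μ
  refine ⟨X, fun μ => isMultivectorFieldAt_ιMulti _, fun μ γ => ?_, fun μ => ?_⟩
  -- The vertical factor is contracted first, and it already kills every form pulled back from the
  -- base.
  · rw [hX, contract_mul, contract_ι, interior_pullback, dproj_verticalAt, map_zero]
    simp
  · rw [hX, contract_mul, contract_ι, interior_verticalAt]
    exact contract_completeLift_pullback μ _ _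

variable [FiniteDimensional ℝ E] [T2Space N]

/-- The pointwise decomposition `exists_sum_contract_eq` has constant vectors `v` and linear maps
`L`, so in a chart it writes `γ` as a sum of contractions of smooth `k`-forms by constant
multivectors. Bump functions make these data global, preserving the identity only near `x₀`. -/
theorem exists_local_hamiltonian (hk : 1 ≤ k) {p r : ℕ} (hpr : p + r = k)
    (hkn : k ≤ Module.finrank ℝ E) {γ : FormField 𝓘(ℝ, E) N} (hγ : IsForm p γ) (x₀ : N) :
    ∃ X : MultivectorField (phaseModel E k) (PhaseSpace E N k), IsMultivectorField (r + 1) X ∧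
      AnnihilatesBase X ∧ ∀ᶠ y in 𝓝 x₀, ∀ μ : PhaseSpace E N k, μ.1 = y →
        contract (X μ) (extD (theta E N k) μ) = positionForm k γ μ := by
  subst hpr
  obtain ⟨J, hJ, v, L, hL⟩ := exists_sum_contract_eq (E := E) p r hkn
  choose ξ hξ using fun j a => exists_vectorField_eventuallyEq (E := E) x₀ (v j a)
  have hg (j : J) (z : E) (hz : z ∈ (extChartAt 𝓘(ℝ, E) x₀).target) :
      ContDiffAt ℝ ∞ (fun z => L j (chartForm x₀ p γ z)) z :=
    ContDiffAt.comp (g := L j) z (L j).contDiff.contDiffAt (hγ.contDiffAt_chartForm hz p)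
  choose η hη hη' using fun j => exists_form_eventuallyEq x₀ (hg j)
  choose X hX hX' hX'' using fun j => exists_verticalLift_mul_completeLift hk r (hη j) (ξ j)
  refine ⟨∑ j, X j, fun μ => IsMultivectorFieldAt.sum _ fun j _ => hX j μ,
    AnnihilatesBase.sum _ fun j _ => hX' j, ?_⟩
  have h1 : ∀ᶠ y in 𝓝 x₀, ∀ j a, evalVF y (ξ j a) =
      ofChart 𝓘(ℝ, E) x₀ (extChartAt 𝓘(ℝ, E) x₀ y) (v j a) :=
    Filter.eventually_all.2 fun j => Filter.eventually_all.2 fun a => hξ j a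
  have h2 := Filter.eventually_all.2 hη'
  filter_upwards [h1, h2, (isOpen_extChartAt_source (I := 𝓘(ℝ, E)) x₀).mem_nhds
    (mem_extChartAt_source x₀)] with y h1 h2 hy
  rintro μ rfl
  rw [Finset.sum_apply, contract_sum]
  simp_rw [hX'']
  rw [← map_sum, positionForm]
  congr 1
  have hA (j : J) : contract (ExteriorAlgebra.map (evalVF μ.1) (ExteriorAlgebra.ιMulti ℝ r (ξ j)))
      (Pi.single (p + r) (component (η j) (p + r) μ.1) : GradedForms E) =
      pullback (toChart 𝓘(ℝ, E) x₀ μ.1) (contract (ExteriorAlgebra.ιMulti ℝ r (v j))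
        (Pi.single (p + r) (L j (chartForm x₀ p γ (extChartAt 𝓘(ℝ, E) x₀ μ.1))) :
          GradedForms E)) := by
    rw [h2, ← pullback_single, contract_pullback, ExteriorAlgebra.map_apply_ιMulti,
      ExteriorAlgebra.map_apply_ιMulti]
    congr 3
    refine congrArg _ (funext fun a => ?_)
    have h5 := toChart_comp_ofChart' hy
    change toChart 𝓘(ℝ, E) x₀ μ.1 (evalVF μ.1 (ξ j a)) = v j a
    rw [h1]
    exact congrArg (fun A : E →L[ℝ] E => A (v j a)) h5
  refine (Finset.sum_congr rfl fun j _ => hA j).trans ?_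
  rw [← map_sum, hL, pullback_single]
  have h6 := ofChart_comp_toChart' hy
  have h7 : (chartForm x₀ p γ (extChartAt 𝓘(ℝ, E) x₀ μ.1)).compContinuousLinearMap
      (toChart 𝓘(ℝ, E) x₀ μ.1) = component γ p μ.1 := by
    rw [chartForm, (extChartAt 𝓘(ℝ, E) x₀).left_inv hy]
    change (component γ p μ.1).compContinuousLinearMap
      ((ofChart 𝓘(ℝ, E) x₀ (extChartAt 𝓘(ℝ, E) x₀ μ.1)).comp (toChart 𝓘(ℝ, E) x₀ μ.1)) = _
    rw [h6]
    rfl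
  rw [h7]
  funext m
  by_cases hm : m = p
  · subst hm
    exact Pi.single_eq_same _ _
  · exact (Pi.single_eq_of_ne hm _).trans (hγ.1 _ _ hm).symm

/-- Contraction is pointwise linear in the multivector, so local solutions can be averaged. The
partition of unity lives on `N` and is pulled back along the projection, since the local solutions
work over full fibres. -/
theorem exists_multivectorField_contractField_eq [SecondCountableTopology N] (hk : 1 ≤ k) {p r : ℕ}
    (hpr : p + r = k) (hkn : k ≤ Module.finrank ℝ E) {γ : FormField 𝓘(ℝ, E) N} (hγ : IsForm p γ) :
    ∃ X : MultivectorField (phaseModel E k) (PhaseSpace E N k), IsMultivectorField (r + 1) X ∧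
      AnnihilatesBase X ∧ contractField X (extD (theta E N k)) = positionForm k γ := by
  choose X hX hX' hX'' using exists_local_hamiltonian hk hpr hkn hγ
  have hlc : LocallyCompactSpace N := ChartedSpace.locallyCompactSpace E N
  choose U hU hUo hxU using fun x₀ => eventually_nhds_iff.1 (hX'' x₀)
  obtain ⟨ρ, hρ⟩ := SmoothPartitionOfUnity.exists_isSubordinate 𝓘(ℝ, E) (s := univ)
    isClosed_univ U hUo fun x _ => mem_iUnion.2 ⟨x, hxU x⟩
  let g (i : N) : C^∞⟮phaseModel E k, PhaseSpace E N k; ℝ⟯ :=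
    ⟨fun μ => ρ i μ.1, (ρ i).contMDiff.comp (contMDiff_proj (n := ∞) (IB := 𝓘(ℝ, E))
      (fun x : N => TangentSpace 𝓘(ℝ, E) x [⋀^Fin k]→L[ℝ] Bundle.Trivial N ℝ x))⟩
  let Z : MultivectorField (phaseModel E k) (PhaseSpace E N k) := fun μ =>
    ∑ᶠ i, ρ i μ.1 • X i μ
  -- By local finiteness one finite index set serves a whole neighbourhood, as `IsMultivectorField`
  -- requires.
  have hZ (μ : PhaseSpace E N k) : ∃ s : Finset N, ∀ᶠ ν in 𝓝 μ,
      Z ν = ∑ i ∈ s, g i ν • X i ν ∧ ∑ i ∈ s, g i ν = 1 := by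
    obtain ⟨s, hs⟩ := ρ.toPartitionOfUnity.exists_finset_nhds μ.1
    have hc : Filter.Tendsto (fun ν : PhaseSpace E N k => ν.1) (𝓝 μ) (𝓝 μ.1) :=
      (FiberBundle.continuous_proj (E [⋀^Fin k]→L[ℝ] ℝ)
        (fun x : N => TangentSpace 𝓘(ℝ, E) x [⋀^Fin k]→L[ℝ] Bundle.Trivial N ℝ x)).tendsto μ
    refine ⟨s, (hc.eventually hs).mono fun ν hν => ⟨?_, hν.1⟩⟩
    refine finsum_eq_sum_of_support_subset _ fun i hi => hν.2 fun h => hi ?_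
    change ρ i ν.1 • X i ν = 0
    rw [show ρ i ν.1 = 0 from h, zero_smul]
  refine ⟨Z, fun μ => ?_, fun μ γ => ?_, funext fun μ => ?_⟩
  · obtain ⟨s, hs⟩ := hZ μ
    refine (IsMultivectorFieldAt.sum s (X := fun i ν => g i ν • X i ν) fun i _ =>
      IsMultivectorFieldAt.smul (g i) (hX i μ)).congr ?_
    filter_upwards [hs] with ν hν
    rw [hν.1, Finset.sum_apply]
  · obtain ⟨s, hs⟩ := hZ μ
    rw [hs.self_of_nhds.1, contract_sum]
    exact Finset.sum_eq_zero fun i _ => by rw [contract_smul, hX' i μ γ, smul_zero]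
  · obtain ⟨s, hs⟩ := hZ μ
    rw [contractField, hs.self_of_nhds.1, contract_sum]
    have h (i : N) : contract (g i μ • X i μ) (extD (theta E N k) μ) =
        g i μ • positionForm k γ μ := by
      rw [contract_smul]
      -- Inside `U i` the local identity holds; outside, the weight is zero.
      by_cases hi : μ.1 ∈ U i
      · rw [hU i μ.1 hi μ rfl]
      · have h0 : ρ i μ.1 = 0 := image_eq_zero_of_notMem_tsupport fun h => hi (hρ i h)
        rw [show g i μ = 0 from h0, zero_smul, zero_smul]
    rw [Finset.sum_congr rfl fun i _ => h i, ← Finset.sum_smul, hs.self_of_nhds.2, one_smul]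

/-- Apply the previous result to `dα`, of degree `k - i + 1`: one vertical factor and `i - 1`
complete lifts make a multivector of degree `i`. As `ω = -dθ`, the signs cancel. -/
theorem exists_hamiltonianField_positionForm [SecondCountableTopology N]
    (hkn : k ≤ Module.finrank ℝ E) {i : ℕ} (hi : 1 ≤ i) (hik : i ≤ k) {α : FormField 𝓘(ℝ, E) N}
    (hα : IsForm (k - i) α) :
    ∃ X, IsHamiltonianField (omega E N k) i (positionForm k α) X ∧ AnnihilatesBase X := by
  obtain ⟨X, hX, hX', h⟩ := exists_multivectorField_contractField_eq (hi.trans hik)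
    (show k - i + 1 + (i - 1) = k by omega) hkn hα.extD
  rw [Nat.sub_add_cancel hi] at hX
  refine ⟨X, ⟨hX, ?_⟩, hX'⟩
  rw [extD_positionForm hα, omega, contractField_neg_right, neg_neg, h]

/-- The contraction of `ω` by a Hamiltonian field of the first form is, up to sign, pulled back from
the base, so the field chosen for the second form annihilates it. -/
theorem hamBracket_positionForm [SecondCountableTopology N]
    (hkn : k ≤ Module.finrank ℝ E) {i j : ℕ} (hi : 1 ≤ i) (hik : i ≤ k) (hj : 1 ≤ j) (hjk : j ≤ k)
    {α β : FormField 𝓘(ℝ, E) N} (hα : IsForm (k - i) α) (hβ : IsForm (k - j) β) :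
    hamBracket (omega E N k) i j (positionForm k α) (positionForm k β) = 0 := by
  obtain ⟨X, hX, -⟩ := exists_hamiltonianField_positionForm hkn hi hik hα
  obtain ⟨Y, hY, hY'⟩ := exists_hamiltonianField_positionForm hkn hj hjk hβ
  have h : contractField X (omega E N k) = -positionForm k (extD α) := by
    rw [← extD_positionForm hα, hX.2, neg_neg]
  have h2 : contractField Y (positionForm k (extD α)) = 0 := funext fun μ => hY' μ _
  rw [hamBracket_eq hX hY, h, contractField_neg_right, h2, neg_zero, smul_zero]

/-- The contraction of `ω` by a Hamiltonian field of the position form is `-π^* dα`, and the lift of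
`Y` contracts it through its projection `Y`. The minus sign turns $(-1)^{j+1}$ into $(-1)^j$. -/
theorem hamBracket_positionForm_momentumForm [SecondCountableTopology N]
    (hkn : k ≤ Module.finrank ℝ E) {i j : ℕ} (hi : 1 ≤ i) (hik : i ≤ k)
    {α : FormField 𝓘(ℝ, E) N} (hα : IsForm (k - i) α)
    {Y : ExteriorAlgebra ℝ (VF 𝓘(ℝ, E) N)} (hY : Y ∈ lieKernel 𝓘(ℝ, E) N j) :
    hamBracket (omega E N k) i j (positionForm k α) (momentumForm k j Y) =
      ((-1 : ℝ) ^ j * zeta j) •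
        positionForm k (contractField (toMultivectorField Y) (extD α)) := by
  obtain ⟨X, hX, -⟩ := exists_hamiltonianField_positionForm hkn hi hik hα
  have h : contractField X (omega E N k) = -positionForm k (extD α) := by
    rw [← extD_positionForm hα, hX.2, neg_neg]
  have h2 : contractField (completeLift k Y) (positionForm k (extD α)) =
      positionForm k (contractField (toMultivectorField Y) (extD α)) :=
    funext fun μ => contract_completeLift_pullback μ Y _
  rw [hamBracket_eq hX (isHamiltonianField_momentumForm (hi.trans hik) hY), h,
    contractField_neg_right, contractField_smul_left, h2, pow_succ]
  module

end PositionForms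

end MultiPhase

end

theorem mainTheorem11 {E : Type*} [NormedAddCommGroup E] [NormedSpace ℝ E] [FiniteDimensional ℝ E]
    {N : Type*} [TopologicalSpace N] [ChartedSpace E N] [IsManifold 𝓘(ℝ, E) ∞ N] [T2Space N]
    [SecondCountableTopology N] (k : ℕ) (hk : 1 ≤ k) (hkn : k ≤ Module.finrank ℝ E) :
    -- momentum forms are Hamiltonian, with Hamiltonian multivector field `ζ(l) Y♯`
    (∀ l : ℕ, 1 ≤ l → l ≤ k → ∀ Y ∈ MultiPhase.lieKernel 𝓘(ℝ, E) N l,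
      MultiPhase.IsHamiltonianForm (MultiPhase.omega E N k) k l (MultiPhase.momentumForm k l Y) ∧
      MultiPhase.IsHamiltonianField (MultiPhase.omega E N k) l (MultiPhase.momentumForm k l Y)
        (MultiPhase.zeta l • MultiPhase.completeLift k Y)) ∧
    -- the bracket of two momentum forms
    (∀ s t : ℕ, 1 ≤ s → s ≤ k → 1 ≤ t → t ≤ k →
      ∀ Y₁ ∈ MultiPhase.lieKernel 𝓘(ℝ, E) N s, ∀ Y₂ ∈ MultiPhase.lieKernel 𝓘(ℝ, E) N t,
      MultiPhase.hamBracket (MultiPhase.omega E N k) s t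
          (MultiPhase.momentumForm k s Y₁) (MultiPhase.momentumForm k t Y₂) =
        -(-1 : ℝ) ^ (t * s + s + t) •
            MultiPhase.momentumForm k (s + t - 1) (MultiPhase.schoutenVF Y₁ Y₂) +
          ((-1 : ℝ) ^ (t * (s + 1)) * MultiPhase.zeta (s + 1) * MultiPhase.zeta (t + 1)) •
            MultiPhase.extD (MultiPhase.contractField (MultiPhase.completeLift k Y₁)
              (MultiPhase.contractField (MultiPhase.completeLift k Y₂)
                (MultiPhase.theta E N k)))) ∧
    -- position forms are Hamiltonian
    (∀ i : ℕ, 1 ≤ i → i ≤ k → ∀ α : MultiPhase.FormField 𝓘(ℝ, E) N, MultiPhase.IsForm (k - i) α →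
      MultiPhase.IsHamiltonianForm (MultiPhase.omega E N k) k i
        (MultiPhase.positionForm k α)) ∧
    -- the bracket of two position forms
    (∀ i j : ℕ, 1 ≤ i → i ≤ k → 1 ≤ j → j ≤ k →
      ∀ α β : MultiPhase.FormField 𝓘(ℝ, E) N, MultiPhase.IsForm (k - i) α →
        MultiPhase.IsForm (k - j) β →
      MultiPhase.hamBracket (MultiPhase.omega E N k) i j
        (MultiPhase.positionForm k α) (MultiPhase.positionForm k β) = 0) ∧
    -- the bracket of a position form and a momentum form
    (∀ i j : ℕ, 1 ≤ i → i ≤ k → 1 ≤ j → j ≤ k →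
      ∀ α : MultiPhase.FormField 𝓘(ℝ, E) N, MultiPhase.IsForm (k - i) α →
      ∀ Y ∈ MultiPhase.lieKernel 𝓘(ℝ, E) N j,
      MultiPhase.hamBracket (MultiPhase.omega E N k) i j
          (MultiPhase.positionForm k α) (MultiPhase.momentumForm k j Y) =
        ((-1 : ℝ) ^ j * MultiPhase.zeta j) •
          MultiPhase.positionForm k
            (MultiPhase.contractField (MultiPhase.toMultivectorField Y)
              (MultiPhase.extD α))) := by
  refine ⟨fun l hl hlk Y hY => ?_, fun s t hs _ _ _ Y₁ h₁ Y₂ h₂ =>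
    MultiPhase.hamBracket_momentumForm hk hs h₁ h₂, fun i hi hik α hα => ?_,
    fun i j hi hik hj hjk α β hα hβ =>
      MultiPhase.hamBracket_positionForm hkn hi hik hj hjk hα hβ,
    fun i j hi hik _ _ α hα Y hY =>
      MultiPhase.hamBracket_positionForm_momentumForm hkn hi hik hα hY⟩
  · have h := MultiPhase.isHamiltonianField_momentumForm hk hY
    exact ⟨⟨MultiPhase.isForm_momentumForm hlk hY.1, _, h⟩, h⟩
  · obtain ⟨X, hX, -⟩ := MultiPhase.exists_hamiltonianField_positionForm hkn hi hik hα
    exact ⟨MultiPhase.isForm_positionForm hα, X, hX⟩
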